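/- Consider pairs $(f,\lambda)$ of smooth real functions $f=f(t,x)$, $\lambda=\lambda(t)$, defined over open sets of the $(t,x)$-plane, with $f_{xxx}=0$, $\lambda_t=f_{xx}\lambda$ and $f\lambda\ne0$. To each such pair associate the potential system $$\mathcal R_{f,\lambda}\colon\quad v_x=\lambda u,\qquad v_t=-\lambda\left(\tfrac12u^2+fu_x-f_xu\right)$$ for $(u,v)$ and the potential equation $$\mathcal P_{f,\lambda}\colon\quad v_t+\frac1{2\lambda}v_x^2+fv_{xx}-f_xv_x=0$$ for $v$. All considerations are local: equations are considered on open sets $D$ of the space of $(t,x,v)$ (resp. $W$ of the space of $(t,x,u,v)$) lying over the domain of $(f,\lambda)$, and a point transformation is a smooth diffeomorphism between two such open sets. It is admissible if it maps the source equation (system) to the target one, i.e. whenever it takes the germ of the graph of a smooth function to the germ of the graph of a smooth function, the jet of the first function at the base point satisfies the source equation if and only if the jet of the second one satisfies the target equation. Lemma. For each of the two classes the admissible transformations form a groupoid (the equivalence groupoid of the class), and the two equivalence groupoids are isomorphic in the following sense. Assigning to $\mathcal P_{f,\lambda}$ on $D$ the system $\mathcal R_{f,\lambda}$ on $\{(t,x,u,v)\mid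 (t,x,v)\in D,\ u\in\mathbb R\}$ is injective, and there are bijections, compatible with composition and identities, between the admissible transformations from $\mathcal P_{f,\lambda}$ on $D$ to $\mathcal P_{\tilde f,\tilde\lambda}$ on $\tilde D$ and those between the corresponding systems. The bijection is the prolongation to $u$ according to $u=v_x/\lambda$, and its inverse is the projection to the space of $(t,x,v)$. Moreover, every admissible transformation between potential systems, on arbitrary open sets of the space of $(t,x,u,v)$, coincides near each point of its domain with the prolongation of an admissible transformation between the potential equations with the same arbitrary elements $(f,\lambda)$, $(\tilde f,\tilde\lambda)$. -/

import Mathlib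

open Set Filter Topology CategoryTheory
open scoped ContDiff

namespace PotentialBurgers

/-! Functions of two independent variables `(t, x)` and their partial derivatives. -/

/-- Partial derivative with respect to `t`. -/
noncomputable def dt (g : ℝ × ℝ → ℝ) (z : ℝ × ℝ) : ℝ := deriv (fun s => g (s, z.2)) z.1

/-- Partial derivative with respect to `x`. -/
noncomputable def dx (g : ℝ × ℝ → ℝ) (z : ℝ × ℝ) : ℝ := deriv (fun y => g (z.1, y)) z.2

/-- The extended arbitrary element `(f, λ)` with `f = f(t,x)`, `λ = λ(t)`, defined over an open set
`dom` of the `(t,x)`-plane and satisfying `f_xxx = 0`, `λ_t = f_xx λ`, `f λ ≠ 0` there. -/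
structure ArbElem where
  dom : Set (ℝ × ℝ)
  isOpen_dom : IsOpen dom
  f : ℝ × ℝ → ℝ
  lam : ℝ → ℝ
  smooth_f : ContDiffOn ℝ ∞ f dom
  smooth_lam : ∀ z ∈ dom, ContDiffAt ℝ ∞ lam z.1
  f_xxx : ∀ z ∈ dom, dx (dx (dx f)) z = 0
  lam_t : ∀ z ∈ dom, deriv lam z.1 = dx (dx f) z * lam z.1
  ne_zero : ∀ z ∈ dom, f z * lam z.1 ≠ 0

/-- A parameterized family of (systems of) differential equations for `F`-valued functions of
`(t,x)`: `E θ s z` says that the equation with the arbitrary element `θ` is satisfied by `s` at the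
point `z`, that is, that the jet of `s` at `z` belongs to the manifold of the equation. -/
abbrev EqClass (F : Type) := ArbElem → (ℝ × ℝ → F) → ℝ × ℝ → Prop

/-- The class of potential equations,
`v_t + v_x ^ 2 / (2 λ) + f v_xx - f_x v_x = 0`. -/
def potentialEquation : EqClass ℝ := fun θ v z =>
  dt v z + 1 / (2 * θ.lam z.1) * dx v z ^ 2 + θ.f z * dx (dx v) z - dx θ.f z * dx v z = 0

/-- The class of potential systems for the pair `s = (u, v)`,
`v_x = λ u`, `v_t = - λ (u ^ 2 / 2 + f u_x - f_x u)`. -/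
def potentialSystem : EqClass (ℝ × ℝ) := fun θ s z =>
  let u : ℝ × ℝ → ℝ := fun y => (s y).1
  let v : ℝ × ℝ → ℝ := fun y => (s y).2
  dx v z = θ.lam z.1 * u z ∧
    dt v z = - θ.lam z.1 * (1 / 2 * u z ^ 2 + θ.f z * dx u z - dx θ.f z * u z)

section Transformations

variable {F : Type} [NormedAddCommGroup F] [NormedSpace ℝ F]

/-- An arbitrary element together with an open set of the space of independent and dependent
variables (lying over the domain of the arbitrary element) on which the equation is considered. -/
structure LocalEq (F : Type) [NormedAddCommGroup F] [NormedSpace ℝ F] where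
  elem : ArbElem
  carrier : Set (ℝ × ℝ × F)
  isOpen_carrier : IsOpen carrier
  over_dom : ∀ p ∈ carrier, (p.1, p.2.1) ∈ elem.dom

open Classical in
/-- Extension by zero of a map between subsets. -/
noncomputable def extendZero {E : Type} [Zero E] {S S' : Set E} (g : S → S') (p : E) : E :=
  if h : p ∈ S then (g ⟨p, h⟩ : E) else 0

theorem extendZero_of_mem {E : Type} [Zero E] {S S' : Set E} (g : S → S') {p : E} (h : p ∈ S) :
    extendZero g p = g ⟨p, h⟩ := dif_pos h

/-- A (local) point transformation: a smooth diffeomorphism between the open sets of the source and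
of the target. -/
@[ext]
structure PointTransf (A B : LocalEq F) where
  toEquiv : A.carrier ≃ B.carrier
  smooth : ContDiffOn ℝ ∞ (extendZero toEquiv) A.carrier
  smooth_symm : ContDiffOn ℝ ∞ (extendZero toEquiv.symm) B.carrier

/-- The transformation as a map of the whole space, by zero outside its domain. -/
noncomputable def PointTransf.map {A B : LocalEq F} (φ : PointTransf A B) :
    ℝ × ℝ × F → ℝ × ℝ × F := extendZero φ.toEquiv

theorem contDiffOn_extendZero_id (A : LocalEq F) :
    ContDiffOn ℝ ∞ (extendZero (Equiv.refl A.carrier)) A.carrier :=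
  contDiffOn_id.congr fun p hp => by simp [extendZero_of_mem _ hp]

theorem contDiffOn_extendZero_comp {A B C : LocalEq F} (g : A.carrier ≃ B.carrier)
    (h : B.carrier ≃ C.carrier) (hg : ContDiffOn ℝ ∞ (extendZero g) A.carrier)
    (hh : ContDiffOn ℝ ∞ (extendZero h) B.carrier) :
    ContDiffOn ℝ ∞ (extendZero (g.trans h)) A.carrier := by
  refine (hh.comp hg fun p hp => ?_).congr fun p hp => ?_
  · rw [extendZero_of_mem _ hp]; exact (g ⟨p, hp⟩).2
  · simp [extendZero_of_mem _ hp]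
    rw [extendZero_of_mem _ (g ⟨p, hp⟩).2]

/-- The groupoid of all point transformations; `φ ≫ ψ` is `φ` followed by `ψ`. -/
instance : Groupoid (LocalEq F) where
  Hom A B := PointTransf A B
  id A := ⟨Equiv.refl _, contDiffOn_extendZero_id A, contDiffOn_extendZero_id A⟩
  comp φ ψ := ⟨φ.toEquiv.trans ψ.toEquiv,
    contDiffOn_extendZero_comp _ _ φ.smooth ψ.smooth,
    contDiffOn_extendZero_comp _ _ ψ.smooth_symm φ.smooth_symm⟩
  inv φ := ⟨φ.toEquiv.symm, φ.smooth_symm, φ.smooth⟩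
  id_comp _ := PointTransf.ext rfl
  comp_id _ := PointTransf.ext rfl
  assoc _ _ _ := PointTransf.ext rfl
  inv_comp φ := PointTransf.ext (Equiv.symm_trans_self φ.toEquiv)
  comp_inv φ := PointTransf.ext (Equiv.self_trans_symm φ.toEquiv)

/-- The graph of a function of `(t,x)`. -/
def graph (s : ℝ × ℝ → F) : Set (ℝ × ℝ × F) := {p | p.2.2 = s (p.1, p.2.1)}

/-- The transformation `φ` takes the germ of the function `s` at `z` to the germ of the function
`s'` at `z'`: near the point `(z, s z)` it maps the graph of `s` onto the graph of `s'`. -/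
def Transforms {A B : LocalEq F} (φ : A ⟶ B) (s : ℝ × ℝ → F) (z : ℝ × ℝ)
    (s' : ℝ × ℝ → F) (z' : ℝ × ℝ) : Prop :=
  (z.1, z.2, s z) ∈ A.carrier ∧ PointTransf.map φ (z.1, z.2, s z) = (z'.1, z'.2, s' z') ∧
    ∀ᶠ p in 𝓝 (z.1, z.2, s z), p ∈ graph s ↔ PointTransf.map φ p ∈ graph s'

/-- `φ` maps the source equation to the target equation: wherever the prolongation of `φ` to
jets of functions is defined, a jet satisfies the source equation if and only if its image
satisfies the target equation. -/
def IsAdmissible (E : EqClass F) {A B : LocalEq F} (φ : A ⟶ B) : Prop :=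
  ∀ (s s' : ℝ × ℝ → F) (z z' : ℝ × ℝ), ContDiffAt ℝ ∞ s z → ContDiffAt ℝ ∞ s' z' →
    Transforms φ s z s' z' → (E A.elem s z ↔ E B.elem s' z')

/-- `G` is the equivalence groupoid of the class `E`: its objects are all the equations of the
class on all open sets and its arrows are exactly the admissible transformations. -/
def IsEquivalenceGroupoid (E : EqClass F) (G : Subgroupoid (LocalEq F)) : Prop :=
  G.IsWide ∧ ∀ A B : LocalEq F, G.arrows A B = {φ | IsAdmissible E φ}

end Transformations

/-- The arbitrary element of `A` considered on the open set of all `(t,x,u,v)` with `(t,x,v)` in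
the open set of `A` and with arbitrary `u`. -/
def cylinder (A : LocalEq ℝ) : LocalEq (ℝ × ℝ) where
  elem := A.elem
  carrier := {q | (q.1, q.2.1, q.2.2.2) ∈ A.carrier}
  isOpen_carrier := A.isOpen_carrier.preimage (by fun_prop)
  over_dom := fun _ hq => A.over_dom _ hq

/-- `φ` is the projection of `ψ` to the space of `(t,x,v)`. -/
def IsProjection {A B : LocalEq ℝ} (ψ : cylinder A ⟶ cylinder B) (φ : A ⟶ B) : Prop :=
  ∀ t x u v : ℝ, (t, x, v) ∈ A.carrier →
    PointTransf.map φ (t, x, v) =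
      ((PointTransf.map ψ (t, x, u, v)).1, (PointTransf.map ψ (t, x, u, v)).2.1,
        (PointTransf.map ψ (t, x, u, v)).2.2.2)

/-- `ψ` is the prolongation of `φ` to `u` according to `u = v_x / λ`: it projects to `φ`, and its
`u`-component takes `v_x / λ` to the value of the same expression for the transformed function. -/
def IsProlongation {A B : LocalEq ℝ} (φ : A ⟶ B) (ψ : cylinder A ⟶ cylinder B) : Prop :=
  IsProjection ψ φ ∧
    ∀ (v v' : ℝ × ℝ → ℝ) (z z' : ℝ × ℝ), ContDiffAt ℝ ∞ v z → ContDiffAt ℝ ∞ v' z' →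
      Transforms φ v z v' z' →
        (PointTransf.map ψ (z.1, z.2, dx v z / A.elem.lam z.1, v z)).2.2.1 =
          dx v' z' / B.elem.lam z'.1

end PotentialBurgers

/-!
Admissible transformations of the potential equations and of the potential systems are determined
by their action on jets, and the proof identifies both kinds of transformations with explicit
geometric conditions on the differential of the transformation.

*Potential equations.* For a transformation `t' = T`, `x' = X`, `v' = V`, almost every second-order
jet satisfying the source equation is mapped to a jet of a function (`exists_transforms`), which
then satisfies the target equation. The derivative `v_tt` does not occur in the source equation, and
its coefficient in the transformed equation is a multiple of `(D_x T) ^ 2`; hence `T = T(t)`. The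
comparison of the coefficients of `v_xx` gives `f (D_x X) ^ 2 = T_t f'` for all values of `v_x`, so
`X = X(t,x)`. Such transformations (`IsFibered`) map all graphs to graphs, and this is what makes
admissibility stable under composition.

*Potential systems.* In a first-order jet at `(t,x,u,v)` that satisfies the system, `u_t` and `u_x`
are arbitrary, `v_x = λ u`, and `v_t` is an affine function of `u_x` with the slope `-λ f ≠ 0`.
Linear algebra (`covector_eq_zero`) shows that `dt'` and `dv' - λ' u' dx'` are combinations of `dt`
and `dv - λ u dx`, at least at those points over which some jet is mapped to the jet of a function.
As `dv - λ u dx` is not integrable modulo `dt`, these points are dense and `T = T(t)`. The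
coefficients of `u_x` in the second equation give `X_u = V_u = 0` and
`f (X_x + λ u X_v) ^ 2 = T_t f'`, and the right-hand side does not depend on `u`, so `X_v = 0`.
Therefore, the transformation projects to `(t,x,v)`, and its `u`-component is determined by
`V_x + λ u V_v = λ' U X_x` (`IsProjectable`). Conversely, a transformation of this form is
admissible if and only if one more expression, `sysDefect`, vanishes.

*Prolongation.* A function `v` has the lift `(v_x / λ, v)`, and the potential
equation for `v` is the potential system for its lift. The prolongation of a fibered
transformation maps lifts to lifts, every point of a cylinder lies on a lift, and every first-order
jet satisfying the system is the jet of a lift. So prolongations are unique, are compatible with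
composition, and preserve and reflect admissibility.

*Localization.* On an arbitrary open set of the space of `(t,x,u,v)`, a projectable transformation
projects near each point, and it coincides there with the prolongation of its projection. The
prolongation is defined for all values of `u`. It remains admissible because `sysDefect` of a
prolongation is a polynomial in `u` and vanishes on an open interval.
-/

namespace PotentialBurgers

/-! ### Point transformations and their differentials -/

section General

variable {F : Type} [NormedAddCommGroup F] [NormedSpace ℝ F] {A B C : LocalEq F}

/-- The differential of a point transformation, as a map of the whole space. -/
noncomputable abbrev tangent (φ : A ⟶ B) (p : ℝ × ℝ × F) : (ℝ × ℝ × F) →L[ℝ] (ℝ × ℝ × F) :=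
  fderiv ℝ (PointTransf.map φ) p

theorem map_mem (φ : A ⟶ B) {p : ℝ × ℝ × F} (hp : p ∈ A.carrier) :
    PointTransf.map φ p ∈ B.carrier := by
  unfold PointTransf.map
  rw [extendZero_of_mem _ hp]
  exact (PointTransf.toEquiv φ ⟨p, hp⟩).2

theorem map_inv_map (φ : A ⟶ B) {p : ℝ × ℝ × F} (hp : p ∈ A.carrier) :
    PointTransf.map (Groupoid.inv φ) (PointTransf.map φ p) = p := by
  have h : PointTransf.map φ p = (PointTransf.toEquiv φ ⟨p, hp⟩ : ℝ × ℝ × F) :=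
    extendZero_of_mem _ hp
  rw [h]
  have h2 := extendZero_of_mem (PointTransf.toEquiv φ).symm (PointTransf.toEquiv φ ⟨p, hp⟩).2
  exact h2.trans (by simp)

theorem map_map_inv (φ : A ⟶ B) {p : ℝ × ℝ × F} (hp : p ∈ B.carrier) :
    PointTransf.map φ (PointTransf.map (Groupoid.inv φ) p) = p :=
  map_inv_map (Groupoid.inv φ) hp

theorem map_id {p : ℝ × ℝ × F} (hp : p ∈ A.carrier) : PointTransf.map (𝟙 A) p = p :=
  extendZero_of_mem _ hp

theorem map_comp (φ : A ⟶ B) (ψ : B ⟶ C) {p : ℝ × ℝ × F} (hp : p ∈ A.carrier) :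
    PointTransf.map (φ ≫ ψ) p = PointTransf.map ψ (PointTransf.map φ p) := by
  have h : PointTransf.map φ p = (PointTransf.toEquiv φ ⟨p, hp⟩ : ℝ × ℝ × F) :=
    extendZero_of_mem _ hp
  rw [h]
  have h1 : PointTransf.map (φ ≫ ψ) p = (PointTransf.toEquiv (φ ≫ ψ) ⟨p, hp⟩ : ℝ × ℝ × F) :=
    extendZero_of_mem _ hp
  rw [h1]
  exact (extendZero_of_mem (PointTransf.toEquiv ψ) (PointTransf.toEquiv φ ⟨p, hp⟩).2).symm

theorem map_injOn (φ : A ⟶ B) : InjOn (PointTransf.map φ) A.carrier := fun p hp q hq h => by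
  rw [← map_inv_map φ hp, h, map_inv_map φ hq]

theorem ext_map {φ ψ : A ⟶ B} (h : ∀ p ∈ A.carrier, PointTransf.map φ p = PointTransf.map ψ p) :
    φ = ψ := by
  refine PointTransf.ext (Equiv.ext fun p => Subtype.ext ?_)
  have h1 := h p p.2
  unfold PointTransf.map at h1
  rwa [extendZero_of_mem _ p.2, extendZero_of_mem _ p.2] at h1

theorem contDiffAt_map (φ : A ⟶ B) {p : ℝ × ℝ × F} (hp : p ∈ A.carrier) :
    ContDiffAt ℝ ∞ (PointTransf.map φ) p :=
  (PointTransf.smooth φ).contDiffAt (A.isOpen_carrier.mem_nhds hp)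

theorem hasFDerivAt_map (φ : A ⟶ B) {p : ℝ × ℝ × F} (hp : p ∈ A.carrier) :
    HasFDerivAt (PointTransf.map φ) (tangent φ p) p :=
  ((contDiffAt_map φ hp).differentiableAt (by simp)).hasFDerivAt

theorem contDiffAt_tangent (φ : A ⟶ B) {p : ℝ × ℝ × F} (hp : p ∈ A.carrier) :
    ContDiffAt ℝ ∞ (tangent φ) p :=
  (contDiffAt_map φ hp).fderiv_right (by norm_cast)

theorem tangent_inv_tangent (φ : A ⟶ B) {p : ℝ × ℝ × F} (hp : p ∈ A.carrier) (w : ℝ × ℝ × F) :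
    tangent (Groupoid.inv φ) (PointTransf.map φ p) (tangent φ p w) = w := by
  have h1 := (hasFDerivAt_map (Groupoid.inv φ) (map_mem φ hp)).comp p (hasFDerivAt_map φ hp)
  have h2 : HasFDerivAt (PointTransf.map (Groupoid.inv φ) ∘ PointTransf.map φ)
      (ContinuousLinearMap.id ℝ (ℝ × ℝ × F)) p := by
    refine (hasFDerivAt_id p).congr_of_eventuallyEq ?_
    filter_upwards [A.isOpen_carrier.mem_nhds hp] with q hq using map_inv_map φ hq
  exact DFunLike.congr_fun (h1.unique h2) w

theorem tangent_tangent_inv (φ : A ⟶ B) {p : ℝ × ℝ × F} (hp : p ∈ A.carrier) (w : ℝ × ℝ × F) :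
    tangent φ p (tangent (Groupoid.inv φ) (PointTransf.map φ p) w) = w := by
  have h := tangent_inv_tangent (Groupoid.inv φ) (map_mem φ hp) w
  rw [map_inv_map φ hp] at h
  exact h

theorem tangent_injective (φ : A ⟶ B) {p : ℝ × ℝ × F} (hp : p ∈ A.carrier) {w : ℝ × ℝ × F}
    (h : tangent φ p w = 0) : w = 0 := by
  rw [← tangent_inv_tangent φ hp w, h, map_zero]

/-- Commutation of the second partial derivatives of a component of a point transformation. -/
theorem fderiv_tangent_comm (φ : A ⟶ B) {p : ℝ × ℝ × F} (hp : p ∈ A.carrier) (w e : ℝ × ℝ × F) :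
    fderiv ℝ (tangent φ) p e w = fderiv ℝ (tangent φ) p w e :=
  ((contDiffAt_map φ hp).isSymmSndFDerivAt (by
    rw [minSmoothness_of_isRCLikeNormedField]; exact WithTop.coe_le_coe.2 le_top)).eq e w

/-! ### The action of point transformations on germs of functions -/

/-- The point of the graph of `s` over `z`. -/
def graphPt (s : ℝ × ℝ → F) (z : ℝ × ℝ) : ℝ × ℝ × F := (z.1, z.2, s z)

/-- The map `z ↦ z'` of the independent variables induced by a transformation on the graph of
`s`. -/
noncomputable def baseMap (φ : A ⟶ B) (s : ℝ × ℝ → F) (z : ℝ × ℝ) : ℝ × ℝ :=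
  ((PointTransf.map φ (graphPt s z)).1, (PointTransf.map φ (graphPt s z)).2.1)

theorem hasFDerivAt_graphPt {s : ℝ × ℝ → F} {z : ℝ × ℝ} (hs : DifferentiableAt ℝ s z) :
    HasFDerivAt (graphPt s) ((ContinuousLinearMap.fst ℝ ℝ ℝ).prod
      ((ContinuousLinearMap.snd ℝ ℝ ℝ).prod (fderiv ℝ s z))) z :=
  hasFDerivAt_fst.prodMk (hasFDerivAt_snd.prodMk hs.hasFDerivAt)

theorem contDiffAt_graphPt {s : ℝ × ℝ → F} {z : ℝ × ℝ} (hs : ContDiffAt ℝ ∞ s z) :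
    ContDiffAt ℝ ∞ (graphPt s) z :=
  contDiffAt_fst.prodMk (contDiffAt_snd.prodMk hs)

theorem hasFDerivAt_map_graphPt (φ : A ⟶ B) {s : ℝ × ℝ → F} {z : ℝ × ℝ}
    (hz : graphPt s z ∈ A.carrier) (hs : DifferentiableAt ℝ s z) :
    HasFDerivAt (fun y => PointTransf.map φ (graphPt s y))
      ((tangent φ (graphPt s z)).comp ((ContinuousLinearMap.fst ℝ ℝ ℝ).prod
      ((ContinuousLinearMap.snd ℝ ℝ ℝ).prod (fderiv ℝ s z)))) z :=
  (hasFDerivAt_map φ hz).comp z (hasFDerivAt_graphPt hs)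

/-- The tangent vector to the graph of `s` over the vector `w`. -/
noncomputable def graphVec (s : ℝ × ℝ → F) (z w : ℝ × ℝ) : ℝ × ℝ × F := (w.1, w.2, fderiv ℝ s z w)

/-- The differential of `baseMap`. -/
noncomputable def baseVec (φ : A ⟶ B) (s : ℝ × ℝ → F) (z w : ℝ × ℝ) : ℝ × ℝ :=
  ((tangent φ (graphPt s z) (graphVec s z w)).1, (tangent φ (graphPt s z) (graphVec s z w)).2.1)

theorem exists_hasFDerivAt_baseMap (φ : A ⟶ B) {s : ℝ × ℝ → F} {z : ℝ × ℝ}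
    (hz : graphPt s z ∈ A.carrier) (hs : DifferentiableAt ℝ s z) :
    ∃ L : (ℝ × ℝ) →L[ℝ] (ℝ × ℝ), HasFDerivAt (baseMap φ s) L z ∧ ∀ w, L w = baseVec φ s z w :=
  ⟨_, (hasFDerivAt_map_graphPt φ hz hs).fst.prodMk (hasFDerivAt_map_graphPt φ hz hs).snd.fst,
    fun _ => rfl⟩

theorem contDiffAt_map_graphPt (φ : A ⟶ B) {s : ℝ × ℝ → F} {z : ℝ × ℝ}
    (hz : graphPt s z ∈ A.carrier) (hs : ContDiffAt ℝ ∞ s z) :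
    ContDiffAt ℝ ∞ (fun y => PointTransf.map φ (graphPt s y)) z :=
  (contDiffAt_map φ hz).comp z (contDiffAt_graphPt hs)

theorem eventually_graphPt_mem {s : ℝ × ℝ → F} {z : ℝ × ℝ} (hz : graphPt s z ∈ A.carrier)
    (hs : ContinuousAt s z) : ∀ᶠ y in 𝓝 z, graphPt s y ∈ A.carrier := by
  have : ContinuousAt (graphPt s) z := continuousAt_fst.prodMk (continuousAt_snd.prodMk hs)
  exact this.eventually (A.isOpen_carrier.mem_nhds hz)

theorem Transforms.mem {φ : A ⟶ B} {s s' : ℝ × ℝ → F} {z z' : ℝ × ℝ}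
    (h : Transforms φ s z s' z') : graphPt s z ∈ A.carrier := h.1

theorem Transforms.map_eq {φ : A ⟶ B} {s s' : ℝ × ℝ → F} {z z' : ℝ × ℝ}
    (h : Transforms φ s z s' z') : PointTransf.map φ (graphPt s z) = graphPt s' z' := h.2.1

theorem Transforms.baseMap_eq {φ : A ⟶ B} {s s' : ℝ × ℝ → F} {z z' : ℝ × ℝ}
    (h : Transforms φ s z s' z') : baseMap φ s z = z' := by
  unfold baseMap; rw [h.map_eq]; rfl

theorem Transforms.eventually_eq {φ : A ⟶ B} {s s' : ℝ × ℝ → F} {z z' : ℝ × ℝ}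
    (h : Transforms φ s z s' z') (hs : ContinuousAt s z) :
    ∀ᶠ y in 𝓝 z, PointTransf.map φ (graphPt s y) = graphPt s' (baseMap φ s y) := by
  have hc : ContinuousAt (graphPt s) z := continuousAt_fst.prodMk (continuousAt_snd.prodMk hs)
  filter_upwards [hc.eventually h.2.2] with y hy
  have : (PointTransf.map φ (graphPt s y)).2.2 = s' (baseMap φ s y) := hy.1 rfl
  exact Prod.ext rfl (Prod.ext rfl this)

theorem Transforms.symm {φ : A ⟶ B} {s s' : ℝ × ℝ → F} {z z' : ℝ × ℝ}
    (h : Transforms φ s z s' z') : Transforms (Groupoid.inv φ) s' z' s z := by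
  have h1 := h.map_eq
  have h2 : graphPt s' z' ∈ B.carrier := h1 ▸ map_mem φ h.mem
  have h3 : PointTransf.map (Groupoid.inv φ) (graphPt s' z') = graphPt s z := by
    rw [← h1, map_inv_map φ h.mem]
  refine ⟨h2, h3, ?_⟩
  have hc : Tendsto (PointTransf.map (Groupoid.inv φ)) (𝓝 (graphPt s' z')) (𝓝 (graphPt s z)) := by
    have := (contDiffAt_map (Groupoid.inv φ) h2).continuousAt
    rwa [ContinuousAt, h3] at this
  filter_upwards [hc.eventually h.2.2, B.isOpen_carrier.mem_nhds h2] with p hp hpB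
  rw [hp, map_map_inv φ hpB]

theorem Transforms.trans {φ : A ⟶ B} {ψ : B ⟶ C} {s s' s'' : ℝ × ℝ → F} {z z' z'' : ℝ × ℝ}
    (h : Transforms φ s z s' z') (h' : Transforms ψ s' z' s'' z'') :
    Transforms (φ ≫ ψ) s z s'' z'' := by
  refine ⟨h.1, ?_, ?_⟩
  · rw [map_comp φ ψ h.1, h.2.1, h'.2.1]
  · have hc : Tendsto (PointTransf.map φ) (𝓝 (graphPt s z)) (𝓝 (graphPt s' z')) := by
      have := (contDiffAt_map φ h.mem).continuousAt
      rwa [ContinuousAt, h.map_eq] at this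
    filter_upwards [h.2.2, hc.eventually h'.2.2, A.isOpen_carrier.mem_nhds h.1] with p h1 h2 hp
    rw [h1, h2, map_comp φ ψ hp]

/-- If the graph of `s` is mapped to the graph of `s'`, then so are the tangent planes of these
graphs. -/
theorem tangent_graphVec_of_eventually {φ : A ⟶ B} {s s' : ℝ × ℝ → F} {z : ℝ × ℝ}
    (hz : graphPt s z ∈ A.carrier)
    (he : ∀ᶠ y in 𝓝 z, PointTransf.map φ (graphPt s y) = graphPt s' (baseMap φ s y))
    (hs : DifferentiableAt ℝ s z) (hs' : DifferentiableAt ℝ s' (baseMap φ s z)) (w : ℝ × ℝ) :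
    tangent φ (graphPt s z) (graphVec s z w) =
      graphVec s' (baseMap φ s z) (baseVec φ s z w) := by
  obtain ⟨L, hL, hLw⟩ := exists_hasFDerivAt_baseMap φ hz hs
  have h1 := hasFDerivAt_map_graphPt φ hz hs
  have h2 : HasFDerivAt (graphPt s' ∘ baseMap φ s) _ z := (hasFDerivAt_graphPt hs').comp z hL
  have h3 := h1.unique (h2.congr_of_eventuallyEq he)
  refine (DFunLike.congr_fun h3 w).trans ?_
  simp [graphVec, hLw]

theorem Transforms.tangent_graphVec {φ : A ⟶ B} {s s' : ℝ × ℝ → F} {z z' : ℝ × ℝ}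
    (h : Transforms φ s z s' z') (hs : DifferentiableAt ℝ s z) (hs' : DifferentiableAt ℝ s' z')
    (w : ℝ × ℝ) :
    tangent φ (graphPt s z) (graphVec s z w) = graphVec s' z' (baseVec φ s z w) := by
  have hz := h.baseMap_eq
  subst hz
  exact tangent_graphVec_of_eventually h.mem (h.eventually_eq hs.continuousAt) hs hs' w

theorem Transforms.baseVec_injective {φ : A ⟶ B} {s s' : ℝ × ℝ → F} {z z' : ℝ × ℝ}
    (h : Transforms φ s z s' z') (hs : DifferentiableAt ℝ s z) (hs' : DifferentiableAt ℝ s' z')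
    {w : ℝ × ℝ} (hw : baseVec φ s z w = 0) : w = 0 := by
  have h1 := h.tangent_graphVec hs hs' w
  rw [hw] at h1
  have h2 := tangent_injective φ h.mem (h1.trans (by simp [graphVec]))
  simp only [graphVec, Prod.mk_eq_zero] at h2
  exact Prod.ext h2.1 h2.2.1

/-- A transformation whose induced map of the independent variables is nondegenerate along the
graph of `s` takes the germ of this graph to the germ of a graph. -/
theorem exists_transforms (φ : A ⟶ B) {s : ℝ × ℝ → F} {z : ℝ × ℝ}
    (hz : graphPt s z ∈ A.carrier) (hs : ContDiffAt ℝ ∞ s z)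
    (hinj : ∀ w, baseVec φ s z w = 0 → w = 0) :
    ∃ s' z', ContDiffAt ℝ ∞ s' z' ∧ Transforms φ s z s' z' := by
  obtain ⟨L, hL, hLw⟩ := exists_hasFDerivAt_baseMap φ hz (hs.differentiableAt (by simp))
  have hLi : Function.Injective L.toLinearMap := by
    rw [← LinearMap.ker_eq_bot, LinearMap.ker_eq_bot']
    intro w hw
    exact hinj w ((hLw w).symm.trans hw)
  let e : (ℝ × ℝ) ≃L[ℝ] (ℝ × ℝ) :=
    (LinearEquiv.ofInjectiveEndo L.toLinearMap hLi).toContinuousLinearEquiv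
  have he : HasFDerivAt (baseMap φ s) (e : (ℝ × ℝ) →L[ℝ] (ℝ × ℝ)) z := by
    convert hL using 1
    ext1 <;> rfl
  have hcd := contDiffAt_map_graphPt φ hz hs
  have hb : ContDiffAt ℝ ∞ (baseMap φ s) z :=
    (contDiffAt_fst.comp z hcd).prodMk ((contDiffAt_fst.comp _ contDiffAt_snd).comp z hcd)
  let P := hb.toOpenPartialHomeomorph (baseMap φ s) he (by simp)
  have hP : (P : ℝ × ℝ → ℝ × ℝ) = baseMap φ s := rfl
  have hzP : z ∈ P.source := hb.mem_toOpenPartialHomeomorph_source he (by simp)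
  have hsymm : ContDiffAt ℝ ∞ P.symm (baseMap φ s z) := hb.to_localInverse he (by simp)
  have hback : P.symm (baseMap φ s z) = z := P.left_inv hzP
  refine ⟨fun y => (PointTransf.map φ (graphPt s (P.symm y))).2.2, baseMap φ s z, ?_, hz, ?_, ?_⟩
  · have h1 : ContDiffAt ℝ ∞ (fun y => (PointTransf.map φ (graphPt s y)).2.2)
        (P.symm (baseMap φ s z)) := by
      rw [hback]
      exact (contDiffAt_snd.comp _ contDiffAt_snd).comp z hcd
    exact h1.comp _ hsymm
  · simp only [hback]; rfl
  · have hproj : ContinuousAt (fun p : ℝ × ℝ × F => (p.1, p.2.1)) (graphPt s z) := by fun_prop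
    have hA := A.isOpen_carrier.mem_nhds hz
    have hmap := (contDiffAt_map φ hz).continuousAt
    have hproj' : ContinuousAt (fun p => ((PointTransf.map φ p).1, (PointTransf.map φ p).2.1))
        (graphPt s z) := by fun_prop
    have htgt : P.target ∈ 𝓝 (baseMap φ s z) := P.open_target.mem_nhds (P.map_source hzP)
    have hback' : ContinuousAt
        (fun p => P.symm ((PointTransf.map φ p).1, (PointTransf.map φ p).2.1))
        (graphPt s z) := ContinuousAt.comp (f := fun p : ℝ × ℝ × F =>
          ((PointTransf.map φ p).1, (PointTransf.map φ p).2.1)) (g := P.symm)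
          hsymm.continuousAt hproj'
    have hmem : ∀ᶠ p in 𝓝 (graphPt s z),
        graphPt s (P.symm ((PointTransf.map φ p).1, (PointTransf.map φ p).2.1)) ∈ A.carrier := by
      refine hback'.eventually (p := fun y => graphPt s y ∈ A.carrier) ?_
      have := eventually_graphPt_mem hz hs.continuousAt
      rw [← hback] at this
      exact this
    change ∀ᶠ p in 𝓝 (graphPt s z), _
    filter_upwards [hA, hproj.eventually (P.open_source.mem_nhds hzP), hproj'.eventually htgt, hmem]
      with p hpA hps hpt hpm
    constructor
    · intro hp
      have hp' : p = graphPt s (p.1, p.2.1) := Prod.ext rfl (Prod.ext rfl hp)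
      have h1 : ((PointTransf.map φ p).1, (PointTransf.map φ p).2.1) = P (p.1, p.2.1) := by
        rw [hP, baseMap, ← hp']
      change (PointTransf.map φ p).2.2 = (PointTransf.map φ (graphPt s (P.symm
        ((PointTransf.map φ p).1, (PointTransf.map φ p).2.1)))).2.2
      rw [h1, P.left_inv hps, ← hp']
    · intro hp
      set y := P.symm ((PointTransf.map φ p).1, (PointTransf.map φ p).2.1) with hy
      have h1 : baseMap φ s y = ((PointTransf.map φ p).1, (PointTransf.map φ p).2.1) := by
        rw [← hP, hy, P.right_inv hpt]
      have h2 : PointTransf.map φ p = PointTransf.map φ (graphPt s y) := by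
        refine Prod.ext ?_ (Prod.ext ?_ hp)
        · exact (congrArg Prod.fst h1).symm
        · exact (congrArg Prod.snd h1).symm
      rw [map_injOn φ hpA hpm h2]
      rfl

/-- The image of a function under a transformation depends, up to the first order, only on the
first-order jet of this function. -/
theorem Transforms.jet_eq {φ : A ⟶ B} {s s' σ σ' : ℝ × ℝ → F} {z z' z'' : ℝ × ℝ}
    (h : Transforms φ s z s' z') (k : Transforms φ σ z σ' z'')
    (hs : DifferentiableAt ℝ s z) (hs' : DifferentiableAt ℝ s' z')
    (hσ : DifferentiableAt ℝ σ z) (hσ' : DifferentiableAt ℝ σ' z'')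
    (h0 : s z = σ z) (h1 : fderiv ℝ s z = fderiv ℝ σ z) :
    z' = z'' ∧ s' z' = σ' z' ∧ fderiv ℝ s' z' = fderiv ℝ σ' z' := by
  have hg : graphPt s z = graphPt σ z := by simp [graphPt, h0]
  have hm : graphPt s' z' = graphPt σ' z'' := by rw [← h.map_eq, ← k.map_eq, hg]
  have hz : z' = z'' := Prod.ext (congrArg (fun p => p.1) hm) (congrArg (fun p => p.2.1) hm)
  subst hz
  refine ⟨rfl, congrArg (fun p => p.2.2) hm, ?_⟩
  have hb : ∀ w, baseVec φ s z w = baseVec φ σ z w := fun w => by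
    simp [baseVec, graphVec, hg, h1]
  obtain ⟨L, hL, hLw⟩ := exists_hasFDerivAt_baseMap φ h.mem hs
  have hLi : Function.Injective L.toLinearMap := by
    rw [← LinearMap.ker_eq_bot, LinearMap.ker_eq_bot']
    intro w hw
    exact h.baseVec_injective hs hs' ((hLw w).symm.trans hw)
  have hsurj := LinearMap.surjective_of_injective hLi
  refine ContinuousLinearMap.ext fun b => ?_
  obtain ⟨w, rfl⟩ := hsurj b
  have e1 := h.tangent_graphVec hs hs' w
  have e2 := k.tangent_graphVec hσ hσ' w
  have e3 : graphVec s z w = graphVec σ z w := by simp [graphVec, h1]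
  rw [hg, e3, e2, hb] at e1
  have e4 := congrArg (fun p => p.2.2) e1
  simp only [graphVec, ← hb, ← hLw] at e4
  exact e4.symm

/-- The Jacobian determinant of the map of the independent variables that is induced by the
transformation on graphs with partial derivatives `a`, `b` with respect to `t`, `x` at `p`. -/
noncomputable def jacobian (φ : A ⟶ B) (p : ℝ × ℝ × F) (a b : F) : ℝ :=
  (tangent φ p (1, 0, a)).1 * (tangent φ p (0, 1, b)).2.1 -
    (tangent φ p (0, 1, b)).1 * (tangent φ p (1, 0, a)).2.1

theorem graphVec_eq (s : ℝ × ℝ → F) (z w : ℝ × ℝ) :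
    graphVec s z w = w.1 • ((1, 0, fderiv ℝ s z (1, 0)) : ℝ × ℝ × F) +
      w.2 • ((0, 1, fderiv ℝ s z (0, 1)) : ℝ × ℝ × F) := by
  have : w = w.1 • ((1 : ℝ), (0 : ℝ)) + w.2 • ((0 : ℝ), (1 : ℝ)) := by ext <;> simp
  have h : fderiv ℝ s z w = w.1 • fderiv ℝ s z (1, 0) + w.2 • fderiv ℝ s z (0, 1) := by
    conv_lhs => rw [this]
    rw [map_add, map_smul, map_smul]
  simp [graphVec, h]

theorem baseVec_eq (φ : A ⟶ B) (s : ℝ × ℝ → F) (z w : ℝ × ℝ) :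
    baseVec φ s z w =
      (w.1 * (tangent φ (graphPt s z) (1, 0, fderiv ℝ s z (1, 0))).1 +
        w.2 * (tangent φ (graphPt s z) (0, 1, fderiv ℝ s z (0, 1))).1,
       w.1 * (tangent φ (graphPt s z) (1, 0, fderiv ℝ s z (1, 0))).2.1 +
        w.2 * (tangent φ (graphPt s z) (0, 1, fderiv ℝ s z (0, 1))).2.1) := by
  simp only [baseVec, graphVec_eq, map_add, map_smul]
  simp

theorem exists_transforms_of_jacobian_ne_zero (φ : A ⟶ B) {s : ℝ × ℝ → F} {z : ℝ × ℝ}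
    (hz : graphPt s z ∈ A.carrier) (hs : ContDiffAt ℝ ∞ s z)
    (hJ : jacobian φ (graphPt s z) (fderiv ℝ s z (1, 0)) (fderiv ℝ s z (0, 1)) ≠ 0) :
    ∃ s' z', ContDiffAt ℝ ∞ s' z' ∧ Transforms φ s z s' z' := by
  refine exists_transforms φ hz hs fun w hw => ?_
  rw [baseVec_eq, Prod.mk_eq_zero] at hw
  unfold jacobian at hJ
  obtain ⟨h1, h2⟩ := hw
  refine Prod.ext ((mul_eq_zero.1 ?_).resolve_right hJ) ((mul_eq_zero.1 ?_).resolve_right hJ)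
  · linear_combination (tangent φ (graphPt s z) (0, 1, fderiv ℝ s z (0, 1))).2.1 * h1 -
      (tangent φ (graphPt s z) (0, 1, fderiv ℝ s z (0, 1))).1 * h2
  · linear_combination (tangent φ (graphPt s z) (1, 0, fderiv ℝ s z (1, 0))).1 * h2 -
      (tangent φ (graphPt s z) (1, 0, fderiv ℝ s z (1, 0))).2.1 * h1

/-- The partial derivatives of the image of `s`, by the chain rule. -/
theorem chain_rule_of_eventually {φ : A ⟶ B} {s s' : ℝ × ℝ → F} {z : ℝ × ℝ}
    (hz : graphPt s z ∈ A.carrier)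
    (he : ∀ᶠ y in 𝓝 z, PointTransf.map φ (graphPt s y) = graphPt s' (baseMap φ s y))
    (hs : DifferentiableAt ℝ s z) (hs' : DifferentiableAt ℝ s' (baseMap φ s z)) (w : ℝ × ℝ) :
    (tangent φ (graphPt s z) (w.1, w.2, fderiv ℝ s z w)).2.2 =
      (tangent φ (graphPt s z) (w.1, w.2, fderiv ℝ s z w)).1 •
        fderiv ℝ s' (baseMap φ s z) (1, 0) +
      (tangent φ (graphPt s z) (w.1, w.2, fderiv ℝ s z w)).2.1 •
        fderiv ℝ s' (baseMap φ s z) (0, 1) := by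
  have h1 := tangent_graphVec_of_eventually hz he hs hs' w
  rw [graphVec_eq s'] at h1
  have h2 := congrArg (fun p => p.2.2) h1
  simp only [Prod.snd_add, Prod.smul_snd] at h2
  exact h2

theorem Transforms.chain_rule {φ : A ⟶ B} {s s' : ℝ × ℝ → F} {z z' : ℝ × ℝ}
    (h : Transforms φ s z s' z') (hs : DifferentiableAt ℝ s z) (hs' : DifferentiableAt ℝ s' z')
    (w : ℝ × ℝ) :
    (tangent φ (graphPt s z) (w.1, w.2, fderiv ℝ s z w)).2.2 =
      (tangent φ (graphPt s z) (w.1, w.2, fderiv ℝ s z w)).1 • fderiv ℝ s' z' (1, 0) +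
      (tangent φ (graphPt s z) (w.1, w.2, fderiv ℝ s z w)).2.1 • fderiv ℝ s' z' (0, 1) := by
  have hz := h.baseMap_eq
  subst hz
  exact chain_rule_of_eventually h.mem (h.eventually_eq hs.continuousAt) hs hs' w

theorem eventually_differentiableAt {s : ℝ × ℝ → F} {z : ℝ × ℝ} (hs : ContDiffAt ℝ ∞ s z) :
    ∀ᶠ y in 𝓝 z, DifferentiableAt ℝ s y := by
  filter_upwards [(hs.of_le (m := 1) (WithTop.coe_le_coe.2 le_top)).eventually (by simp)] with y hy
    using hy.differentiableAt (by simp)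

theorem Transforms.eventually_chain_rule {φ : A ⟶ B} {s s' : ℝ × ℝ → F} {z z' : ℝ × ℝ}
    (h : Transforms φ s z s' z') (hs : ContDiffAt ℝ ∞ s z) (hs' : ContDiffAt ℝ ∞ s' z') :
    ∀ᶠ y in 𝓝 z, ∀ w : ℝ × ℝ, (tangent φ (graphPt s y) (w.1, w.2, fderiv ℝ s y w)).2.2 =
      (tangent φ (graphPt s y) (w.1, w.2, fderiv ℝ s y w)).1 •
        fderiv ℝ s' (baseMap φ s y) (1, 0) +
      (tangent φ (graphPt s y) (w.1, w.2, fderiv ℝ s y w)).2.1 •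
        fderiv ℝ s' (baseMap φ s y) (0, 1) := by
  have hz := h.baseMap_eq
  subst hz
  obtain ⟨L, hL, -⟩ := exists_hasFDerivAt_baseMap φ h.mem (hs.differentiableAt (by simp))
  filter_upwards [(h.eventually_eq hs.continuousAt).eventually_nhds,
    eventually_graphPt_mem h.mem hs.continuousAt, eventually_differentiableAt hs,
    hL.continuousAt.eventually (eventually_differentiableAt hs')] with y h1 h2 h3 h4 w
  exact chain_rule_of_eventually h2 h1 h3 h4 w

/-! ### Groupoids of admissible transformations -/

/-- Every germ of the graph of a smooth function is mapped by `φ` to the germ of such a graph. -/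
def PreservesGraphs (φ : A ⟶ B) : Prop :=
  ∀ (s : ℝ × ℝ → F) (z : ℝ × ℝ), graphPt s z ∈ A.carrier → ContDiffAt ℝ ∞ s z →
    ∃ s' z', ContDiffAt ℝ ∞ s' z' ∧ Transforms φ s z s' z'

theorem isAdmissible_inv {E : EqClass F} {φ : A ⟶ B} (h : IsAdmissible E φ) :
    IsAdmissible E (Groupoid.inv φ) := fun s s' z z' hs hs' ht =>
  (h s' s z' z hs' hs ht.symm).symm

theorem isAdmissible_comp {E : EqClass F} {φ : A ⟶ B} {ψ : B ⟶ C} (h : IsAdmissible E φ)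
    (h' : IsAdmissible E ψ) (hφ : PreservesGraphs φ) : IsAdmissible E (φ ≫ ψ) := by
  intro s s'' z z'' hs hs'' ht
  obtain ⟨s', z', hs', ht'⟩ := hφ s z ht.mem hs
  have h1 := ht'.symm.trans ht
  rw [← Category.assoc, Groupoid.inv_comp, Category.id_comp] at h1
  exact (h s s' z z' hs hs' ht').trans (h' s' s'' z' z'' hs' hs'' h1)

theorem isAdmissible_id {E : EqClass F}
    (hE : ∀ θ s s' z, s =ᶠ[𝓝 z] s' → (E θ s z ↔ E θ s' z)) : IsAdmissible E (𝟙 A) := by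
  intro s s' z z' hs hs' ht
  have h0 : baseMap (𝟙 A) s =ᶠ[𝓝 z] id := by
    filter_upwards [eventually_graphPt_mem ht.mem hs.continuousAt] with y hy
    rw [baseMap, map_id hy]; rfl
  have hz : z = z' := by rw [← ht.baseMap_eq]; exact h0.self_of_nhds.symm
  subst hz
  refine hE _ _ _ _ ?_
  filter_upwards [ht.eventually_eq hs.continuousAt, h0,
    eventually_graphPt_mem ht.mem hs.continuousAt] with y h1 h2 h3
  rw [map_id h3, h2] at h1
  exact congrArg (fun p => p.2.2) h1

/-- The equivalence groupoid of a class of equations all of whose admissible transformations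
preserve graphs. -/
def equivalenceGroupoid (E : EqClass F)
    (hG : ∀ {A B : LocalEq F} (φ : A ⟶ B), IsAdmissible E φ → PreservesGraphs φ) :
    Subgroupoid (LocalEq F) where
  arrows _ _ := {φ | IsAdmissible E φ}
  inv h := isAdmissible_inv h
  mul h _ h' := isAdmissible_comp h h' (hG _ h)

theorem isEquivalenceGroupoid_equivalenceGroupoid (E : EqClass F)
    (hE : ∀ θ s s' z, s =ᶠ[𝓝 z] s' → (E θ s z ↔ E θ s' z))
    (hG : ∀ {A B : LocalEq F} (φ : A ⟶ B), IsAdmissible E φ → PreservesGraphs φ) :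
    IsEquivalenceGroupoid E (equivalenceGroupoid E hG) :=
  ⟨⟨fun _ => isAdmissible_id hE⟩, fun _ _ => rfl⟩

end General

section

/-! ### Partial derivatives and test functions -/

theorem dt_eq_fderiv {g : ℝ × ℝ → ℝ} {z : ℝ × ℝ} (hg : DifferentiableAt ℝ g z) :
    dt g z = fderiv ℝ g z (1, 0) := by
  have h : HasDerivAt (fun s : ℝ => ((s, z.2) : ℝ × ℝ)) (1, 0) z.1 :=
    (hasDerivAt_id z.1).prodMk (hasDerivAt_const z.1 z.2)
  exact (HasFDerivAt.comp_hasDerivAt (f := fun s : ℝ => ((s, z.2) : ℝ × ℝ)) z.1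
    hg.hasFDerivAt h).deriv

theorem dx_eq_fderiv {g : ℝ × ℝ → ℝ} {z : ℝ × ℝ} (hg : DifferentiableAt ℝ g z) :
    dx g z = fderiv ℝ g z (0, 1) := by
  have h : HasDerivAt (fun s : ℝ => ((z.1, s) : ℝ × ℝ)) (0, 1) z.2 :=
    (hasDerivAt_const z.2 z.1).prodMk (hasDerivAt_id z.2)
  exact (HasFDerivAt.comp_hasDerivAt (f := fun s : ℝ => ((z.1, s) : ℝ × ℝ)) z.2
    hg.hasFDerivAt h).deriv

theorem dt_congr {g h : ℝ × ℝ → ℝ} {z : ℝ × ℝ} (e : g =ᶠ[𝓝 z] h) : dt g z = dt h z := by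
  refine Filter.EventuallyEq.deriv_eq ?_
  have hc : ContinuousAt (fun s : ℝ => ((s, z.2) : ℝ × ℝ)) z.1 := by fun_prop
  exact hc.eventually e

theorem dx_congr {g h : ℝ × ℝ → ℝ} {z : ℝ × ℝ} (e : g =ᶠ[𝓝 z] h) : dx g z = dx h z := by
  refine Filter.EventuallyEq.deriv_eq ?_
  have hc : ContinuousAt (fun s : ℝ => ((z.1, s) : ℝ × ℝ)) z.2 := by fun_prop
  exact hc.eventually e

theorem dx_congr_eventually {g h : ℝ × ℝ → ℝ} {z : ℝ × ℝ} (e : g =ᶠ[𝓝 z] h) :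
    dx g =ᶠ[𝓝 z] dx h :=
  (eventually_eventually_nhds.2 e).mono fun _ hy => dx_congr hy

theorem dx_eventuallyEq {g : ℝ × ℝ → ℝ} {z : ℝ × ℝ} (hg : ContDiffAt ℝ ∞ g z) :
    dx g =ᶠ[𝓝 z] fun y => fderiv ℝ g y (0, 1) :=
  (eventually_differentiableAt hg).mono fun _ hy => dx_eq_fderiv hy

theorem contDiffAt_dx {g : ℝ × ℝ → ℝ} {z : ℝ × ℝ} (hg : ContDiffAt ℝ ∞ g z) :
    ContDiffAt ℝ ∞ (dx g) z :=
  ((hg.fderiv_right (m := ∞) (by norm_cast)).clm_apply contDiffAt_const).congr_of_eventuallyEq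
    (dx_eventuallyEq hg)

theorem dx_dx_eq_fderiv {g : ℝ × ℝ → ℝ} {z : ℝ × ℝ} (hg : ContDiffAt ℝ ∞ g z) :
    dx (dx g) z = fderiv ℝ (fderiv ℝ g) z (0, 1) (0, 1) := by
  have h : DifferentiableAt ℝ (fderiv ℝ g) z :=
    (hg.fderiv_right (m := ∞) (by norm_cast)).differentiableAt (by simp)
  rw [dx_congr (dx_eventuallyEq hg), dx_eq_fderiv (by fun_prop)]
  rw [fderiv_clm_apply h (by fun_prop)]
  simp

/-- The second-degree polynomial with the given second-order jet at `z₀`. -/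
noncomputable def quadJet (z₀ : ℝ × ℝ) (c p q r m w : ℝ) (z : ℝ × ℝ) : ℝ :=
  c + p * (z.1 - z₀.1) + q * (z.2 - z₀.2) + r / 2 * (z.1 - z₀.1) ^ 2 +
    m * ((z.1 - z₀.1) * (z.2 - z₀.2)) + w / 2 * (z.2 - z₀.2) ^ 2

section QuadJet

variable (z₀ : ℝ × ℝ) (c p q r m w : ℝ)

theorem contDiff_quadJet : ContDiff ℝ ∞ (quadJet z₀ c p q r m w) := by
  unfold quadJet; fun_prop

theorem quadJet_self : quadJet z₀ c p q r m w z₀ = c := by simp [quadJet]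

theorem dt_quadJet (z : ℝ × ℝ) :
    dt (quadJet z₀ c p q r m w) z = p + r * (z.1 - z₀.1) + m * (z.2 - z₀.2) := by
  have h1 : HasDerivAt (fun s : ℝ => s - z₀.1) 1 z.1 := (hasDerivAt_id z.1).sub_const _
  have h2 := (((((hasDerivAt_const z.1 c).add (h1.const_mul p)).add
    (hasDerivAt_const z.1 (q * (z.2 - z₀.2)))).add ((h1.pow 2).const_mul (r / 2))).add
    ((h1.mul_const (z.2 - z₀.2)).const_mul m)).add
    (hasDerivAt_const z.1 (w / 2 * (z.2 - z₀.2) ^ 2))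
  refine h2.deriv.trans ?_
  simp; ring

theorem dx_quadJet (z : ℝ × ℝ) :
    dx (quadJet z₀ c p q r m w) z = q + m * (z.1 - z₀.1) + w * (z.2 - z₀.2) := by
  have h1 : HasDerivAt (fun s : ℝ => s - z₀.2) 1 z.2 := (hasDerivAt_id z.2).sub_const _
  have h2 := (((((hasDerivAt_const z.2 c).add (hasDerivAt_const z.2 (p * (z.1 - z₀.1)))).add
    (h1.const_mul q)).add (hasDerivAt_const z.2 (r / 2 * (z.1 - z₀.1) ^ 2))).add
    ((h1.const_mul (z.1 - z₀.1)).const_mul m)).add ((h1.pow 2).const_mul (w / 2))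
  refine h2.deriv.trans ?_
  simp; ring

theorem dx_dx_quadJet (z : ℝ × ℝ) : dx (dx (quadJet z₀ c p q r m w)) z = w := by
  have h1 : HasDerivAt (fun s : ℝ => s - z₀.2) 1 z.2 := (hasDerivAt_id z.2).sub_const _
  have h2 := ((hasDerivAt_const z.2 (q + m * (z.1 - z₀.1))).add (h1.const_mul w))
  rw [show dx (quadJet z₀ c p q r m w) = fun z => q + m * (z.1 - z₀.1) + w * (z.2 - z₀.2) from
    funext (dx_quadJet z₀ c p q r m w)]
  refine h2.deriv.trans ?_
  simp

theorem fderiv_quadJet (z e : ℝ × ℝ) :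
    fderiv ℝ (quadJet z₀ c p q r m w) z e =
      (p + r * (z.1 - z₀.1) + m * (z.2 - z₀.2)) * e.1 +
        (q + m * (z.1 - z₀.1) + w * (z.2 - z₀.2)) * e.2 := by
  have hd := (contDiff_quadJet z₀ c p q r m w).contDiffAt.differentiableAt (x := z) (by simp)
  have he : e = e.1 • ((1 : ℝ), (0 : ℝ)) + e.2 • ((0 : ℝ), (1 : ℝ)) := by ext <;> simp
  rw [← dt_quadJet z₀ c p q r m w, ← dx_quadJet z₀ c p q r m w, dt_eq_fderiv hd, dx_eq_fderiv hd]
  conv_lhs => rw [he]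
  rw [map_add, map_smul, map_smul, smul_eq_mul, smul_eq_mul]; ring

end QuadJet

/-- A consequence of the identity theorem: an analytic function that vanishes wherever a continuous
function, not identically zero, does not vanish, is zero. -/
theorem eq_zero_of_forall_ne_zero {E : Type*} [NormedAddCommGroup E] [NormedSpace ℝ E]
    {f g : E → ℝ} (hf : Continuous f) (hg : AnalyticOnNhd ℝ g univ) {x₀ : E} (h₀ : f x₀ ≠ 0)
    (h : ∀ x, f x ≠ 0 → g x = 0) (x : E) : g x = 0 := by
  have h1 : g =ᶠ[𝓝 x₀] fun _ => 0 :=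
    (hf.continuousAt.eventually_ne h₀).mono h
  exact congrFun (hg.eq_of_eventuallyEq analyticOnNhd_const h1) x

/-! ### Admissible transformations of potential equations are fibered -/

theorem potentialEquation_congr (θ : ArbElem) (v v' : ℝ × ℝ → ℝ) (z : ℝ × ℝ) (h : v =ᶠ[𝓝 z] v') :
    potentialEquation θ v z ↔ potentialEquation θ v' z := by
  simp only [potentialEquation, dt_congr h, dx_congr h, dx_congr (dx_congr_eventually h)]

variable {A B : LocalEq ℝ}

/-- The chain rule for the second derivatives of the image of `s`: the derivative in the direction
`ξ` of the expression for the first derivative with respect to `x`. -/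
theorem Transforms.second_order {φ : A ⟶ B} {s s' : ℝ × ℝ → ℝ} {z z' : ℝ × ℝ}
    (h : Transforms φ s z s' z') (hs : ContDiffAt ℝ ∞ s z) (hs' : ContDiffAt ℝ ∞ s' z')
    (ξ : ℝ × ℝ) {Dt Dx Dt' Dx' : ℝ × ℝ × ℝ}
    (hDt : Dt = tangent φ (graphPt s z) (1, 0, fderiv ℝ s z (1, 0)))
    (hDx : Dx = tangent φ (graphPt s z) (0, 1, fderiv ℝ s z (0, 1)))
    (hDt' : Dt' = fderiv ℝ (tangent φ) (graphPt s z) (graphVec s z ξ) (1, 0, fderiv ℝ s z (1, 0)) +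
      tangent φ (graphPt s z) (0, 0, fderiv ℝ (fderiv ℝ s) z ξ (1, 0)))
    (hDx' : Dx' = fderiv ℝ (tangent φ) (graphPt s z) (graphVec s z ξ) (0, 1, fderiv ℝ s z (0, 1)) +
      tangent φ (graphPt s z) (0, 0, fderiv ℝ (fderiv ℝ s) z ξ (0, 1))) :
    (Dt.1 * Dx.2.1 - Dx.1 * Dt.2.1) * fderiv ℝ (fderiv ℝ s') z' (baseVec φ s z ξ) (0, 1) +
      fderiv ℝ s' z' (0, 1) *
        (Dt'.1 * Dx.2.1 + Dt.1 * Dx'.2.1 - (Dx'.1 * Dt.2.1 + Dx.1 * Dt'.2.1)) =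
      Dt'.1 * Dx.2.2 + Dt.1 * Dx'.2.2 - (Dx'.1 * Dt.2.2 + Dx.1 * Dt'.2.2) := by
  have hz := h.baseMap_eq
  subst hz
  have hsd : DifferentiableAt ℝ s z := hs.differentiableAt (by simp)
  -- everything is restricted to the line through `z` in the direction `ξ`
  let c : ℝ → ℝ × ℝ := fun τ => z + τ • ξ
  have hc : HasDerivAt c ξ 0 := by
    have h1 := ((hasDerivAt_id (0 : ℝ)).smul_const ξ).const_add z
    rw [one_smul] at h1
    exact h1
  have hc0 : c 0 = z := by simp [c]
  have hs2 : HasFDerivAt (fderiv ℝ s) (fderiv ℝ (fderiv ℝ s) z) (c 0) := by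
    rw [hc0]
    exact ((hs.fderiv_right (m := ∞) (by norm_cast)).differentiableAt (by simp)).hasFDerivAt
  have hs2' : HasFDerivAt (fderiv ℝ s') (fderiv ℝ (fderiv ℝ s') (baseMap φ s z))
      (baseMap φ s (c 0)) := by
    rw [hc0]
    exact ((hs'.fderiv_right (m := ∞) (by norm_cast)).differentiableAt (by simp)).hasFDerivAt
  have hT : HasFDerivAt (tangent φ) (fderiv ℝ (tangent φ) (graphPt s z)) (graphPt s (c 0)) := by
    rw [hc0]
    exact ((contDiffAt_tangent φ h.mem).differentiableAt (by simp)).hasFDerivAt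
  have hg : HasDerivAt (fun τ => graphPt s (c τ)) (graphVec s z ξ) 0 := by
    have h1 := hasFDerivAt_graphPt hsd
    rw [← hc0] at h1
    have h2 := HasFDerivAt.comp_hasDerivAt (f := c) 0 h1 hc
    rw [hc0] at h2
    exact h2
  have hTg : HasDerivAt (fun τ => tangent φ (graphPt s (c τ)))
      (fderiv ℝ (tangent φ) (graphPt s z) (graphVec s z ξ)) 0 := hT.comp_hasDerivAt 0 hg
  have hfs : HasDerivAt (fun τ => fderiv ℝ s (c τ)) (fderiv ℝ (fderiv ℝ s) z ξ) 0 :=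
    hs2.comp_hasDerivAt 0 hc
  have hD : ∀ e : ℝ × ℝ, HasDerivAt
      (fun τ => tangent φ (graphPt s (c τ)) (e.1, e.2, fderiv ℝ s (c τ) e))
      (fderiv ℝ (tangent φ) (graphPt s z) (graphVec s z ξ) (e.1, e.2, fderiv ℝ s z e) +
        tangent φ (graphPt s z) (0, 0, fderiv ℝ (fderiv ℝ s) z ξ e)) 0 := fun e => by
    have h1 : HasDerivAt (fun τ => ((e.1, e.2, fderiv ℝ s (c τ) e) : ℝ × ℝ × ℝ))
        (0, 0, fderiv ℝ (fderiv ℝ s) z ξ e) 0 := by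
      have h2 := hfs.clm_apply (hasDerivAt_const (0 : ℝ) e)
      simp only [map_zero, add_zero] at h2
      exact (hasDerivAt_const _ _).prodMk ((hasDerivAt_const _ _).prodMk h2)
    have h3 := hTg.clm_apply h1
    rwa [hc0] at h3
  have hDtd := hD (1, 0)
  have hDxd := hD (0, 1)
  rw [← hDt'] at hDtd
  rw [← hDx'] at hDxd
  obtain ⟨L, hL, hLw⟩ := exists_hasFDerivAt_baseMap φ h.mem hsd
  have hb : HasDerivAt (fun τ => baseMap φ s (c τ)) (baseVec φ s z ξ) 0 := by
    rw [← hLw]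
    exact HasFDerivAt.comp_hasDerivAt (f := c) 0 (by rw [hc0]; exact hL) hc
  have hq : HasDerivAt (fun τ => fderiv ℝ s' (baseMap φ s (c τ)) (0, 1))
      (fderiv ℝ (fderiv ℝ s') (baseMap φ s z) (baseVec φ s z ξ) (0, 1)) 0 := by
    have h1 : HasDerivAt (fun τ => fderiv ℝ s' (baseMap φ s (c τ)))
        (fderiv ℝ (fderiv ℝ s') (baseMap φ s z) (baseVec φ s z ξ)) 0 :=
      HasFDerivAt.comp_hasDerivAt (f := fun τ => baseMap φ s (c τ)) 0 hs2' hb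
    have h2 := h1.clm_apply (hasDerivAt_const (0 : ℝ) ((0, 1) : ℝ × ℝ))
    rwa [map_zero, add_zero] at h2
  have hct : Tendsto c (𝓝 0) (𝓝 z) := by
    have := hc.continuousAt; rwa [ContinuousAt, hc0] at this
  have hev := hct.eventually (h.eventually_chain_rule hs hs')
  generalize hDtf : (fun τ => tangent φ (graphPt s (c τ)) ((1, 0).1, (1, 0).2,
    fderiv ℝ s (c τ) (1, 0))) = f at hDtd
  generalize hDxf : (fun τ => tangent φ (graphPt s (c τ)) ((0, 1).1, (0, 1).2,
    fderiv ℝ s (c τ) (0, 1))) = g at hDxd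
  have hf0 : f 0 = Dt := by rw [← hDtf, hDt, ← hc0]
  have hg0 : g 0 = Dx := by rw [← hDxf, hDx, ← hc0]
  have hf1 : HasDerivAt (fun τ => (f τ).1) Dt'.1 0 := hDtd.fst
  have hf2 : HasDerivAt (fun τ => (f τ).2.1) Dt'.2.1 0 := hDtd.snd.fst
  have hf3 : HasDerivAt (fun τ => (f τ).2.2) Dt'.2.2 0 := hDtd.snd.snd
  have hg1 : HasDerivAt (fun τ => (g τ).1) Dx'.1 0 := hDxd.fst
  have hg2 : HasDerivAt (fun τ => (g τ).2.1) Dx'.2.1 0 := hDxd.snd.fst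
  have hg3 : HasDerivAt (fun τ => (g τ).2.2) Dx'.2.2 0 := hDxd.snd.snd
  have hlhs := hq.mul ((hf1.mul hg2).sub (hg1.mul hf2))
  have hrhs := (hf1.mul hg3).sub (hg1.mul hf3)
  have key := hlhs.unique (hrhs.congr_of_eventuallyEq (by
    filter_upwards [hev] with τ hτ
    have h1 := hτ (1, 0)
    have h2 := hτ (0, 1)
    have e1 : tangent φ (graphPt s (c τ)) ((1, 0).1, (1, 0).2, fderiv ℝ s (c τ) (1, 0)) = f τ := by
      rw [← hDtf]
    have e2 : tangent φ (graphPt s (c τ)) ((0, 1).1, (0, 1).2, fderiv ℝ s (c τ) (0, 1)) = g τ := by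
      rw [← hDxf]
    rw [e1] at h1
    rw [e2] at h2
    simp only [smul_eq_mul] at h1 h2
    simp only [Pi.mul_apply, Pi.sub_apply]
    rw [h1, h2]
    ring))
  simp only [hf0, hg0, hc0, Pi.mul_apply, Pi.sub_apply] at key
  linear_combination key

end

section

variable {A B : LocalEq ℝ}

theorem fderiv_fderiv_quadJet (z₀ : ℝ × ℝ) (c p q r m w : ℝ) (z e e' : ℝ × ℝ) :
    fderiv ℝ (fderiv ℝ (quadJet z₀ c p q r m w)) z e e' =
      (r * e.1 + m * e.2) * e'.1 + (m * e.1 + w * e.2) * e'.2 := by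
  have h : DifferentiableAt ℝ (fderiv ℝ (quadJet z₀ c p q r m w)) z :=
    ((contDiff_quadJet z₀ c p q r m w).contDiffAt.fderiv_right (m := ∞)
      (by norm_cast)).differentiableAt (by simp)
  have h1 : fderiv ℝ (fun y => fderiv ℝ (quadJet z₀ c p q r m w) y e') z e =
      fderiv ℝ (fderiv ℝ (quadJet z₀ c p q r m w)) z e e' := by
    rw [fderiv_clm_apply h (by fun_prop)]
    simp
  have h2 : (fun y => fderiv ℝ (quadJet z₀ c p q r m w) y e') =
      quadJet z₀ (p * e'.1 + q * e'.2) (r * e'.1 + m * e'.2) (m * e'.1 + w * e'.2) 0 0 0 := by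
    funext y
    rw [fderiv_quadJet, quadJet]
    ring
  rw [← h1, h2, fderiv_quadJet]
  ring

theorem tangent_apply (φ : A ⟶ B) (p : ℝ × ℝ × ℝ) (a b c : ℝ) :
    tangent φ p (a, b, c) =
      a • tangent φ p (1, 0, 0) + b • tangent φ p (0, 1, 0) + c • tangent φ p (0, 0, 1) := by
  rw [← map_smul, ← map_smul, ← map_smul, ← map_add, ← map_add]
  congr 1
  ext <;> simp

theorem jacobian_apply (φ : A ⟶ B) (p : ℝ × ℝ × ℝ) (a b : ℝ) :
    jacobian φ p a b =
      ((tangent φ p (1, 0, 0)).1 + a * (tangent φ p (0, 0, 1)).1) *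
          ((tangent φ p (0, 1, 0)).2.1 + b * (tangent φ p (0, 0, 1)).2.1) -
        ((tangent φ p (0, 1, 0)).1 + b * (tangent φ p (0, 0, 1)).1) *
          ((tangent φ p (1, 0, 0)).2.1 + a * (tangent φ p (0, 0, 1)).2.1) := by
  unfold jacobian
  rw [tangent_apply φ p 1 0 a, tangent_apply φ p 0 1 b]
  simp

/-- If all these determinants vanished, then the differentials of the `t`- and `x`-components would
be linearly dependent. -/
theorem exists_jacobian_ne_zero (φ : A ⟶ B) {p : ℝ × ℝ × ℝ} (hp : p ∈ A.carrier) :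
    ∃ a b, jacobian φ p a b ≠ 0 := by
  by_contra! hJ
  simp only [jacobian_apply] at hJ
  obtain ⟨⟨a, b, c⟩, hv⟩ : ∃ v, tangent φ p v = (1, 0, 0) := ⟨_, tangent_tangent_inv φ hp _⟩
  obtain ⟨⟨a', b', c'⟩, hw⟩ : ∃ v, tangent φ p v = (0, 1, 0) := ⟨_, tangent_tangent_inv φ hp _⟩
  rw [tangent_apply] at hv hw
  have v1 := congrArg (fun v => v.1) hv
  have v2 := congrArg (fun v => v.2.1) hv
  have w1 := congrArg (fun v => v.1) hw
  have w2 := congrArg (fun v => v.2.1) hw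
  have h00 := hJ 0 0
  have h01 := hJ 0 1
  have h10 := hJ 1 0
  simp only [Prod.fst_add, Prod.snd_add, Prod.smul_fst, Prod.smul_snd, smul_eq_mul] at v1 v2 w1 w2
  generalize tangent φ p (1, 0, 0) = Lt at *
  generalize tangent φ p (0, 1, 0) = Lx at *
  generalize tangent φ p (0, 0, 1) = Lv at *
  -- all the minors of the rows of `T` and `X` vanish
  have m1 : Lt.1 * Lx.2.1 - Lx.1 * Lt.2.1 = 0 := by linear_combination h00
  have m2 : Lt.1 * Lv.2.1 - Lv.1 * Lt.2.1 = 0 := by linear_combination h01 - h00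
  have m3 : Lv.1 * Lx.2.1 - Lx.1 * Lv.2.1 = 0 := by linear_combination h10 - h00
  have : (1 : ℝ) = 0 := by
    linear_combination (a * b' - a' * b) * m1 + (a * c' - a' * c) * m2 - (b * c' - b' * c) * m3 -
      (a' * Lt.2.1 + b' * Lx.2.1 + c' * Lv.2.1) * v1 - w2 +
      (a * Lt.2.1 + b * Lx.2.1 + c * Lv.2.1) * w1
  norm_num at this

/-- The image of the second-order jet with `v_t = p`, `v_x = q`, `v_tt = r`, `v_tx = 0`, `v_xx = w`
under an admissible transformation of potential equations: `p'`, `q'`, `w'` stand for `v'_t'`,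
`v'_x'` and `v'_x'x'`, and `Dt`, `Dx` for the total derivatives of the components of `φ`. The vector
`(-D_x T, D_t T)` is mapped to a multiple of `∂_x'`; `Kt` and `Kx` are the parts, free of
second-order derivatives of `v`, of the derivatives of `Dt` and `Dx` along it. -/
theorem IsAdmissible.image_quadJet {φ : A ⟶ B} (hφ : IsAdmissible potentialEquation φ)
    {P : ℝ × ℝ × ℝ} (hP : P ∈ A.carrier) {p q r w : ℝ} (hJ : jacobian φ P p q ≠ 0)
    (hE : p + 1 / (2 * A.elem.lam P.1) * q ^ 2 + A.elem.f (P.1, P.2.1) * w -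
      dx A.elem.f (P.1, P.2.1) * q = 0)
    {z' : ℝ × ℝ} (hz' : z' = ((PointTransf.map φ P).1, (PointTransf.map φ P).2.1))
    {Dt Dx Lv Kt Kx : ℝ × ℝ × ℝ}
    (hDt : Dt = tangent φ P (1, 0, p)) (hDx : Dx = tangent φ P (0, 1, q))
    (hLv : Lv = tangent φ P (0, 0, 1))
    (hKt : Kt = fderiv ℝ (tangent φ) P (-Dx.1, Dt.1, p * -Dx.1 + q * Dt.1) (1, 0, p))
    (hKx : Kx = fderiv ℝ (tangent φ) P (-Dx.1, Dt.1, p * -Dx.1 + q * Dt.1) (0, 1, q)) :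
    ∃ p' q' w' : ℝ, Dt.2.2 = Dt.1 * p' + Dt.2.1 * q' ∧ Dx.2.2 = Dx.1 * p' + Dx.2.1 * q' ∧
      p' + 1 / (2 * B.elem.lam z'.1) * q' ^ 2 + B.elem.f z' * w' - dx B.elem.f z' * q' = 0 ∧
      jacobian φ P p q ^ 2 * w' =
        Kt.1 * Dx.2.2 + Dt.1 * Kx.2.2 - (Kx.1 * Dt.2.2 + Dx.1 * Kt.2.2) -
          q' * (Kt.1 * Dx.2.1 + Dt.1 * Kx.2.1 - (Kx.1 * Dt.2.1 + Dx.1 * Kt.2.1)) +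
          (Lv.2.2 - p' * Lv.1 - q' * Lv.2.1) * (r * Dx.1 ^ 2 + w * Dt.1 ^ 2) := by
  let z : ℝ × ℝ := (P.1, P.2.1)
  let s := quadJet z P.2.2 p q r 0 w
  have hs : ContDiffAt ℝ ∞ s z := (contDiff_quadJet ..).contDiffAt
  have hsd := hs.differentiableAt (by simp)
  have hg : graphPt s z = P := by
    simp only [graphPt, s, quadJet_self]; rfl
  have d1 : fderiv ℝ s z (1, 0) = p := by simp [s, fderiv_quadJet]
  have d2 : fderiv ℝ s z (0, 1) = q := by simp [s, fderiv_quadJet]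
  obtain ⟨s', y, hs', ht⟩ := exists_transforms_of_jacobian_ne_zero φ (s := s) (z := z)
    (by rw [hg]; exact hP) hs (by rw [hg, d1, d2]; exact hJ)
  have hy : y = z' := by rw [← ht.baseMap_eq, baseMap, hg, hz']
  subst hy
  have hsd' := hs'.differentiableAt (by simp)
  have c1 := ht.chain_rule hsd hsd' (1, 0)
  have c2 := ht.chain_rule hsd hsd' (0, 1)
  simp only [d1, d2, hg, ← hDt, ← hDx, smul_eq_mul] at c1 c2
  have hE1 : potentialEquation A.elem s z := by
    simp only [potentialEquation, s, dt_quadJet, dx_quadJet, dx_dx_quadJet]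
    simpa [z] using hE
  have hE2 := (hφ s s' z y hs hs' ht).1 hE1
  simp only [potentialEquation] at hE2
  rw [dt_eq_fderiv hsd', dx_eq_fderiv hsd', dx_dx_eq_fderiv hs'] at hE2
  refine ⟨_, _, _, c1, c2, hE2, ?_⟩
  have hv : graphVec s z (-Dx.1, Dt.1) = (-Dx.1, Dt.1, p * -Dx.1 + q * Dt.1) := by
    simp [graphVec, s, fderiv_quadJet]
  have hb : baseVec φ s z (-Dx.1, Dt.1) = jacobian φ P p q • ((0 : ℝ), (1 : ℝ)) := by
    rw [baseVec_eq, hg, d1, d2, ← hDt, ← hDx, jacobian, ← hDt, ← hDx]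
    ext <;> simp <;> ring
  have h2 := ht.second_order hs hs' (-Dx.1, Dt.1) (Dt := Dt) (Dx := Dx)
    (Dt' := Kt + (r * -Dx.1) • Lv) (Dx' := Kx + (w * Dt.1) • Lv)
    (by rw [hg, d1, hDt]) (by rw [hg, d2, hDx])
    (by
      rw [hg, d1, hv, ← hKt, fderiv_fderiv_quadJet, hLv, ← map_smul]
      simp)
    (by
      rw [hg, d2, hv, ← hKx, fderiv_fderiv_quadJet, hLv, ← map_smul]
      simp)
  rw [hb, map_smul, _root_.smul_apply, smul_eq_mul] at h2
  have hJ' : jacobian φ P p q = Dt.1 * Dx.2.1 - Dx.1 * Dt.2.1 := by rw [jacobian, hDt, hDx]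
  rw [← hJ'] at h2
  simp only [Prod.fst_add, Prod.snd_add, Prod.smul_fst, Prod.smul_snd, smul_eq_mul] at h2
  set p' := fderiv ℝ s' y (1, 0)
  set q' := fderiv ℝ s' y (0, 1)
  linear_combination h2 - r * Dx.1 * Lv.1 * c2 - w * Dt.1 * Lv.1 * c1

/-- A transformation is fibered if its `t`-component depends at most on `t` and its `x`-component at
most on `(t,x)`, in the infinitesimal sense: `T_x = T_v = X_v = 0`. -/
def IsFibered (φ : A ⟶ B) : Prop :=
  ∀ p ∈ A.carrier, (tangent φ p (0, 1, 0)).1 = 0 ∧ (tangent φ p (0, 0, 1)).1 = 0 ∧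
    (tangent φ p (0, 0, 1)).2.1 = 0

/-- The image of `∂_v` is transversal to the image of a tangent plane of a graph; here `p'` and `q'`
are the slopes of this image. -/
theorem vertical_ne_zero (φ : A ⟶ B) {P : ℝ × ℝ × ℝ} (hP : P ∈ A.carrier) {p q p' q' : ℝ}
    {Dt Dx Lv : ℝ × ℝ × ℝ} (hDt : Dt = tangent φ P (1, 0, p)) (hDx : Dx = tangent φ P (0, 1, q))
    (hLv : Lv = tangent φ P (0, 0, 1)) (h1 : Dt.2.2 = Dt.1 * p' + Dt.2.1 * q')
    (h2 : Dx.2.2 = Dx.1 * p' + Dx.2.1 * q') : Lv.2.2 - p' * Lv.1 - q' * Lv.2.1 ≠ 0 := by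
  intro h3
  obtain ⟨⟨a, b, c⟩, hv⟩ : ∃ v, tangent φ P v = (0, 0, 1) := ⟨_, tangent_tangent_inv φ hP _⟩
  have h4 : tangent φ P (a, b, c) = a • Dt + b • Dx + (c - p * a - q * b) • Lv := by
    rw [hDt, hDx, hLv, ← map_smul, ← map_smul, ← map_smul, ← map_add, ← map_add]
    congr 1
    ext <;> simp
    ring
  rw [h4] at hv
  have v1 := congrArg (fun v => v.1) hv
  have v2 := congrArg (fun v => v.2.1) hv
  have v3 := congrArg (fun v => v.2.2) hv
  simp only [Prod.fst_add, Prod.snd_add, Prod.smul_fst, Prod.smul_snd, smul_eq_mul] at v1 v2 v3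
  have : (1 : ℝ) = 0 := by
    linear_combination -v3 + p' * v1 + q' * v2 + (c - p * a - q * b) * h3 + a * h1 + b * h2
  norm_num at this

/-- Admissibility forces `D_x T = 0`: the coefficient of `v_tt` in the transformed equation is a
multiple of the square of `D_x T`. -/
theorem IsAdmissible.tangent_fst_eq_zero {φ : A ⟶ B} (hφ : IsAdmissible potentialEquation φ)
    {P : ℝ × ℝ × ℝ} (hP : P ∈ A.carrier) :
    (tangent φ P (0, 1, 0)).1 = 0 ∧ (tangent φ P (0, 0, 1)).1 = 0 := by
  have key : ∀ p q : ℝ, jacobian φ P p q ≠ 0 → (tangent φ P (0, 1, q)).1 = 0 := by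
    intro p q hJ
    have hne := A.elem.ne_zero _ (A.over_dom P hP)
    have hf : A.elem.f (P.1, P.2.1) ≠ 0 := left_ne_zero_of_mul hne
    have hf' : B.elem.f ((PointTransf.map φ P).1, (PointTransf.map φ P).2.1) ≠ 0 :=
      left_ne_zero_of_mul (B.elem.ne_zero _ (B.over_dom _ (map_mem φ hP)))
    obtain ⟨w, hw⟩ : ∃ w, p + 1 / (2 * A.elem.lam P.1) * q ^ 2 + A.elem.f (P.1, P.2.1) * w -
        dx A.elem.f (P.1, P.2.1) * q = 0 :=
      ⟨-(p + 1 / (2 * A.elem.lam P.1) * q ^ 2 - dx A.elem.f (P.1, P.2.1) * q) /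
        A.elem.f (P.1, P.2.1), by rw [mul_div_cancel₀ _ hf]; ring⟩
    -- two jets that differ in `v_tt` only: their images have the same first-order derivatives and,
    -- by the target equation, the same `v'_x'x'`
    obtain ⟨p₀, q₀, w₀, a1, a2, a3, a4⟩ :=
      hφ.image_quadJet hP (r := 0) hJ hw rfl rfl rfl rfl rfl rfl
    obtain ⟨p₁, q₁, w₁, b1, b2, b3, b4⟩ :=
      hφ.image_quadJet hP (r := 1) hJ hw rfl rfl rfl rfl rfl rfl
    have hρ := vertical_ne_zero φ hP rfl rfl rfl a1 a2
    have hJ' := hJ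
    rw [jacobian] at hJ'
    have hp : p₀ = p₁ := by
      refine mul_left_cancel₀ hJ' ?_
      linear_combination -(tangent φ P (0, 1, q)).2.1 * (a1 - b1) +
        (tangent φ P (1, 0, p)).2.1 * (a2 - b2)
    have hq : q₀ = q₁ := by
      refine mul_left_cancel₀ hJ' ?_
      linear_combination (tangent φ P (0, 1, q)).1 * (a1 - b1) -
        (tangent φ P (1, 0, p)).1 * (a2 - b2)
    subst hp hq
    have hw' : w₀ = w₁ := by
      refine mul_left_cancel₀ hf' ?_
      linear_combination a3 - b3
    subst hw'
    have h := b4.symm.trans a4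
    have h' : ((tangent φ P (0, 0, 1)).2.2 - p₀ * (tangent φ P (0, 0, 1)).1 -
        q₀ * (tangent φ P (0, 0, 1)).2.1) * (tangent φ P (0, 1, q)).1 ^ 2 = 0 := by
      linear_combination h
    exact pow_eq_zero_iff (two_ne_zero) |>.1 ((mul_eq_zero.1 h').resolve_left hρ)
  obtain ⟨a, b, hab⟩ := exists_jacobian_ne_zero φ hP
  have h := eq_zero_of_forall_ne_zero (f := fun y : ℝ × ℝ => jacobian φ P y.1 y.2)
    (g := fun y : ℝ × ℝ => (tangent φ P (0, 1, 0)).1 + y.2 * (tangent φ P (0, 0, 1)).1)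
    (by simp only [jacobian_apply]; fun_prop)
    (fun y _ => analyticAt_const.add (analyticAt_snd.mul analyticAt_const)) (x₀ := (a, b)) hab
    (fun y hy => by
      have := key y.1 y.2 hy
      rw [tangent_apply] at this
      simpa using this)
  have h0 := h (0, 0)
  have h1 := h (0, 1)
  simp only at h0 h1
  exact ⟨by linear_combination h0, by linear_combination h1 - h0⟩

theorem fderiv_tangent_apply {F : Type} [NormedAddCommGroup F] [NormedSpace ℝ F] {A B : LocalEq F}
    (φ : A ⟶ B) {p : ℝ × ℝ × F} (hp : p ∈ A.carrier) (ℓ : (ℝ × ℝ × F) →L[ℝ] ℝ)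
    (e w : ℝ × ℝ × F) :
    fderiv ℝ (fun y => ℓ (tangent φ y w)) p e = ℓ (fderiv ℝ (tangent φ) p e w) := by
  have h := ((contDiffAt_tangent φ hp).differentiableAt (by simp)).hasFDerivAt
  have h1 := ℓ.hasFDerivAt.comp p (h.clm_apply (hasFDerivAt_const w p))
  have h2 := h1.fderiv
  have h3 := DFunLike.congr_fun h2 e
  refine h3.trans ?_
  simp

/-- Every admissible transformation of potential equations is fibered. For the `x`-component, the
comparison of the coefficients of `v_xx` gives `f (D_x X) ^ 2 = T_t f'` for all values of `v_x`. -/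
theorem IsAdmissible.isFibered {φ : A ⟶ B} (hφ : IsAdmissible potentialEquation φ) :
    IsFibered φ := by
  intro P hP
  obtain ⟨hTx, hTv⟩ := hφ.tangent_fst_eq_zero hP
  refine ⟨hTx, hTv, ?_⟩
  have hf : A.elem.f (P.1, P.2.1) ≠ 0 :=
    left_ne_zero_of_mul (A.elem.ne_zero _ (A.over_dom P hP))
  set z' := ((PointTransf.map φ P).1, (PointTransf.map φ P).2.1) with hz'
  have hJe : ∀ p q, jacobian φ P p q = (tangent φ P (1, 0, 0)).1 *
      ((tangent φ P (0, 1, 0)).2.1 + q * (tangent φ P (0, 0, 1)).2.1) := by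
    intro p q
    rw [jacobian_apply, hTx, hTv]; ring
  have key : ∀ q : ℝ, jacobian φ P 0 q ≠ 0 → A.elem.f (P.1, P.2.1) *
      ((tangent φ P (0, 1, 0)).2.1 + q * (tangent φ P (0, 0, 1)).2.1) ^ 2 -
        (tangent φ P (1, 0, 0)).1 * B.elem.f z' = 0 := by
    intro q hJ
    rw [hJe] at hJ
    obtain ⟨p, hp⟩ : ∃ p, p = dx A.elem.f (P.1, P.2.1) * q - 1 / (2 * A.elem.lam P.1) * q ^ 2 :=
      ⟨_, rfl⟩
    -- two jets that satisfy the equation and have the same `v_x` but different `v_xx`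
    obtain ⟨p₀, q₀, w₀, a1, a2, a3, a4⟩ :=
      hφ.image_quadJet hP (p := p) (r := 0) (w := 0) (by rw [hJe]; exact hJ)
        (by rw [hp]; ring) hz' rfl rfl rfl rfl rfl
    obtain ⟨p₁, q₁, w₁, b1, b2, b3, b4⟩ :=
      hφ.image_quadJet hP (p := p - A.elem.f (P.1, P.2.1)) (r := 0) (w := 1)
        (by rw [hJe]; exact hJ) (by rw [hp]; ring) hz' rfl rfl rfl rfl rfl
    have hρ := vertical_ne_zero φ hP rfl rfl rfl a1 a2
    -- the `t`-component of `D_x` vanishes together with its derivatives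
    have hK : ∀ e, (fderiv ℝ (tangent φ) P e (0, 1, q)).1 = 0 := by
      intro e
      rw [← ContinuousLinearMap.coe_fst' (R := ℝ), ← fderiv_tangent_apply φ hP]
      have : (fun y => (ContinuousLinearMap.fst ℝ ℝ (ℝ × ℝ)) (tangent φ y (0, 1, q)))
          =ᶠ[𝓝 P] fun _ => 0 := by
        filter_upwards [A.isOpen_carrier.mem_nhds hP] with y hy
        obtain ⟨h1, h2⟩ := hφ.tangent_fst_eq_zero hy
        rw [tangent_apply]
        simp [h1, h2]
      rw [this.fderiv_eq]
      simp
    rw [hK, tangent_apply φ P 1 0, tangent_apply φ P 0 1, hJe] at a4 b4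
    rw [tangent_apply φ P 1 0] at a1 b1
    rw [tangent_apply φ P 0 1] at a2 b2
    simp only [Prod.fst_add, Prod.snd_add, Prod.smul_fst, Prod.smul_snd, smul_eq_mul, hTx, hTv,
      mul_zero, zero_mul, add_zero, zero_add, one_mul, sub_zero, neg_zero] at a1 a2 b1 b2 a4 b4 hρ
    set T := (tangent φ P (1, 0, 0)).1
    set n := (tangent φ P (0, 1, 0)).2.1 + q * (tangent φ P (0, 0, 1)).2.1
    have hT : T ≠ 0 := left_ne_zero_of_mul hJ
    have hn : n ≠ 0 := right_ne_zero_of_mul hJ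
    have hq : q₀ = q₁ := mul_left_cancel₀ hn (a2.symm.trans b2)
    subst hq
    set ρ := (tangent φ P (0, 0, 1)).2.2 - q₀ * (tangent φ P (0, 0, 1)).2.1
    have h1 : n ^ 2 * (w₁ - w₀) = ρ := by
      refine mul_left_cancel₀ (pow_ne_zero 2 hT) ?_
      rw [a2] at a4 b4
      linear_combination b4 - a4
    have h2 : T * (p₁ - p₀) = -A.elem.f (P.1, P.2.1) * ρ := by
      linear_combination a1 - b1
    have h3 : w₁ - w₀ ≠ 0 := fun h => hρ (by rw [← h1, h, mul_zero])
    refine (mul_eq_zero.1 ?_).resolve_right h3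
    linear_combination A.elem.f (P.1, P.2.1) * h1 + h2 - T * (b3 - a3)
  obtain ⟨a, b, hab⟩ := exists_jacobian_ne_zero φ hP
  have h := eq_zero_of_forall_ne_zero (f := fun q : ℝ => jacobian φ P 0 q)
    (by simp only [jacobian_apply]; fun_prop) (fun y _ => by fun_prop) (x₀ := b)
    (by rw [hJe] at hab ⊢; exact hab) key
  have h0 := h 0
  have h1 := h 1
  have h2 := h (-1)
  have h3 : A.elem.f (P.1, P.2.1) * (tangent φ P (0, 0, 1)).2.1 ^ 2 = 0 := by
    linear_combination (h1 + h2 - 2 * h0) / 2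
  exact (pow_eq_zero_iff two_ne_zero).1 ((mul_eq_zero.1 h3).resolve_left hf)

theorem IsFibered.preservesGraphs {φ : A ⟶ B} (hφ : IsFibered φ) : PreservesGraphs φ := by
  intro s z hz hs
  refine exists_transforms_of_jacobian_ne_zero φ hz hs ?_
  obtain ⟨hTx, hTv, hXv⟩ := hφ _ hz
  obtain ⟨a, b, hab⟩ := exists_jacobian_ne_zero φ hz
  rw [jacobian_apply, hTx, hTv, hXv] at hab ⊢
  simpa using hab

end

section

/-! ### First-order jets of potential systems -/

theorem potentialSystem_congr (θ : ArbElem) (s s' : ℝ × ℝ → ℝ × ℝ) (z : ℝ × ℝ)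
    (h : s =ᶠ[𝓝 z] s') : potentialSystem θ s z ↔ potentialSystem θ s' z := by
  have h1 : (fun y => (s y).1) =ᶠ[𝓝 z] fun y => (s' y).1 := h.mono fun y hy => by simp only [hy]
  have h2 : (fun y => (s y).2) =ᶠ[𝓝 z] fun y => (s' y).2 := h.mono fun y hy => by simp only [hy]
  simp only [potentialSystem, dt_congr h2, dx_congr h2, dx_congr h1, h.self_of_nhds]

theorem potentialSystem_iff (θ : ArbElem) {s : ℝ × ℝ → ℝ × ℝ} {z : ℝ × ℝ}
    (h : DifferentiableAt ℝ s z) : potentialSystem θ s z ↔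
      (fderiv ℝ s z (0, 1)).2 = θ.lam z.1 * (s z).1 ∧
      (fderiv ℝ s z (1, 0)).2 = -θ.lam z.1 * (1 / 2 * (s z).1 ^ 2 +
        θ.f z * (fderiv ℝ s z (0, 1)).1 - dx θ.f z * (s z).1) := by
  have h1 : HasFDerivAt (fun y => (s y).1) _ z := h.hasFDerivAt.fst
  have h2 : HasFDerivAt (fun y => (s y).2) _ z := h.hasFDerivAt.snd
  simp only [potentialSystem, dt_eq_fderiv h2.differentiableAt, dx_eq_fderiv h2.differentiableAt,
    dx_eq_fderiv h1.differentiableAt, h1.fderiv, h2.fderiv]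
  rfl

variable {A B : LocalEq (ℝ × ℝ)}

/-- The value of `v_t` at the point `p = (t,x,u,v)` that is prescribed by the potential system for
the value `b` of `u_x`. -/
noncomputable def vtVal (θ : ArbElem) (p : ℝ × ℝ × ℝ × ℝ) (b : ℝ) : ℝ :=
  -θ.lam p.1 * (1 / 2 * p.2.2.1 ^ 2 + θ.f (p.1, p.2.1) * b - dx θ.f (p.1, p.2.1) * p.2.2.1)

/-- The vector `D_t` for a first-order jet at `p` that satisfies the potential system, with
`u_t = a` and `u_x = b`. -/
noncomputable def vecT (θ : ArbElem) (p : ℝ × ℝ × ℝ × ℝ) (a b : ℝ) : ℝ × ℝ × ℝ × ℝ :=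
  (1, 0, a, vtVal θ p b)

/-- The vector `D_x` for a first-order jet at `p` that satisfies the potential system, with
`u_x = b`. -/
noncomputable def vecX (θ : ArbElem) (p : ℝ × ℝ × ℝ × ℝ) (b : ℝ) : ℝ × ℝ × ℝ × ℝ :=
  (0, 1, b, θ.lam p.1 * p.2.2.1)

/-- The Jacobian determinant of the induced map of the independent variables on such a jet. -/
noncomputable def sysJacobian (φ : A ⟶ B) (p : ℝ × ℝ × ℝ × ℝ) (a b : ℝ) : ℝ :=
  jacobian φ p (a, vtVal A.elem p b) (b, A.elem.lam p.1 * p.2.2.1)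

/-- The image of a first-order jet satisfying the source system satisfies the target system; `a'`
and `b'` stand for `u'_t'` and `u'_x'`. -/
theorem IsAdmissible.image_jet {φ : A ⟶ B} (hφ : IsAdmissible potentialSystem φ)
    {p : ℝ × ℝ × ℝ × ℝ} (hp : p ∈ A.carrier) {a b : ℝ} (hJ : sysJacobian φ p a b ≠ 0)
    {q : ℝ × ℝ × ℝ × ℝ} (hq : q = PointTransf.map φ p) :
    ∃ a' b' : ℝ,
      (tangent φ p (vecT A.elem p a b)).2.2.1 = (tangent φ p (vecT A.elem p a b)).1 * a' +
        (tangent φ p (vecT A.elem p a b)).2.1 * b' ∧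
      (tangent φ p (vecX A.elem p b)).2.2.1 = (tangent φ p (vecX A.elem p b)).1 * a' +
        (tangent φ p (vecX A.elem p b)).2.1 * b' ∧
      (tangent φ p (vecT A.elem p a b)).2.2.2 =
        (tangent φ p (vecT A.elem p a b)).1 * vtVal B.elem q b' +
        (tangent φ p (vecT A.elem p a b)).2.1 * (B.elem.lam q.1 * q.2.2.1) ∧
      (tangent φ p (vecX A.elem p b)).2.2.2 =
        (tangent φ p (vecX A.elem p b)).1 * vtVal B.elem q b' +
        (tangent φ p (vecX A.elem p b)).2.1 * (B.elem.lam q.1 * q.2.2.1) := by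
  let z : ℝ × ℝ := (p.1, p.2.1)
  let s : ℝ × ℝ → ℝ × ℝ := fun y => (quadJet z p.2.2.1 a b 0 0 0 y,
    quadJet z p.2.2.2 (vtVal A.elem p b) (A.elem.lam p.1 * p.2.2.1) 0 0 0 y)
  have hs : ContDiffAt ℝ ∞ s z :=
    (contDiff_quadJet ..).contDiffAt.prodMk (contDiff_quadJet ..).contDiffAt
  have hsd := hs.differentiableAt (by simp)
  have hsz : s z = p.2.2 := by simp only [s, quadJet_self]
  have hg : graphPt s z = p := by
    simp only [graphPt, hsz]; rfl
  have hfd : ∀ e, fderiv ℝ s z e = (a * e.1 + b * e.2,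
      vtVal A.elem p b * e.1 + A.elem.lam p.1 * p.2.2.1 * e.2) := by
    intro e
    have h := ((contDiff_quadJet z p.2.2.1 a b 0 0 0).contDiffAt.differentiableAt
      (x := z) (by simp)).hasFDerivAt.prodMk ((contDiff_quadJet z p.2.2.2 (vtVal A.elem p b)
      (A.elem.lam p.1 * p.2.2.1) 0 0 0).contDiffAt.differentiableAt (x := z) (by simp)).hasFDerivAt
    rw [show fderiv ℝ s z = _ from h.fderiv]
    simp [fderiv_quadJet]
  obtain ⟨s', y, hs', ht⟩ := exists_transforms_of_jacobian_ne_zero φ (s := s) (z := z)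
    (by rw [hg]; exact hp) hs (by rw [hg, hfd, hfd]; simpa [sysJacobian] using hJ)
  have hsd' := hs'.differentiableAt (by simp)
  have hE1 : potentialSystem A.elem s z := by
    rw [potentialSystem_iff _ hsd, hfd, hfd, hsz]
    simp [vtVal, z]
  have hE2 := (hφ s s' z y hs hs' ht).1 hE1
  rw [potentialSystem_iff _ hsd'] at hE2
  have hm := ht.map_eq
  rw [hg, ← hq] at hm
  have c1 := ht.chain_rule hsd hsd' (1, 0)
  have c2 := ht.chain_rule hsd hsd' (0, 1)
  simp only [hfd, hg] at c1 c2
  have e1 : ((1 : ℝ), (0 : ℝ), a * 1 + b * 0,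
      vtVal A.elem p b * 1 + A.elem.lam p.1 * p.2.2.1 * 0) = vecT A.elem p a b := by
    simp [vecT]
  have e2 : ((0 : ℝ), (1 : ℝ), a * 0 + b * 1,
      vtVal A.elem p b * 0 + A.elem.lam p.1 * p.2.2.1 * 1) = vecX A.elem p b := by
    simp [vecX]
  rw [e1] at c1
  rw [e2] at c2
  have hv : vtVal B.elem q (fderiv ℝ s' y (0, 1)).1 = (fderiv ℝ s' y (1, 0)).2 := by
    rw [hE2.2, vtVal, hm]; rfl
  have hl : B.elem.lam q.1 * q.2.2.1 = (fderiv ℝ s' y (0, 1)).2 := by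
    rw [hE2.1, hm]; rfl
  refine ⟨(fderiv ℝ s' y (1, 0)).1, (fderiv ℝ s' y (0, 1)).1, ?_, ?_, ?_, ?_⟩
  · simpa using congrArg Prod.fst c1
  · simpa using congrArg Prod.fst c2
  · rw [hv, hl]; simpa using congrArg Prod.snd c1
  · rw [hv, hl]; simpa using congrArg Prod.snd c2

theorem functional_apply (ℓ : (ℝ × ℝ × ℝ × ℝ) →L[ℝ] ℝ) (a b c d : ℝ) :
    ℓ (a, b, c, d) = a * ℓ (1, 0, 0, 0) + b * ℓ (0, 1, 0, 0) + c * ℓ (0, 0, 1, 0) +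
      d * ℓ (0, 0, 0, 1) := by
  simp only [← smul_eq_mul, ← map_smul, ← map_add]
  congr 1
  ext <;> simp

/-- The form of `covector_eq_zero` in coordinates. The coefficients of the polynomial identity in
`a`, `b` leave one minor of `α`, `β` undetermined, which vanishes by the Plücker relation. -/
theorem covector_eq_zero_aux {k c₀ αt αx αu αv βt βx βu βv : ℝ} (hk : k ≠ 0)
    (h : ∀ a b : ℝ, (αt + a * αu + (c₀ - k * b) * αv) * (βx + b * βu) =
      (αx + b * αu) * (βt + a * βu + (c₀ - k * b) * βv))
    {t₁ x₁ u₁ v₁ t₂ x₂ u₂ v₂ : ℝ}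
    (h11 : t₁ * αt + x₁ * αx + u₁ * αu + v₁ * αv = 1)
    (h12 : t₂ * αt + x₂ * αx + u₂ * αu + v₂ * αv = 0)
    (h21 : t₁ * βt + x₁ * βx + u₁ * βu + v₁ * βv = 0)
    (h22 : t₂ * βt + x₂ * βx + u₂ * βu + v₂ * βv = 1) :
    (αu = 0 ∧ αx = 0) ∧ βu = 0 ∧ βx = 0 := by
  have h00 := h 0 0
  have h10 := h 1 0
  have h01 := h 0 1
  have h0m := h 0 (-1)
  have E1 : αu * βx - αx * βu = 0 := by linear_combination h10 - h00
  have E2 : αu * βv - αv * βu = 0 := by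
    refine (mul_eq_zero.1 (?_ : k * _ = 0)).resolve_left hk
    linear_combination (h01 + h0m - 2 * h00) / 2
  have E3 : αt * βu - αu * βt = k * (αv * βx - αx * βv) := by
    linear_combination (h01 - h0m) / 2 + c₀ * E2
  -- the Plücker relation for the decomposable two-form `α ∧ β`
  have E4 : αv * βx - αx * βv = 0 := by
    have : k * (αv * βx - αx * βv) ^ 2 = 0 := by
      linear_combination -(αv * βx - αx * βv) * E3 - (αv * βt - αt * βv) * E1 -
        (αt * βx - αx * βt) * E2
    exact (pow_eq_zero_iff two_ne_zero).1 ((mul_eq_zero.1 this).resolve_left hk)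
  have E5 : αt * βu - αu * βt = 0 := by rw [E3, E4, mul_zero]
  have E6 : αt * βx - αx * βt = 0 := by linear_combination h00 - c₀ * E4
  refine ⟨⟨?_, ?_⟩, ?_, ?_⟩
  · linear_combination -αu * h22 + βu * h12 - t₂ * E5 + v₂ * E2 + x₂ * E1
  · linear_combination -αx * h22 + βx * h12 - t₂ * E6 - u₂ * E1 - v₂ * E4
  · linear_combination -βu * h11 + αu * h21 + t₁ * E5 - v₁ * E2 - x₁ * E1
  · linear_combination -βx * h11 + αx * h21 + t₁ * E6 + u₁ * E1 + v₁ * E4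

/-- If `α ∧ β` vanishes on all tangent planes `⟨D_t, D_x⟩` that satisfy the potential system, then
the independent covectors `α`, `β` are linear combinations of `dt` and `dv - λ u dx`. -/
theorem covector_eq_zero {θ : ArbElem} {p : ℝ × ℝ × ℝ × ℝ} (hp : (p.1, p.2.1) ∈ θ.dom)
    {α β : (ℝ × ℝ × ℝ × ℝ) →L[ℝ] ℝ} {e₁ e₂ : ℝ × ℝ × ℝ × ℝ} (h11 : α e₁ = 1) (h12 : α e₂ = 0)
    (h21 : β e₁ = 0) (h22 : β e₂ = 1)
    (h : ∀ a b, α (vecT θ p a b) * β (vecX θ p b) = α (vecX θ p b) * β (vecT θ p a b)) :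
    (α (0, 0, 1, 0) = 0 ∧ α (0, 1, 0, θ.lam p.1 * p.2.2.1) = 0) ∧
      (β (0, 0, 1, 0) = 0 ∧ β (0, 1, 0, θ.lam p.1 * p.2.2.1) = 0) := by
  have hne := θ.ne_zero _ hp
  set μ := θ.lam p.1 * p.2.2.1 with hμ
  obtain ⟨t₁, x₁, u₁, v₁⟩ := e₁
  obtain ⟨t₂, x₂, u₂, v₂⟩ := e₂
  have hv : ∀ b, vtVal θ p b = vtVal θ p 0 - θ.f (p.1, p.2.1) * θ.lam p.1 * b :=
    fun b => by simp only [vtVal]; ring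
  -- coordinates with respect to the basis `∂_t`, `∂_x + λ u ∂_v`, `∂_u`, `∂_v`
  have hbas : ∀ (ℓ : (ℝ × ℝ × ℝ × ℝ) →L[ℝ] ℝ) (a b c d : ℝ), ℓ (a, b, c, d) =
      a * ℓ (1, 0, 0, 0) + b * ℓ (0, 1, 0, μ) + c * ℓ (0, 0, 1, 0) +
        (d - b * μ) * ℓ (0, 0, 0, 1) := by
    intro ℓ a b c d
    rw [functional_apply ℓ a b c d, functional_apply ℓ 0 1 0 μ]
    ring
  rw [hbas] at h11 h12 h21 h22
  refine covector_eq_zero_aux hne (c₀ := vtVal θ p 0) (fun a b => ?_) h11 h12 h21 h22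
  have h1 := h a b
  rw [vecT, vecX, ← hμ, hv, hbas α 1 0 a, hbas β 1 0 a, hbas α 0 1 b, hbas β 0 1 b] at h1
  linear_combination h1

end

section

/-! ### The pullback of the contact form and generic points -/

variable {A B : LocalEq (ℝ × ℝ)}

attribute [local fun_prop] analyticAt_fst analyticAt_snd

/-- The covector `dt` on the space of `(t,x,u,v)`. -/
noncomputable def covT : (ℝ × ℝ × ℝ × ℝ) →L[ℝ] ℝ := ContinuousLinearMap.fst ℝ ℝ _

/-- The covector `dx` on the space of `(t,x,u,v)`. -/
noncomputable def covX : (ℝ × ℝ × ℝ × ℝ) →L[ℝ] ℝ :=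
  (ContinuousLinearMap.fst ℝ ℝ _).comp (ContinuousLinearMap.snd ℝ ℝ _)

/-- The covector `dv` on the space of `(t,x,u,v)`. -/
noncomputable def covV : (ℝ × ℝ × ℝ × ℝ) →L[ℝ] ℝ :=
  (ContinuousLinearMap.snd ℝ ℝ ℝ).comp
    ((ContinuousLinearMap.snd ℝ ℝ (ℝ × ℝ)).comp (ContinuousLinearMap.snd ℝ ℝ _))

@[simp] theorem covT_apply (w : ℝ × ℝ × ℝ × ℝ) : covT w = w.1 := rfl
@[simp] theorem covX_apply (w : ℝ × ℝ × ℝ × ℝ) : covX w = w.2.1 := rfl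
@[simp] theorem covV_apply (w : ℝ × ℝ × ℝ × ℝ) : covV w = w.2.2.2 := rfl

/-- The points over which the first-order jets satisfying the potential system are generically
mapped to jets of functions. -/
def Generic (φ : A ⟶ B) (p : ℝ × ℝ × ℝ × ℝ) : Prop := ∃ a b, sysJacobian φ p a b ≠ 0

theorem sysJacobian_eq (φ : A ⟶ B) (p : ℝ × ℝ × ℝ × ℝ) (a b : ℝ) :
    sysJacobian φ p a b =
      (tangent φ p (vecT A.elem p a b)).1 * (tangent φ p (vecX A.elem p b)).2.1 -
        (tangent φ p (vecX A.elem p b)).1 * (tangent φ p (vecT A.elem p a b)).2.1 := rfl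

theorem vtVal_eq (θ : ArbElem) (p : ℝ × ℝ × ℝ × ℝ) (b : ℝ) :
    vtVal θ p b = vtVal θ p 0 - θ.f (p.1, p.2.1) * θ.lam p.1 * b := by
  simp only [vtVal]; ring

theorem analyticAt_vecT (θ : ArbElem) (p : ℝ × ℝ × ℝ × ℝ) (y : ℝ × ℝ) :
    AnalyticAt ℝ (fun y : ℝ × ℝ => vecT θ p y.1 y.2) y := by
  simp only [vecT, vtVal_eq θ p (Prod.snd _)]
  exact analyticAt_const.prod (analyticAt_const.prod (analyticAt_fst.prod (by fun_prop)))

theorem analyticAt_vecX (θ : ArbElem) (p : ℝ × ℝ × ℝ × ℝ) (y : ℝ × ℝ) :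
    AnalyticAt ℝ (fun y : ℝ × ℝ => vecX θ p y.2) y :=
  analyticAt_const.prod (analyticAt_const.prod (analyticAt_snd.prod analyticAt_const))

theorem analyticAt_functional_vecT (θ : ArbElem) (p : ℝ × ℝ × ℝ × ℝ)
    (ℓ : (ℝ × ℝ × ℝ × ℝ) →L[ℝ] ℝ) (y : ℝ × ℝ) :
    AnalyticAt ℝ (fun y : ℝ × ℝ => ℓ (vecT θ p y.1 y.2)) y :=
  (ℓ.analyticAt _).comp (analyticAt_vecT θ p y)

theorem analyticAt_functional_vecX (θ : ArbElem) (p : ℝ × ℝ × ℝ × ℝ)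
    (ℓ : (ℝ × ℝ × ℝ × ℝ) →L[ℝ] ℝ) (y : ℝ × ℝ) :
    AnalyticAt ℝ (fun y : ℝ × ℝ => ℓ (vecX θ p y.2)) y :=
  (ℓ.analyticAt _).comp (analyticAt_vecX θ p y)

theorem continuous_sysJacobian (φ : A ⟶ B) (p : ℝ × ℝ × ℝ × ℝ) :
    Continuous fun y : ℝ × ℝ => sysJacobian φ p y.1 y.2 := by
  have hT : Continuous fun y : ℝ × ℝ => vecT A.elem p y.1 y.2 :=
    continuous_iff_continuousAt.2 fun y => (analyticAt_vecT A.elem p y).continuousAt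
  have hX : Continuous fun y : ℝ × ℝ => vecX A.elem p y.2 :=
    continuous_iff_continuousAt.2 fun y => (analyticAt_vecX A.elem p y).continuousAt
  simp only [sysJacobian_eq]
  fun_prop

/-- An analytic function of `(u_t, u_x)` that vanishes on the jets that are mapped to jets of
functions vanishes identically. -/
theorem Generic.eq_zero {φ : A ⟶ B} {p : ℝ × ℝ × ℝ × ℝ} (h : Generic φ p) {g : ℝ × ℝ → ℝ}
    (hg : ∀ y, AnalyticAt ℝ g y) (h0 : ∀ a b, sysJacobian φ p a b ≠ 0 → g (a, b) = 0) (a b : ℝ) :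
    g (a, b) = 0 := by
  obtain ⟨a₀, b₀, hab⟩ := h
  exact eq_zero_of_forall_ne_zero (continuous_sysJacobian φ p) (fun y _ => hg y) (x₀ := (a₀, b₀))
    hab (fun y hy => h0 y.1 y.2 hy) (a, b)

/-- The contact form `dv' - λ' u' dx'` of the target at the image of `p`, pulled back to `p`. -/
noncomputable def contactForm (φ : A ⟶ B) (p : ℝ × ℝ × ℝ × ℝ) : (ℝ × ℝ × ℝ × ℝ) →L[ℝ] ℝ :=
  (covV - (B.elem.lam (PointTransf.map φ p).1 * (PointTransf.map φ p).2.2.1) • covX).comp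
    (tangent φ p)

theorem contactForm_apply (φ : A ⟶ B) (p w : ℝ × ℝ × ℝ × ℝ) :
    contactForm φ p w = (tangent φ p w).2.2.2 -
      B.elem.lam (PointTransf.map φ p).1 * (PointTransf.map φ p).2.2.1 * (tangent φ p w).2.1 :=
  rfl

/-- At generic points, `dt'` and the contact form of the target are combinations of `dt` and
`dv - λ u dx`: their exterior product vanishes on the jets that satisfy the source system, because
`v'_x' = λ' u'` on the images of these jets. -/
theorem IsAdmissible.contact {φ : A ⟶ B} (hφ : IsAdmissible potentialSystem φ)
    {p : ℝ × ℝ × ℝ × ℝ} (hp : p ∈ A.carrier) (hg : Generic φ p) :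
    ((tangent φ p (0, 0, 1, 0)).1 = 0 ∧
        (tangent φ p (0, 1, 0, A.elem.lam p.1 * p.2.2.1)).1 = 0) ∧
      (contactForm φ p (0, 0, 1, 0) = 0 ∧
        contactForm φ p (0, 1, 0, A.elem.lam p.1 * p.2.2.1) = 0) := by
  obtain ⟨e₁, h₁⟩ : ∃ e, tangent φ p e = (1, 0, 0, 0) := ⟨_, tangent_tangent_inv φ hp _⟩
  obtain ⟨e₂, h₂⟩ : ∃ e, tangent φ p e = (0, 0, 0, 1) := ⟨_, tangent_tangent_inv φ hp _⟩
  refine covector_eq_zero (θ := A.elem) (α := covT.comp (tangent φ p)) (β := contactForm φ p)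
    (e₁ := e₁) (e₂ := e₂) (A.over_dom p hp) ?_ ?_ ?_ ?_ fun a b => ?_
  · simp [h₁]
  · simp [h₂]
  · simp [contactForm_apply, h₁]
  · simp [contactForm_apply, h₂]
  · refine sub_eq_zero.1 (hg.eq_zero (g := fun y : ℝ × ℝ =>
      (covT.comp (tangent φ p)) (vecT A.elem p y.1 y.2) * contactForm φ p (vecX A.elem p y.2) -
      (covT.comp (tangent φ p)) (vecX A.elem p y.2) * contactForm φ p (vecT A.elem p y.1 y.2))
      (fun y => ?_) (fun a b hJ => ?_) a b)
    · exact ((analyticAt_functional_vecT _ _ _ _).mul (analyticAt_functional_vecX _ _ _ _)).sub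
        ((analyticAt_functional_vecX _ _ _ _).mul (analyticAt_functional_vecT _ _ _ _))
    · obtain ⟨a', b', -, -, h3, h4⟩ := hφ.image_jet hp hJ rfl
      simp only [contactForm_apply, ContinuousLinearMap.comp_apply, covT_apply]
      rw [h3, h4]
      ring

/-- At the other points, the same holds for `dt'` and `dx'`, by the definition of genericity. -/
theorem not_generic_contact {φ : A ⟶ B} {p : ℝ × ℝ × ℝ × ℝ} (hp : p ∈ A.carrier)
    (hg : ¬ Generic φ p) :
    ((tangent φ p (0, 0, 1, 0)).1 = 0 ∧
        (tangent φ p (0, 1, 0, A.elem.lam p.1 * p.2.2.1)).1 = 0) ∧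
      ((tangent φ p (0, 0, 1, 0)).2.1 = 0 ∧
        (tangent φ p (0, 1, 0, A.elem.lam p.1 * p.2.2.1)).2.1 = 0) := by
  obtain ⟨e₁, h₁⟩ : ∃ e, tangent φ p e = (1, 0, 0, 0) := ⟨_, tangent_tangent_inv φ hp _⟩
  obtain ⟨e₂, h₂⟩ : ∃ e, tangent φ p e = (0, 1, 0, 0) := ⟨_, tangent_tangent_inv φ hp _⟩
  refine covector_eq_zero (θ := A.elem) (α := covT.comp (tangent φ p))
    (β := covX.comp (tangent φ p))
    (e₁ := e₁) (e₂ := e₂) (A.over_dom p hp) (by simp [h₁]) (by simp [h₂]) (by simp [h₁])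
    (by simp [h₂]) fun a b => ?_
  unfold Generic at hg
  push Not at hg
  have h := hg a b
  rw [sysJacobian_eq] at h
  exact sub_eq_zero.1 h

/-- The line through `p` along which only `u` varies. -/
def uLine (p : ℝ × ℝ × ℝ × ℝ) (τ : ℝ) : ℝ × ℝ × ℝ × ℝ := (p.1, p.2.1, p.2.2.1 + τ, p.2.2.2)

theorem uLine_zero (p : ℝ × ℝ × ℝ × ℝ) : uLine p 0 = p := by simp [uLine]

theorem hasDerivAt_uLine (p : ℝ × ℝ × ℝ × ℝ) (τ : ℝ) :
    HasDerivAt (uLine p) (0, 0, 1, 0) τ :=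
  (hasDerivAt_const _ _).prodMk ((hasDerivAt_const _ _).prodMk
    (((hasDerivAt_id τ).const_add p.2.2.1).prodMk (hasDerivAt_const _ _)))

theorem tendsto_uLine (p : ℝ × ℝ × ℝ × ℝ) : Tendsto (uLine p) (𝓝 0) (𝓝 p) := by
  have := (hasDerivAt_uLine p 0).continuousAt
  rwa [ContinuousAt, uLine_zero] at this

theorem hasDerivAt_map_uLine (φ : A ⟶ B) {p : ℝ × ℝ × ℝ × ℝ} (hp : p ∈ A.carrier) :
    HasDerivAt (fun τ => PointTransf.map φ (uLine p τ)) (tangent φ p (0, 0, 1, 0)) 0 := by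
  have h := hasFDerivAt_map φ hp
  rw [← uLine_zero p] at h
  have h1 := HasFDerivAt.comp_hasDerivAt (f := uLine p) 0 h (hasDerivAt_uLine p 0)
  rw [uLine_zero p] at h1
  exact h1

theorem hasDerivAt_tangent_uLine (φ : A ⟶ B) {p : ℝ × ℝ × ℝ × ℝ} (hp : p ∈ A.carrier) :
    HasDerivAt (fun τ => tangent φ (uLine p τ)) (fderiv ℝ (tangent φ) p (0, 0, 1, 0)) 0 := by
  have h := ((contDiffAt_tangent φ hp).differentiableAt (by simp)).hasFDerivAt
  rw [← uLine_zero p] at h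
  have h1 := HasFDerivAt.comp_hasDerivAt (f := uLine p) 0 h (hasDerivAt_uLine p 0)
  rw [uLine_zero p] at h1
  exact h1

/-- If the component `ℓ` of `φ` does not depend on `u` near `p`, then neither do its partial
derivatives. -/
theorem hasDerivAt_functional_tangent_uLine (φ : A ⟶ B) {p : ℝ × ℝ × ℝ × ℝ}
    (hp : p ∈ A.carrier) (ℓ : (ℝ × ℝ × ℝ × ℝ) →L[ℝ] ℝ)
    (h : ∀ᶠ y in 𝓝 p, ℓ (tangent φ y (0, 0, 1, 0)) = 0)
    {w : ℝ → ℝ × ℝ × ℝ × ℝ} {w' : ℝ × ℝ × ℝ × ℝ} (hw : HasDerivAt w w' 0) :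
    HasDerivAt (fun τ => ℓ (tangent φ (uLine p τ) (w τ))) (ℓ (tangent φ p w')) 0 := by
  have h1 := ℓ.hasFDerivAt.comp_hasDerivAt 0 ((hasDerivAt_tangent_uLine φ hp).clm_apply hw)
  have h2 : ℓ (fderiv ℝ (tangent φ) p (0, 0, 1, 0) (w 0)) = 0 := by
    rw [fderiv_tangent_comm φ hp, ← fderiv_tangent_apply φ hp]
    have h3 : (fun y => ℓ (tangent φ y (0, 0, 1, 0))) =ᶠ[𝓝 p] fun _ => 0 := h
    rw [h3.fderiv_eq]
    simp
  rw [map_add, h2, zero_add, uLine_zero] at h1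
  exact h1

/-- A function whose differential is near `p` a combination of `dt` and the contact form
`dv - λ u dx` depends on `t` only, since this contact form is not integrable modulo `dt`. -/
theorem functional_tangent_eq_zero (φ : A ⟶ B) {p : ℝ × ℝ × ℝ × ℝ} (hp : p ∈ A.carrier)
    (ℓ : (ℝ × ℝ × ℝ × ℝ) →L[ℝ] ℝ) (h : ∀ᶠ y in 𝓝 p, ℓ (tangent φ y (0, 0, 1, 0)) = 0 ∧
      ℓ (tangent φ y (0, 1, 0, A.elem.lam y.1 * y.2.2.1)) = 0) :
    ℓ (tangent φ p (0, 1, 0, 0)) = 0 ∧ ℓ (tangent φ p (0, 0, 1, 0)) = 0 ∧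
      ℓ (tangent φ p (0, 0, 0, 1)) = 0 := by
  have hl : A.elem.lam p.1 ≠ 0 := right_ne_zero_of_mul (A.elem.ne_zero _ (A.over_dom p hp))
  have hw : HasDerivAt (fun τ => ((0, 1, 0, A.elem.lam p.1 * (p.2.2.1 + τ)) : ℝ × ℝ × ℝ × ℝ))
      (0, 0, 0, A.elem.lam p.1) 0 := by
    have h1 := ((hasDerivAt_id (0 : ℝ)).const_add p.2.2.1).const_mul (A.elem.lam p.1)
    rw [mul_one] at h1
    exact (hasDerivAt_const _ _).prodMk ((hasDerivAt_const _ _).prodMk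
      ((hasDerivAt_const _ _).prodMk h1))
  have h1 := hasDerivAt_functional_tangent_uLine φ hp ℓ (h.mono fun _ hy => hy.1) hw
  have h2 : (fun τ => ℓ (tangent φ (uLine p τ) (0, 1, 0, A.elem.lam p.1 * (p.2.2.1 + τ))))
      =ᶠ[𝓝 0] fun _ => 0 := by
    filter_upwards [(tendsto_uLine p).eventually h] with τ hτ using hτ.2
  have h3 := (h1.congr_of_eventuallyEq h2.symm).unique (hasDerivAt_const 0 (0 : ℝ))
  obtain ⟨hu, hx⟩ := h.self_of_nhds
  have e1 : ((0, 0, 0, A.elem.lam p.1) : ℝ × ℝ × ℝ × ℝ) = A.elem.lam p.1 • (0, 0, 0, 1) := by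
    simp
  rw [e1, map_smul, map_smul, smul_eq_mul] at h3
  have hv := (mul_eq_zero.1 h3).resolve_left hl
  refine ⟨?_, hu, hv⟩
  have e2 : ((0, 1, 0, A.elem.lam p.1 * p.2.2.1) : ℝ × ℝ × ℝ × ℝ) =
      (0, 1, 0, 0) + (A.elem.lam p.1 * p.2.2.1) • (0, 0, 0, 1) := by simp
  rw [e2, map_add, map_smul, map_add, map_smul, hv, smul_zero, add_zero] at hx
  exact hx

theorem continuousAt_dx {θ : ArbElem} {z : ℝ × ℝ} (hz : z ∈ θ.dom) : ContinuousAt (dx θ.f) z :=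
  (contDiffAt_dx (θ.smooth_f.contDiffAt (θ.isOpen_dom.mem_nhds hz))).continuousAt

theorem Generic.eventually {φ : A ⟶ B} {p : ℝ × ℝ × ℝ × ℝ} (hp : p ∈ A.carrier)
    (h : Generic φ p) : ∀ᶠ y in 𝓝 p, Generic φ y := by
  obtain ⟨a, b, hab⟩ := h
  have hz := A.over_dom p hp
  have h1 : ContinuousAt (fun y : ℝ × ℝ × ℝ × ℝ => A.elem.lam y.1) p :=
    ContinuousAt.comp (f := fun y : ℝ × ℝ × ℝ × ℝ => y.1) (A.elem.smooth_lam _ hz).continuousAt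
      continuousAt_fst
  have hpr : ContinuousAt (fun y : ℝ × ℝ × ℝ × ℝ => (y.1, y.2.1)) p := by fun_prop
  have h2 : ContinuousAt (fun y : ℝ × ℝ × ℝ × ℝ => A.elem.f (y.1, y.2.1)) p :=
    ContinuousAt.comp (f := fun y : ℝ × ℝ × ℝ × ℝ => (y.1, y.2.1))
      (A.elem.smooth_f.contDiffAt (A.elem.isOpen_dom.mem_nhds hz)).continuousAt hpr
  have h3 : ContinuousAt (fun y : ℝ × ℝ × ℝ × ℝ => dx A.elem.f (y.1, y.2.1)) p :=
    ContinuousAt.comp (f := fun y : ℝ × ℝ × ℝ × ℝ => (y.1, y.2.1)) (continuousAt_dx hz) hpr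
  have h4 : ContinuousAt (fun y => tangent φ y) p := (contDiffAt_tangent φ hp).continuousAt
  have h5 : ContinuousAt (fun y => tangent φ y (vecT A.elem y a b)) p := by
    refine h4.clm_apply ?_
    unfold vecT vtVal
    fun_prop
  have h6 : ContinuousAt (fun y => tangent φ y (vecX A.elem y b)) p := by
    refine h4.clm_apply ?_
    unfold vecX
    fun_prop
  have h7 : ContinuousAt (fun y => sysJacobian φ y a b) p := by
    simp only [sysJacobian_eq]
    fun_prop
  filter_upwards [h7.eventually_ne hab] with y hy using ⟨a, b, hy⟩

/-- Generic points are dense: otherwise both `dt'` and `dx'` would be multiples of `dt`. -/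
theorem frequently_generic (φ : A ⟶ B) {p : ℝ × ℝ × ℝ × ℝ} (hp : p ∈ A.carrier) :
    ∃ᶠ y in 𝓝 p, y ∈ A.carrier ∧ Generic φ y := by
  intro hnot
  have hA := A.isOpen_carrier.mem_nhds hp
  have hc : ∀ᶠ y in 𝓝 p, ((tangent φ y (0, 0, 1, 0)).1 = 0 ∧
        (tangent φ y (0, 1, 0, A.elem.lam y.1 * y.2.2.1)).1 = 0) ∧
      ((tangent φ y (0, 0, 1, 0)).2.1 = 0 ∧
        (tangent φ y (0, 1, 0, A.elem.lam y.1 * y.2.2.1)).2.1 = 0) := by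
    filter_upwards [hnot, hA] with y h1 h2
    exact not_generic_contact h2 fun h => h1 ⟨h2, h⟩
  obtain ⟨t1, t2, t3⟩ := functional_tangent_eq_zero φ hp covT (hc.mono fun _ h => h.1)
  obtain ⟨x1, x2, x3⟩ := functional_tangent_eq_zero φ hp covX (hc.mono fun _ h => h.2)
  have hT : ∀ w : ℝ × ℝ × ℝ × ℝ, (tangent φ p w).1 = w.1 * (tangent φ p (1, 0, 0, 0)).1 := by
    intro w
    have := functional_apply (covT.comp (tangent φ p)) w.1 w.2.1 w.2.2.1 w.2.2.2
    simp only [ContinuousLinearMap.comp_apply, t1, t2, t3] at this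
    simpa using this
  have hX : ∀ w : ℝ × ℝ × ℝ × ℝ, (tangent φ p w).2.1 = w.1 * (tangent φ p (1, 0, 0, 0)).2.1 := by
    intro w
    have := functional_apply (covX.comp (tangent φ p)) w.1 w.2.1 w.2.2.1 w.2.2.2
    simp only [ContinuousLinearMap.comp_apply, x1, x2, x3] at this
    simpa using this
  obtain ⟨e₁, h₁⟩ : ∃ e, tangent φ p e = (1, 0, 0, 0) := ⟨_, tangent_tangent_inv φ hp _⟩
  obtain ⟨e₂, h₂⟩ : ∃ e, tangent φ p e = (0, 1, 0, 0) := ⟨_, tangent_tangent_inv φ hp _⟩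
  have a1 := hT e₁
  have a2 := hX e₁
  have b1 := hT e₂
  have b2 := hX e₂
  rw [h₁] at a1 a2
  rw [h₂] at b1 b2
  simp only at a1 a2 b1 b2
  have : (1 : ℝ) = 0 := by
    calc (1 : ℝ) = (e₁.1 * (tangent φ p (1, 0, 0, 0)).1) *
        (e₂.1 * (tangent φ p (1, 0, 0, 0)).2.1) := by rw [← a1, ← b2, mul_one]
      _ = (e₁.1 * (tangent φ p (1, 0, 0, 0)).2.1) *
        (e₂.1 * (tangent φ p (1, 0, 0, 0)).1) := by ring
      _ = 0 := by rw [← a2, zero_mul]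
  norm_num at this

/-- A component of the differential that vanishes at all generic points vanishes. -/
theorem functional_tangent_eq_zero_of_generic (φ : A ⟶ B) (ℓ : (ℝ × ℝ × ℝ × ℝ) →L[ℝ] ℝ)
    (w : ℝ × ℝ × ℝ × ℝ)
    (h : ∀ y ∈ A.carrier, Generic φ y → ℓ (tangent φ y w) = 0) :
    ∀ p ∈ A.carrier, ℓ (tangent φ p w) = 0 := by
  intro p hp
  by_contra hne
  have hc : ContinuousAt (fun y => ℓ (tangent φ y w)) p := by
    have := (contDiffAt_tangent φ hp).continuousAt
    fun_prop
  exact frequently_generic φ hp ((hc.eventually_ne hne).mono fun y hy hy' => hy (h y hy'.1 hy'.2))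

/-- The `t`-component of an admissible transformation depends on `t` only. -/
theorem IsAdmissible.system_tangent_fst {φ : A ⟶ B} (hφ : IsAdmissible potentialSystem φ)
    {p : ℝ × ℝ × ℝ × ℝ} (hp : p ∈ A.carrier) :
    (tangent φ p (0, 1, 0, 0)).1 = 0 ∧ (tangent φ p (0, 0, 1, 0)).1 = 0 ∧
      (tangent φ p (0, 0, 0, 1)).1 = 0 := by
  have key : ∀ y ∈ A.carrier, Generic φ y → covT (tangent φ y (0, 1, 0, 0)) = 0 ∧
      covT (tangent φ y (0, 0, 1, 0)) = 0 ∧ covT (tangent φ y (0, 0, 0, 1)) = 0 := by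
    intro y hy hg
    refine functional_tangent_eq_zero φ hy covT ?_
    filter_upwards [hg.eventually hy, A.isOpen_carrier.mem_nhds hy] with y' h1 h2
    exact (hφ.contact h2 h1).1
  exact ⟨functional_tangent_eq_zero_of_generic φ covT _ (fun y hy hg => (key y hy hg).1) p hp,
    functional_tangent_eq_zero_of_generic φ covT _ (fun y hy hg => (key y hy hg).2.1) p hp,
    functional_tangent_eq_zero_of_generic φ covT _ (fun y hy hg => (key y hy hg).2.2) p hp⟩

end

section

/-! ### Admissible transformations of potential systems are projectable -/

variable {A B : LocalEq (ℝ × ℝ)}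

/-- The vector field `∂_x + λ u ∂_v`. -/
noncomputable def vecXi (θ : ArbElem) (p : ℝ × ℝ × ℝ × ℝ) : ℝ × ℝ × ℝ × ℝ :=
  (0, 1, 0, θ.lam p.1 * p.2.2.1)

theorem functional_vecX (θ : ArbElem) (p : ℝ × ℝ × ℝ × ℝ) (ℓ : (ℝ × ℝ × ℝ × ℝ) →L[ℝ] ℝ) (b : ℝ) :
    ℓ (vecX θ p b) = ℓ (vecXi θ p) + b * ℓ (0, 0, 1, 0) := by
  rw [vecX, vecXi, functional_apply ℓ 0 1 b, functional_apply ℓ 0 1 0 (_ * _)]; ring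

theorem functional_vecT (θ : ArbElem) (p : ℝ × ℝ × ℝ × ℝ) (ℓ : (ℝ × ℝ × ℝ × ℝ) →L[ℝ] ℝ)
    (a b : ℝ) :
    ℓ (vecT θ p a b) = ℓ (1, 0, 0, 0) + a * ℓ (0, 0, 1, 0) + vtVal θ p b * ℓ (0, 0, 0, 1) := by
  rw [vecT, functional_apply ℓ 1 0 a]; ring

theorem tangent_fst_of (φ : A ⟶ B) {p : ℝ × ℝ × ℝ × ℝ}
    (h : (tangent φ p (0, 1, 0, 0)).1 = 0 ∧ (tangent φ p (0, 0, 1, 0)).1 = 0 ∧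
      (tangent φ p (0, 0, 0, 1)).1 = 0) (w : ℝ × ℝ × ℝ × ℝ) :
    (tangent φ p w).1 = w.1 * (tangent φ p (1, 0, 0, 0)).1 := by
  have := functional_apply (covT.comp (tangent φ p)) w.1 w.2.1 w.2.2.1 w.2.2.2
  simp only [ContinuousLinearMap.comp_apply, covT_apply, h.1, h.2.1, h.2.2] at this
  simpa using this

theorem tangent_fst_ne_zero (φ : A ⟶ B) {p : ℝ × ℝ × ℝ × ℝ} (hp : p ∈ A.carrier)
    (h : (tangent φ p (0, 1, 0, 0)).1 = 0 ∧ (tangent φ p (0, 0, 1, 0)).1 = 0 ∧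
      (tangent φ p (0, 0, 0, 1)).1 = 0) : (tangent φ p (1, 0, 0, 0)).1 ≠ 0 := by
  intro h0
  obtain ⟨e, he⟩ : ∃ e, tangent φ p e = (1, 0, 0, 0) := ⟨_, tangent_tangent_inv φ hp _⟩
  have := tangent_fst_of φ h e
  rw [he, h0] at this
  simp at this

/-- The contact form of the target does not vanish on `∂_v`. -/
theorem contactForm_ne_zero (φ : A ⟶ B) {p : ℝ × ℝ × ℝ × ℝ} (hp : p ∈ A.carrier)
    (h : (tangent φ p (0, 1, 0, 0)).1 = 0 ∧ (tangent φ p (0, 0, 1, 0)).1 = 0 ∧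
      (tangent φ p (0, 0, 0, 1)).1 = 0)
    (hu : contactForm φ p (0, 0, 1, 0) = 0) (hx : contactForm φ p (vecXi A.elem p) = 0) :
    contactForm φ p (0, 0, 0, 1) ≠ 0 := by
  intro hv
  obtain ⟨e, he⟩ : ∃ e, tangent φ p e = (0, 0, 0, 1) := ⟨_, tangent_tangent_inv φ hp _⟩
  have h1 := tangent_fst_of φ h e
  rw [he] at h1
  have h2 : e.1 = 0 := (mul_eq_zero.1 h1.symm).resolve_right (tangent_fst_ne_zero φ hp h)
  have h3 : contactForm φ p e = 1 := by simp [contactForm_apply, he]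
  rw [vecXi, functional_apply, hu, hv] at hx
  have h4 := functional_apply (contactForm φ p) e.1 e.2.1 e.2.2.1 e.2.2.2
  have h5 : contactForm φ p (0, 1, 0, 0) = 0 := by linear_combination hx
  rw [hu, hv, h2, h5] at h4
  have h6 : contactForm φ p e = 0 := by
    rw [← h4.trans (by ring : _ = (0 : ℝ)), ← h2]
  rw [h3] at h6
  norm_num at h6

/-- The second equation of the potential system in the transformed variables. -/
theorem IsAdmissible.system_second {φ : A ⟶ B} (hφ : IsAdmissible potentialSystem φ)
    {p : ℝ × ℝ × ℝ × ℝ} (hp : p ∈ A.carrier) (hg : Generic φ p)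
    {q : ℝ × ℝ × ℝ × ℝ} (hq : q = PointTransf.map φ p) (a b : ℝ) :
    contactForm φ p (vecT A.elem p a b) * (tangent φ p (vecX A.elem p b)).2.1 =
      (tangent φ p (1, 0, 0, 0)).1 * (vtVal B.elem q 0 * (tangent φ p (vecX A.elem p b)).2.1 -
        B.elem.f (q.1, q.2.1) * B.elem.lam q.1 * (tangent φ p (vecX A.elem p b)).2.2.1) := by
  have hU : ∀ w, (tangent φ p w).2.2.1 = ((ContinuousLinearMap.fst ℝ ℝ ℝ).comp
    ((ContinuousLinearMap.snd ℝ ℝ (ℝ × ℝ)).comp ((ContinuousLinearMap.snd ℝ ℝ _).comp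
      (tangent φ p)))) w := fun w => rfl
  have hX : ∀ w, (tangent φ p w).2.1 = (covX.comp (tangent φ p)) w := fun w => rfl
  refine sub_eq_zero.1 (hg.eq_zero (g := fun y : ℝ × ℝ =>
    contactForm φ p (vecT A.elem p y.1 y.2) * (tangent φ p (vecX A.elem p y.2)).2.1 -
      (tangent φ p (1, 0, 0, 0)).1 * (vtVal B.elem q 0 * (tangent φ p (vecX A.elem p y.2)).2.1 -
        B.elem.f (q.1, q.2.1) * B.elem.lam q.1 * (tangent φ p (vecX A.elem p y.2)).2.2.1))
      (fun y => ?_) (fun a b hJ => ?_) a b)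
  · simp only [hU, hX]
    exact ((analyticAt_functional_vecT _ _ _ _).mul (analyticAt_functional_vecX _ _ _ _)).sub
      (analyticAt_const.mul ((analyticAt_const.mul (analyticAt_functional_vecX _ _ _ _)).sub
        (analyticAt_const.mul (analyticAt_functional_vecX _ _ _ _))))
  · obtain ⟨a', b', -, h2, h3, -⟩ := hφ.image_jet hp hJ hq
    have hT := tangent_fst_of φ (hφ.system_tangent_fst hp)
    rw [hT (vecX A.elem p b)] at h2
    rw [hT (vecT A.elem p a b), vtVal_eq] at h3
    simp only [vecT, vecX, zero_mul, zero_add, one_mul] at h2 h3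
    simp only [contactForm_apply, ← hq, vecT, vecX]
    rw [h2, h3]
    ring

/-- `X_u = V_u = 0` at generic points: the coefficient of `u_x ^ 2` in the second equation of the
transformed system is a nonvanishing multiple of `X_u`, and the contact form vanishes on `∂_u`. -/
theorem IsAdmissible.system_tangent_u_of_generic {φ : A ⟶ B}
    (hφ : IsAdmissible potentialSystem φ) {p : ℝ × ℝ × ℝ × ℝ} (hp : p ∈ A.carrier)
    (hg : Generic φ p) :
    (tangent φ p (0, 0, 1, 0)).2.1 = 0 ∧ (tangent φ p (0, 0, 1, 0)).2.2.2 = 0 := by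
  have hc := (hφ.contact hp hg).2
  have hCv := contactForm_ne_zero φ hp (hφ.system_tangent_fst hp) hc.1 hc.2
  have hk := A.elem.ne_zero _ (A.over_dom p hp)
  have key : ∀ b : ℝ, (contactForm φ p (1, 0, 0, 0) + (vtVal A.elem p 0 - A.elem.f (p.1, p.2.1) *
      A.elem.lam p.1 * b) * contactForm φ p (0, 0, 0, 1)) *
        (covX (tangent φ p (vecXi A.elem p)) + b * covX (tangent φ p (0, 0, 1, 0))) =
      (tangent φ p (1, 0, 0, 0)).1 * (vtVal B.elem (PointTransf.map φ p) 0 *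
        (covX (tangent φ p (vecXi A.elem p)) + b * covX (tangent φ p (0, 0, 1, 0))) -
        B.elem.f ((PointTransf.map φ p).1, (PointTransf.map φ p).2.1) *
          B.elem.lam (PointTransf.map φ p).1 * ((tangent φ p (vecXi A.elem p)).2.2.1 +
            b * (tangent φ p (0, 0, 1, 0)).2.2.1)) := fun b => by
    have h := hφ.system_second hp hg rfl 0 b
    rw [functional_vecT, vtVal_eq, hc.1, mul_zero, add_zero,
      show (tangent φ p (vecX A.elem p b)).2.1 = (covX.comp (tangent φ p)) (vecX A.elem p b)
        from rfl,
      show (tangent φ p (vecX A.elem p b)).2.2.1 = ((ContinuousLinearMap.fst ℝ ℝ ℝ).comp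
        ((ContinuousLinearMap.snd ℝ ℝ (ℝ × ℝ)).comp ((ContinuousLinearMap.snd ℝ ℝ _).comp
        (tangent φ p)))) (vecX A.elem p b) from rfl, functional_vecX, functional_vecX] at h
    exact h
  have k0 := key 0
  have k1 := key 1
  have k2 := key (-1)
  have hX : (tangent φ p (0, 0, 1, 0)).2.1 = 0 := by
    have h1 : A.elem.f (p.1, p.2.1) * A.elem.lam p.1 * contactForm φ p (0, 0, 0, 1) *
        covX (tangent φ p (0, 0, 1, 0)) = 0 := by
      linear_combination -(k1 + k2 - 2 * k0) / 2
    exact (mul_eq_zero.1 h1).resolve_left (mul_ne_zero hk hCv)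
  refine ⟨hX, ?_⟩
  have h2 := hc.1
  rw [contactForm_apply, hX, mul_zero, sub_zero] at h2
  exact h2

/-- The `x`- and `v`-components of an admissible transformation do not depend on `u`. -/
theorem IsAdmissible.system_tangent_u {φ : A ⟶ B} (hφ : IsAdmissible potentialSystem φ)
    {p : ℝ × ℝ × ℝ × ℝ} (hp : p ∈ A.carrier) :
    (tangent φ p (0, 0, 1, 0)).2.1 = 0 ∧ (tangent φ p (0, 0, 1, 0)).2.2.2 = 0 :=
  ⟨functional_tangent_eq_zero_of_generic φ covX _
      (fun _ hy hg => (hφ.system_tangent_u_of_generic hy hg).1) p hp,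
    functional_tangent_eq_zero_of_generic φ covV _
      (fun _ hy hg => (hφ.system_tangent_u_of_generic hy hg).2) p hp⟩

theorem hasDerivAt_vecXi_uLine (θ : ArbElem) (p : ℝ × ℝ × ℝ × ℝ) :
    HasDerivAt (fun τ => vecXi θ (uLine p τ)) (θ.lam p.1 • (0, 0, 0, 1)) 0 := by
  have h1 := ((hasDerivAt_id (0 : ℝ)).const_add p.2.2.1).const_mul (θ.lam p.1)
  have h2 : θ.lam p.1 • ((0 : ℝ), (0 : ℝ), (0 : ℝ), (1 : ℝ)) = (0, 0, 0, θ.lam p.1 * 1) := by simp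
  rw [h2]
  exact (hasDerivAt_const _ _).prodMk ((hasDerivAt_const _ _).prodMk
    ((hasDerivAt_const _ _).prodMk h1))

theorem IsAdmissible.hasDerivAt_lam_uLine {φ : A ⟶ B} (hφ : IsAdmissible potentialSystem φ)
    {p : ℝ × ℝ × ℝ × ℝ} (hp : p ∈ A.carrier) :
    HasDerivAt (fun τ => B.elem.lam (PointTransf.map φ (uLine p τ)).1) 0 0 := by
  have h1 : HasDerivAt (fun τ => (PointTransf.map φ (uLine p τ)).1)
      (tangent φ p (0, 0, 1, 0)).1 0 := (hasDerivAt_map_uLine φ hp).fst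
  rw [(hφ.system_tangent_fst hp).2.1] at h1
  have h2 := ((B.elem.smooth_lam _ (B.over_dom _ (map_mem φ hp))).differentiableAt
    (by simp)).hasDerivAt
  have h0 : (PointTransf.map φ p).1 = (PointTransf.map φ (uLine p 0)).1 := by rw [uLine_zero]
  rw [h0] at h2
  have h3 := h2.comp 0 h1
  rw [mul_zero] at h3
  exact h3

theorem IsAdmissible.hasDerivAt_f_uLine {φ : A ⟶ B} (hφ : IsAdmissible potentialSystem φ)
    {p : ℝ × ℝ × ℝ × ℝ} (hp : p ∈ A.carrier) :
    HasDerivAt (fun τ => B.elem.f ((PointTransf.map φ (uLine p τ)).1,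
      (PointTransf.map φ (uLine p τ)).2.1)) 0 0 := by
  have h1 : HasDerivAt (fun τ => ((PointTransf.map φ (uLine p τ)).1,
      (PointTransf.map φ (uLine p τ)).2.1))
      ((tangent φ p (0, 0, 1, 0)).1, (tangent φ p (0, 0, 1, 0)).2.1) 0 :=
    HasDerivAt.prodMk (hasDerivAt_map_uLine φ hp).fst (hasDerivAt_map_uLine φ hp).snd.fst
  rw [(hφ.system_tangent_fst hp).2.1, (hφ.system_tangent_u hp).1] at h1
  have hz := B.over_dom _ (map_mem φ hp)
  have h2 := ((B.elem.smooth_f.contDiffAt (B.elem.isOpen_dom.mem_nhds hz)).differentiableAt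
    (by simp)).hasFDerivAt
  rw [← uLine_zero p] at h2
  have h3 := HasFDerivAt.comp_hasDerivAt (f := fun τ => ((PointTransf.map φ (uLine p τ)).1,
      (PointTransf.map φ (uLine p τ)).2.1)) 0 h2 h1
  rw [show ((0 : ℝ), (0 : ℝ)) = 0 from rfl, map_zero] at h3
  exact h3

/-- The relation `f (X_x + λ u X_v) ^ 2 = T_t f'`: the coefficients of `u_x` in the second equation
of the transformed system relate it to `U_u`, and `U_u` is found from the derivative with respect
to `u` of the first equation. -/
theorem IsAdmissible.system_ratio {φ : A ⟶ B} (hφ : IsAdmissible potentialSystem φ)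
    {p : ℝ × ℝ × ℝ × ℝ} (hp : p ∈ A.carrier) (hg : Generic φ p) :
    (tangent φ p (vecXi A.elem p)).2.1 ≠ 0 ∧
    A.elem.f (p.1, p.2.1) * (tangent φ p (vecXi A.elem p)).2.1 ^ 2 =
      (tangent φ p (1, 0, 0, 0)).1 *
        B.elem.f ((PointTransf.map φ p).1, (PointTransf.map φ p).2.1) := by
  have hl : A.elem.lam p.1 ≠ 0 := right_ne_zero_of_mul (A.elem.ne_zero _ (A.over_dom p hp))
  have hc := (hφ.contact hp hg).2
  have hT := hφ.system_tangent_fst hp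
  obtain ⟨hXu, hVu⟩ := hφ.system_tangent_u hp
  have hCv := contactForm_ne_zero φ hp hT hc.1 hc.2
  have hX : ∀ b, (tangent φ p (vecX A.elem p b)).2.1 = (tangent φ p (vecXi A.elem p)).2.1 := by
    intro b
    have := functional_vecX A.elem p (covX.comp (tangent φ p)) b
    simpa [hXu] using this
  have hn : (tangent φ p (vecXi A.elem p)).2.1 ≠ 0 := by
    intro h0
    obtain ⟨a, b, hab⟩ := hg
    rw [sysJacobian_eq, hX, h0, tangent_fst_of φ hT (vecX _ _ _)] at hab
    simp [vecX] at hab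
  refine ⟨hn, ?_⟩
  have k0 := hφ.system_second hp hg rfl 0 0
  have k1 := hφ.system_second hp hg rfl 0 1
  have hU : ∀ b, (tangent φ p (vecX A.elem p b)).2.2.1 = (tangent φ p (vecXi A.elem p)).2.2.1 +
      b * (tangent φ p (0, 0, 1, 0)).2.2.1 := functional_vecX A.elem p
        ((ContinuousLinearMap.fst ℝ ℝ ℝ).comp ((ContinuousLinearMap.snd ℝ ℝ (ℝ × ℝ)).comp
          ((ContinuousLinearMap.snd ℝ ℝ _).comp (tangent φ p))))
  rw [functional_vecT, hX, hU] at k0 k1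
  rw [vtVal_eq A.elem p 1] at k1
  -- the derivative of the relation `V_x + λ u V_v = λ' U (X_x + λ u X_v)` with respect to `u`
  have d1 := hasDerivAt_functional_tangent_uLine φ hp covV
    (by filter_upwards [A.isOpen_carrier.mem_nhds hp] with y hy using (hφ.system_tangent_u hy).2)
    (hasDerivAt_vecXi_uLine A.elem p)
  have d2 := hasDerivAt_functional_tangent_uLine φ hp covX
    (by filter_upwards [A.isOpen_carrier.mem_nhds hp] with y hy using (hφ.system_tangent_u hy).1)
    (hasDerivAt_vecXi_uLine A.elem p)
  have d3 : HasDerivAt (fun τ => (PointTransf.map φ (uLine p τ)).2.2.1)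
      (tangent φ p (0, 0, 1, 0)).2.2.1 0 := (hasDerivAt_map_uLine φ hp).snd.snd.fst
  have d4 := ((hφ.hasDerivAt_lam_uLine hp).mul d3).mul d2
  have d5 := d1.unique (d4.congr_of_eventuallyEq (by
    filter_upwards [(tendsto_uLine p).eventually (hg.eventually hp),
      (tendsto_uLine p).eventually (A.isOpen_carrier.mem_nhds hp)] with τ h1 h2
    have h3 := (hφ.contact h2 h1).2.2
    rw [contactForm_apply, sub_eq_zero] at h3
    exact h3))
  simp only [uLine_zero, map_smul, covV_apply, covX_apply, smul_eq_mul, Pi.mul_apply,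
    zero_mul, zero_add] at d5
  have hCv' := contactForm_apply φ p (0, 0, 0, 1)
  set Cv := contactForm φ p (0, 0, 0, 1)
  set n := (tangent φ p (vecXi A.elem p)).2.1
  refine mul_left_cancel₀ (mul_ne_zero hl hCv) ?_
  set lam' := B.elem.lam (PointTransf.map φ p).1
  set T := (tangent φ p (1, 0, 0, 0)).1
  set Uu := (tangent φ p (0, 0, 1, 0)).2.2.1
  have d6 : A.elem.lam p.1 * Cv = lam' * Uu * n := by
    rw [hCv']; linear_combination d5
  linear_combination -n * (k1 - k0) -
    T * B.elem.f ((PointTransf.map φ p).1, (PointTransf.map φ p).2.1) * d6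

/-- `X_v = 0`: the right-hand side of `f (X_x + λ u X_v) ^ 2 = T_t f'` does not depend on `u`. -/
theorem IsAdmissible.system_tangent_v {φ : A ⟶ B} (hφ : IsAdmissible potentialSystem φ)
    {p : ℝ × ℝ × ℝ × ℝ} (hp : p ∈ A.carrier) : (tangent φ p (0, 0, 0, 1)).2.1 = 0 := by
  refine functional_tangent_eq_zero_of_generic φ covX _ (fun p hp hg => ?_) p hp
  have hl := A.elem.ne_zero _ (A.over_dom p hp)
  have hn := (hφ.system_ratio hp hg).1
  have d2 := hasDerivAt_functional_tangent_uLine φ hp covX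
    (by filter_upwards [A.isOpen_carrier.mem_nhds hp] with y hy using (hφ.system_tangent_u hy).1)
    (hasDerivAt_vecXi_uLine A.elem p)
  have d1 := hasDerivAt_functional_tangent_uLine φ hp covT
    (by filter_upwards [A.isOpen_carrier.mem_nhds hp] with y hy using
      (hφ.system_tangent_fst hy).2.1)
    (hasDerivAt_const (0 : ℝ) ((1, 0, 0, 0) : ℝ × ℝ × ℝ × ℝ))
  have d3 := d1.mul (hφ.hasDerivAt_f_uLine hp)
  have d4 := (d2.pow 2).const_mul (A.elem.f (p.1, p.2.1))
  have d5 := d4.unique (d3.congr_of_eventuallyEq (by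
    filter_upwards [(tendsto_uLine p).eventually (hg.eventually hp),
      (tendsto_uLine p).eventually (A.isOpen_carrier.mem_nhds hp)] with τ h1 h2
    exact (hφ.system_ratio h2 h1).2))
  simp only [uLine_zero, map_smul, covX_apply, covT_apply, smul_eq_mul, map_zero, mul_zero,
    zero_mul, add_zero] at d5
  have h6 : (A.elem.f (p.1, p.2.1) * A.elem.lam p.1) *
      (2 * (tangent φ p (vecXi A.elem p)).2.1) * (tangent φ p (0, 0, 0, 1)).2.1 = 0 := by
    simp only [Nat.cast_ofNat, show 2 - 1 = 1 from rfl, pow_one] at d5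
    linear_combination d5
  exact (mul_eq_zero.1 h6).resolve_left (mul_ne_zero hl (mul_ne_zero two_ne_zero hn))

/-- The form of the admissible transformations of potential systems: `T = T(t)`, `X = X(t,x)`,
`V = V(t,x,v)` in the infinitesimal sense, and `V_x + λ u V_v = λ' U X_x`. -/
structure IsProjectable (φ : A ⟶ B) : Prop where
  fst : ∀ p ∈ A.carrier, (tangent φ p (0, 1, 0, 0)).1 = 0 ∧ (tangent φ p (0, 0, 1, 0)).1 = 0 ∧
      (tangent φ p (0, 0, 0, 1)).1 = 0
  snd_u : ∀ p ∈ A.carrier, (tangent φ p (0, 0, 1, 0)).2.1 = 0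
  snd_v : ∀ p ∈ A.carrier, (tangent φ p (0, 0, 0, 1)).2.1 = 0
  last_u : ∀ p ∈ A.carrier, (tangent φ p (0, 0, 1, 0)).2.2.2 = 0
  contact : ∀ p ∈ A.carrier, contactForm φ p (vecXi A.elem p) = 0

theorem tangent_snd_ne_zero (φ : A ⟶ B) {p : ℝ × ℝ × ℝ × ℝ} (hp : p ∈ A.carrier)
    (h : (tangent φ p (0, 1, 0, 0)).1 = 0 ∧ (tangent φ p (0, 0, 1, 0)).1 = 0 ∧
      (tangent φ p (0, 0, 0, 1)).1 = 0) (hu : (tangent φ p (0, 0, 1, 0)).2.1 = 0)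
    (hv : (tangent φ p (0, 0, 0, 1)).2.1 = 0) : (tangent φ p (0, 1, 0, 0)).2.1 ≠ 0 := by
  intro h0
  obtain ⟨e, he⟩ : ∃ e, tangent φ p e = (0, 1, 0, 0) := ⟨_, tangent_tangent_inv φ hp _⟩
  have h1 := tangent_fst_of φ h e
  rw [he] at h1
  have h2 : e.1 = 0 := (mul_eq_zero.1 h1.symm).resolve_right (tangent_fst_ne_zero φ hp h)
  have h3 : (tangent φ p e).2.1 = e.1 * (tangent φ p (1, 0, 0, 0)).2.1 +
      e.2.1 * (tangent φ p (0, 1, 0, 0)).2.1 + e.2.2.1 * (tangent φ p (0, 0, 1, 0)).2.1 +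
      e.2.2.2 * (tangent φ p (0, 0, 0, 1)).2.1 :=
    functional_apply (covX.comp (tangent φ p)) e.1 e.2.1 e.2.2.1 e.2.2.2
  simp [he, h2, h0, hu, hv] at h3

theorem jacobian_of (φ : A ⟶ B) {p : ℝ × ℝ × ℝ × ℝ}
    (h : (tangent φ p (0, 1, 0, 0)).1 = 0 ∧ (tangent φ p (0, 0, 1, 0)).1 = 0 ∧
      (tangent φ p (0, 0, 0, 1)).1 = 0) (hu : (tangent φ p (0, 0, 1, 0)).2.1 = 0)
    (hv : (tangent φ p (0, 0, 0, 1)).2.1 = 0) (a b : ℝ × ℝ) :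
    jacobian φ p a b = (tangent φ p (1, 0, 0, 0)).1 * (tangent φ p (0, 1, 0, 0)).2.1 := by
  unfold jacobian
  rw [tangent_fst_of φ h, tangent_fst_of φ h (0, 1, b)]
  have h3 := functional_apply (covX.comp (tangent φ p)) 0 1 b.1 b.2
  simp [hu, hv] at h3
  simp [h3]

theorem IsAdmissible.isProjectable {φ : A ⟶ B} (hφ : IsAdmissible potentialSystem φ) :
    IsProjectable φ where
  fst _ hp := hφ.system_tangent_fst hp
  snd_u _ hp := (hφ.system_tangent_u hp).1
  snd_v _ hp := hφ.system_tangent_v hp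
  last_u _ hp := (hφ.system_tangent_u hp).2
  contact p hp := by
    refine (hφ.contact hp ⟨0, 0, ?_⟩).2.2
    rw [sysJacobian, jacobian_of φ (hφ.system_tangent_fst hp) (hφ.system_tangent_u hp).1
      (hφ.system_tangent_v hp)]
    exact mul_ne_zero (tangent_fst_ne_zero φ hp (hφ.system_tangent_fst hp))
      (tangent_snd_ne_zero φ hp (hφ.system_tangent_fst hp) (hφ.system_tangent_u hp).1
      (hφ.system_tangent_v hp))

theorem IsProjectable.jacobian_ne_zero {φ : A ⟶ B} (h : IsProjectable φ)
    {p : ℝ × ℝ × ℝ × ℝ} (hp : p ∈ A.carrier) (a b : ℝ × ℝ) : jacobian φ p a b ≠ 0 := by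
  rw [jacobian_of φ (h.fst p hp) (h.snd_u p hp) (h.snd_v p hp)]
  exact mul_ne_zero (tangent_fst_ne_zero φ hp (h.fst p hp))
    (tangent_snd_ne_zero φ hp (h.fst p hp) (h.snd_u p hp) (h.snd_v p hp))

theorem IsProjectable.preservesGraphs {φ : A ⟶ B} (h : IsProjectable φ) : PreservesGraphs φ :=
  fun _ _ hz hs => exists_transforms_of_jacobian_ne_zero φ hz hs (h.jacobian_ne_zero hz _ _)

/-- The left-hand side of the second equation of the target system, up to a nonvanishing factor,
on the images of the jets at `p` that satisfy the source system and have `u_x = b`. -/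
noncomputable def sysDefect (φ : A ⟶ B) (p : ℝ × ℝ × ℝ × ℝ) (b : ℝ) : ℝ :=
  (contactForm φ p (1, 0, 0, 0) + vtVal A.elem p b * (tangent φ p (0, 0, 0, 1)).2.2.2) *
      (tangent φ p (0, 1, 0, 0)).2.1 -
    (tangent φ p (1, 0, 0, 0)).1 *
      (vtVal B.elem (PointTransf.map φ p) 0 * (tangent φ p (0, 1, 0, 0)).2.1 -
        B.elem.f ((PointTransf.map φ p).1, (PointTransf.map φ p).2.1) *
          B.elem.lam (PointTransf.map φ p).1 * (tangent φ p (vecX A.elem p b)).2.2.1)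

theorem IsAdmissible.sysDefect_eq_zero {φ : A ⟶ B} (hφ : IsAdmissible potentialSystem φ)
    {p : ℝ × ℝ × ℝ × ℝ} (hp : p ∈ A.carrier) (b : ℝ) : sysDefect φ p b = 0 := by
  have h := hφ.isProjectable
  have h1 := hφ.system_second hp ⟨0, 0, h.jacobian_ne_zero hp _ _⟩ rfl 0 b
  have hX := functional_apply (covX.comp (tangent φ p)) 0 1 b (A.elem.lam p.1 * p.2.2.1)
  simp only [ContinuousLinearMap.comp_apply, covX_apply, h.snd_u p hp, h.snd_v p hp] at hX
  have hX' : (tangent φ p (vecX A.elem p b)).2.1 = (tangent φ p (0, 1, 0, 0)).2.1 := by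
    rw [vecX, hX]; ring
  rw [functional_vecT, hX'] at h1
  have hCv : contactForm φ p (0, 0, 0, 1) = (tangent φ p (0, 0, 0, 1)).2.2.2 := by
    rw [contactForm_apply, h.snd_v p hp, mul_zero, sub_zero]
  rw [hCv] at h1
  unfold sysDefect
  linear_combination h1

/-- The converse of `IsAdmissible.isProjectable` and `IsAdmissible.sysDefect_eq_zero`. -/
theorem IsProjectable.isAdmissible {φ : A ⟶ B} (h : IsProjectable φ)
    (hd : ∀ p ∈ A.carrier, ∀ b, sysDefect φ p b = 0) : IsAdmissible potentialSystem φ := by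
  intro s s' z z' hs hs' ht
  have hsd := hs.differentiableAt (by simp)
  have hsd' := hs'.differentiableAt (by simp)
  rw [potentialSystem_iff _ hsd, potentialSystem_iff _ hsd']
  have hp := ht.mem
  have hm := ht.map_eq
  have c1 := ht.chain_rule hsd hsd' (1, 0)
  have c2 := ht.chain_rule hsd hsd' (0, 1)
  set p := graphPt s z with hpdef
  have hT := tangent_fst_ne_zero φ hp (h.fst p hp)
  have hX := tangent_snd_ne_zero φ hp (h.fst p hp) (h.snd_u p hp) (h.snd_v p hp)
  have hCu : contactForm φ p (0, 0, 1, 0) = 0 := by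
    rw [contactForm_apply, h.snd_u p hp, h.last_u p hp, mul_zero, sub_zero]
  have hCv : contactForm φ p (0, 0, 0, 1) = (tangent φ p (0, 0, 0, 1)).2.2.2 := by
    rw [contactForm_apply, h.snd_v p hp, mul_zero, sub_zero]
  have hV := contactForm_ne_zero φ hp (h.fst p hp) hCu (h.contact p hp)
  rw [hCv] at hV
  have hXe : ∀ w : ℝ × ℝ × ℝ × ℝ, (tangent φ p w).2.1 = w.1 * (tangent φ p (1, 0, 0, 0)).2.1 +
      w.2.1 * (tangent φ p (0, 1, 0, 0)).2.1 + w.2.2.1 * (tangent φ p (0, 0, 1, 0)).2.1 +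
      w.2.2.2 * (tangent φ p (0, 0, 0, 1)).2.1 := fun w =>
    functional_apply (covX.comp (tangent φ p)) w.1 w.2.1 w.2.2.1 w.2.2.2
  have hVe : ∀ w : ℝ × ℝ × ℝ × ℝ, (tangent φ p w).2.2.2 =
      w.1 * (tangent φ p (1, 0, 0, 0)).2.2.2 +
      w.2.1 * (tangent φ p (0, 1, 0, 0)).2.2.2 + w.2.2.1 * (tangent φ p (0, 0, 1, 0)).2.2.2 +
      w.2.2.2 * (tangent φ p (0, 0, 0, 1)).2.2.2 := fun w =>
    functional_apply (covV.comp (tangent φ p)) w.1 w.2.1 w.2.2.1 w.2.2.2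
  generalize fderiv ℝ s z (1, 0) = St at *
  generalize fderiv ℝ s z (0, 1) = Sx at *
  generalize fderiv ℝ s' z' (1, 0) = St' at *
  generalize fderiv ℝ s' z' (0, 1) = Sx' at *
  have c1v := congrArg Prod.snd c1
  have c2u := congrArg Prod.fst c2
  have c2v := congrArg Prod.snd c2
  have hdef := hd p hp Sx.1
  have hcon := h.contact p hp
  simp only [Prod.snd_add, Prod.fst_add, Prod.smul_fst, Prod.smul_snd, smul_eq_mul] at c1v c2u c2v
  rw [tangent_fst_of φ (h.fst p hp), hXe, hVe, h.snd_u p hp, h.snd_v p hp, h.last_u p hp] at c1v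
  rw [tangent_fst_of φ (h.fst p hp), hXe, h.snd_u p hp, h.snd_v p hp] at c2u
  rw [tangent_fst_of φ (h.fst p hp), hXe, hVe, h.snd_u p hp, h.snd_v p hp, h.last_u p hp] at c2v
  rw [contactForm_apply, hXe, hVe, h.snd_u p hp, h.snd_v p hp, h.last_u p hp] at hcon
  simp only [vecXi, zero_mul, one_mul, mul_zero, add_zero, zero_add] at c1v c2u c2v hcon
  unfold sysDefect at hdef
  rw [contactForm_apply] at hdef
  have hpu : p.2.2.1 = (s z).1 := rfl
  have hp1 : p.1 = z.1 := rfl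
  have hp2 : p.2.1 = z.2 := rfl
  simp only [vtVal, vecX, hm, hpu, hp1, hp2, graphPt, Prod.mk.eta] at hdef hcon
  have key : Sx.2 = A.elem.lam z.1 * (s z).1 → Sx'.2 = B.elem.lam z'.1 * (s' z').1 →
      (tangent φ p (1, 0, 0, 0)).1 * (St'.2 - -B.elem.lam z'.1 * (1 / 2 * (s' z').1 ^ 2 +
        B.elem.f z' * Sx'.1 - dx B.elem.f z' * (s' z').1)) =
      (tangent φ p (0, 0, 0, 1)).2.2.2 * (St.2 - -A.elem.lam z.1 * (1 / 2 * (s z).1 ^ 2 +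
        A.elem.f z * Sx.1 - dx A.elem.f z * (s z).1)) := by
    intro e1 e2
    rw [← e1, Prod.mk.eta, c2u] at hdef
    rw [e2] at c1v
    refine mul_left_cancel₀ hX ?_
    linear_combination hdef - (tangent φ p (0, 1, 0, 0)).2.1 * c1v
  constructor
  · rintro ⟨e1, e2⟩
    have e3 : Sx'.2 = B.elem.lam z'.1 * (s' z').1 := by
      refine mul_left_cancel₀ hX ?_
      linear_combination hcon - c2v + (tangent φ p (0, 0, 0, 1)).2.2.2 * e1
    have h4 := key e1 e3
    rw [e2, sub_self, mul_zero] at h4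
    exact ⟨e3, sub_eq_zero.1 ((mul_eq_zero.1 h4).resolve_left hT)⟩
  · rintro ⟨e1, e2⟩
    have e3 : Sx.2 = A.elem.lam z.1 * (s z).1 := by
      refine mul_left_cancel₀ hV ?_
      linear_combination c2v - hcon + (tangent φ p (0, 1, 0, 0)).2.1 * e1
    have h4 := key e3 e1
    rw [e2, sub_self, mul_zero] at h4
    exact ⟨e3, sub_eq_zero.1 ((mul_eq_zero.1 h4.symm).resolve_left hV)⟩

end

section

/-! ### Prolongations -/

variable {A B C : LocalEq ℝ}

section MkTransf

variable {F : Type} [NormedAddCommGroup F] [NormedSpace ℝ F] {A B : LocalEq F}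

/-- The point transformation that is given by a smooth map with a smooth inverse. -/
noncomputable def mkTransf (f g : ℝ × ℝ × F → ℝ × ℝ × F) (hf : MapsTo f A.carrier B.carrier)
    (hg : MapsTo g B.carrier A.carrier) (hgf : ∀ p ∈ A.carrier, g (f p) = p)
    (hfg : ∀ p ∈ B.carrier, f (g p) = p) (hfs : ∀ p ∈ A.carrier, ContDiffAt ℝ ∞ f p)
    (hgs : ∀ p ∈ B.carrier, ContDiffAt ℝ ∞ g p) : A ⟶ B :=
  PointTransf.mk
    { toFun := fun p => ⟨f p, hf p.2⟩
      invFun := fun p => ⟨g p, hg p.2⟩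
      left_inv := fun p => Subtype.ext (hgf p p.2)
      right_inv := fun p => Subtype.ext (hfg p p.2) }
    (ContDiffOn.congr (fun _ hp => (hfs _ hp).contDiffWithinAt)
      fun _ hp => extendZero_of_mem _ hp)
    (ContDiffOn.congr (fun _ hp => (hgs _ hp).contDiffWithinAt)
      fun _ hp => extendZero_of_mem _ hp)

theorem map_mkTransf {f g : ℝ × ℝ × F → ℝ × ℝ × F} {hf : MapsTo f A.carrier B.carrier}
    {hg : MapsTo g B.carrier A.carrier} {hgf : ∀ p ∈ A.carrier, g (f p) = p}
    {hfg : ∀ p ∈ B.carrier, f (g p) = p} {hfs : ∀ p ∈ A.carrier, ContDiffAt ℝ ∞ f p}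
    {hgs : ∀ p ∈ B.carrier, ContDiffAt ℝ ∞ g p} {p : ℝ × ℝ × F} (hp : p ∈ A.carrier) :
    PointTransf.map (mkTransf f g hf hg hgf hfg hfs hgs) p = f p :=
  extendZero_of_mem _ hp

end MkTransf

/-- The pair `(u, v)` with `u = v_x / λ`. -/
noncomputable def liftSec (θ : ArbElem) (v : ℝ × ℝ → ℝ) (z : ℝ × ℝ) : ℝ × ℝ :=
  (dx v z / θ.lam z.1, v z)

/-- `ψ` projects to `φ`, and its `u`-component is the prolongation of `φ` according to
`u = v_x / λ`. In contrast to `IsProlongation`, functions that are only differentiable at the point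
under consideration are admitted; the smoothness of a function at a point, understood as
`ContDiffAt ℝ ∞`, does not imply its smoothness at nearby points. -/
def IsStrongProlongation (φ : A ⟶ B) (ψ : cylinder A ⟶ cylinder B) : Prop :=
  IsProjection ψ φ ∧
    ∀ (v v' : ℝ × ℝ → ℝ) (z z' : ℝ × ℝ), DifferentiableAt ℝ v z → DifferentiableAt ℝ v' z' →
      Transforms φ v z v' z' →
        (PointTransf.map ψ (z.1, z.2, dx v z / A.elem.lam z.1, v z)).2.2.1 =
          dx v' z' / B.elem.lam z'.1

theorem IsStrongProlongation.isProlongation {φ : A ⟶ B} {ψ : cylinder A ⟶ cylinder B}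
    (h : IsStrongProlongation φ ψ) : IsProlongation φ ψ :=
  ⟨h.1, fun v v' z z' hv hv' => h.2 v v' z z' (hv.differentiableAt (by simp))
    (hv'.differentiableAt (by simp))⟩

theorem IsStrongProlongation.map_graphPt {φ : A ⟶ B} {ψ : cylinder A ⟶ cylinder B}
    (h : IsStrongProlongation φ ψ) {v v' : ℝ × ℝ → ℝ} {z z' : ℝ × ℝ} (hv : DifferentiableAt ℝ v z)
    (hv' : DifferentiableAt ℝ v' z') (ht : Transforms φ v z v' z') :
    PointTransf.map ψ (graphPt (liftSec A.elem v) z) = graphPt (liftSec B.elem v') z' := by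
  have h1 := h.1 z.1 z.2 (dx v z / A.elem.lam z.1) (v z) ht.mem
  have h2 := h.2 v v' z z' hv hv' ht
  have h3 := ht.map_eq
  unfold graphPt at h3
  rw [h1] at h3
  have e1 := congrArg (fun p => p.1) h3
  have e2 := congrArg (fun p => p.2.1) h3
  have e3 := congrArg (fun p => p.2.2) h3
  exact Prod.ext e1 (Prod.ext e2 (Prod.ext h2 e3))

theorem lam_ne_zero {p : ℝ × ℝ × ℝ} (hp : p ∈ A.carrier) : A.elem.lam p.1 ≠ 0 :=
  right_ne_zero_of_mul (A.elem.ne_zero _ (A.over_dom p hp))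

/-- Every point of a cylinder lies on the lift of an affine function. -/
theorem exists_liftSec {q : ℝ × ℝ × ℝ × ℝ} (hq : q ∈ (cylinder A).carrier) :
    ∃ (v : ℝ × ℝ → ℝ) (z : ℝ × ℝ), ContDiffAt ℝ ∞ v z ∧ graphPt v z ∈ A.carrier ∧
      graphPt (liftSec A.elem v) z = q := by
  refine ⟨quadJet (q.1, q.2.1) q.2.2.2 0 (A.elem.lam q.1 * q.2.2.1) 0 0 0, (q.1, q.2.1),
    (contDiff_quadJet ..).contDiffAt, ?_, ?_⟩
  · rw [graphPt, quadJet_self]; exact hq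
  · have hl : A.elem.lam q.1 ≠ 0 := lam_ne_zero (A := A) hq
    simp only [graphPt, liftSec, quadJet_self, dx_quadJet, sub_self, mul_zero, add_zero]
    rw [mul_div_cancel_left₀ _ hl]

theorem IsStrongProlongation.inv {φ : A ⟶ B} {ψ : cylinder A ⟶ cylinder B}
    (h : IsStrongProlongation φ ψ) : IsStrongProlongation (Groupoid.inv φ) (Groupoid.inv ψ) := by
  constructor
  · intro t x u v hp
    have hq : (t, x, u, v) ∈ (cylinder B).carrier := hp
    have hm := map_mem (Groupoid.inv ψ) hq
    have h1 := map_map_inv ψ hq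
    set q := PointTransf.map (Groupoid.inv ψ) (t, x, u, v)
    have h2 := h.1 q.1 q.2.1 q.2.2.1 q.2.2.2 hm
    rw [show (q.1, q.2.1, q.2.2.1, q.2.2.2) = q from rfl, h1] at h2
    rw [← h2]
    exact map_inv_map φ hm
  · intro v' v z' z hv' hv ht
    have h1 := h.map_graphPt hv hv' ht.symm
    have h2 : graphPt (liftSec A.elem v) z ∈ (cylinder A).carrier := ht.symm.mem
    have h3 := map_inv_map ψ h2
    rw [h1] at h3
    exact congrArg (fun p => p.2.2.1) h3

theorem Transforms.eventually_transforms {F : Type} [NormedAddCommGroup F] [NormedSpace ℝ F]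
    {A B : LocalEq F} {φ : A ⟶ B} {s s' : ℝ × ℝ → F} {z z' : ℝ × ℝ}
    (h : Transforms φ s z s' z') (hs : ContinuousAt s z) :
    ∀ᶠ y in 𝓝 z, Transforms φ s y s' (baseMap φ s y) := by
  have hc : ContinuousAt (graphPt s) z := continuousAt_fst.prodMk (continuousAt_snd.prodMk hs)
  filter_upwards [eventually_graphPt_mem h.mem hs, h.eventually_eq hs,
    hc.eventually h.2.2.eventually_nhds] with y h1 h2 h3
  exact ⟨h1, h2, h3⟩

/-- The prolongation of `φ` maps the lift of `v` into the lift of the image of `v`. Nearby points are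
used here, where `v` is known to be differentiable only. -/
theorem IsStrongProlongation.eventually_mem_graph {φ : A ⟶ B} {ψ : cylinder A ⟶ cylinder B}
    (h : IsStrongProlongation φ ψ) {v v' : ℝ × ℝ → ℝ} {z z' : ℝ × ℝ} (hv : ContDiffAt ℝ ∞ v z)
    (hv' : ContDiffAt ℝ ∞ v' z') (ht : Transforms φ v z v' z') :
    ∀ᶠ p in 𝓝 (graphPt (liftSec A.elem v) z), p ∈ graph (liftSec A.elem v) →
      PointTransf.map ψ p ∈ graph (liftSec B.elem v') := by
  have hvd := hv.differentiableAt (by simp)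
  obtain ⟨L, hL, -⟩ := exists_hasFDerivAt_baseMap φ ht.mem hvd
  have hb := hL.continuousAt
  rw [ContinuousAt, ht.baseMap_eq] at hb
  have hproj : ContinuousAt (fun p : ℝ × ℝ × ℝ × ℝ => (p.1, p.2.1))
    (graphPt (liftSec A.elem v) z) := by fun_prop
  filter_upwards [hproj.eventually (ht.eventually_transforms hvd.continuousAt),
    hproj.eventually (eventually_differentiableAt hv),
    hproj.eventually (hb.eventually (eventually_differentiableAt hv'))] with p h1 h2 h3 hp
  have hp' : p = graphPt (liftSec A.elem v) (p.1, p.2.1) := Prod.ext rfl (Prod.ext rfl hp)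
  rw [hp', h.map_graphPt h2 h3 h1]
  rfl

theorem IsStrongProlongation.transforms {φ : A ⟶ B} {ψ : cylinder A ⟶ cylinder B}
    (h : IsStrongProlongation φ ψ) {v v' : ℝ × ℝ → ℝ} {z z' : ℝ × ℝ} (hv : ContDiffAt ℝ ∞ v z)
    (hv' : ContDiffAt ℝ ∞ v' z') (ht : Transforms φ v z v' z') :
    Transforms ψ (liftSec A.elem v) z (liftSec B.elem v') z' := by
  have hvd := hv.differentiableAt (by simp)
  have hvd' := hv'.differentiableAt (by simp)
  have hm : graphPt (liftSec A.elem v) z ∈ (cylinder A).carrier := ht.mem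
  have he := h.map_graphPt hvd hvd' ht
  refine ⟨hm, he, ?_⟩
  have hc : Tendsto (PointTransf.map ψ) (𝓝 (graphPt (liftSec A.elem v) z))
      (𝓝 (graphPt (liftSec B.elem v') z')) := by
    have := (contDiffAt_map ψ hm).continuousAt
    rwa [ContinuousAt, he] at this
  change ∀ᶠ p in 𝓝 (graphPt (liftSec A.elem v) z), _
  filter_upwards [h.eventually_mem_graph hv hv' ht,
    hc.eventually (h.inv.eventually_mem_graph hv' hv ht.symm),
    (cylinder A).isOpen_carrier.mem_nhds hm] with p h1 h2 h3
  refine ⟨h1, fun h4 => ?_⟩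
  have h5 := h2 h4
  rwa [map_inv_map ψ h3] at h5

/-- The potential equation for `v` is the potential system for the lift of `v`. -/
theorem potentialSystem_liftSec (θ : ArbElem) {v : ℝ × ℝ → ℝ} {z : ℝ × ℝ} (hz : z ∈ θ.dom) :
    potentialSystem θ (liftSec θ v) z ↔ potentialEquation θ v z := by
  have hl : θ.lam z.1 ≠ 0 := right_ne_zero_of_mul (θ.ne_zero z hz)
  have h1 : dx (fun y => dx v y / θ.lam y.1) z = dx (dx v) z / θ.lam z.1 := by
    simp only [dx, deriv_div_const]
  simp only [potentialSystem, potentialEquation, liftSec, h1]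
  constructor
  · rintro ⟨-, h⟩
    rw [show dt v z = dt (fun y => v y) z from rfl, h]
    field_simp
    ring
  · intro h
    refine ⟨by rw [mul_div_cancel₀ _ hl], ?_⟩
    have h2 : dt (fun y => v y) z = -(1 / (2 * θ.lam z.1) * dx v z ^ 2 + θ.f z * dx (dx v) z -
        dx θ.f z * dx v z) := by linear_combination h
    rw [h2]
    field_simp

theorem contDiffAt_liftSec (θ : ArbElem) {v : ℝ × ℝ → ℝ} {z : ℝ × ℝ} (hz : z ∈ θ.dom)
    (hv : ContDiffAt ℝ ∞ v z) : ContDiffAt ℝ ∞ (liftSec θ v) z := by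
  have hl : θ.lam z.1 ≠ 0 := right_ne_zero_of_mul (θ.ne_zero z hz)
  exact ((contDiffAt_dx hv).div ((θ.smooth_lam z hz).comp z contDiffAt_fst) hl).prodMk hv

theorem IsStrongProlongation.isAdmissible_potentialEquation {φ : A ⟶ B}
    {ψ : cylinder A ⟶ cylinder B} (h : IsStrongProlongation φ ψ)
    (hψ : IsAdmissible potentialSystem ψ) : IsAdmissible potentialEquation φ := by
  intro v v' z z' hv hv' ht
  have hz : z ∈ A.elem.dom := A.over_dom _ ht.mem
  have hz' : z' ∈ B.elem.dom := B.over_dom _ ht.symm.mem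
  rw [← potentialSystem_liftSec _ hz, ← potentialSystem_liftSec _ hz']
  exact hψ _ _ z z' (contDiffAt_liftSec _ hz hv) (contDiffAt_liftSec _ hz' hv')
    (h.transforms hv hv' ht)

/-- Every function satisfying the potential system at a point has there the same first-order jet as
the lift of some smooth function. -/
theorem exists_liftSec_jet {θ : ArbElem} {s : ℝ × ℝ → ℝ × ℝ} {z : ℝ × ℝ} (hz : z ∈ θ.dom)
    (hs : DifferentiableAt ℝ s z) (h : potentialSystem θ s z) :
    ∃ v : ℝ × ℝ → ℝ, ContDiffAt ℝ ∞ v z ∧ s z = liftSec θ v z ∧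
      fderiv ℝ s z = fderiv ℝ (liftSec θ v) z := by
  have hl : θ.lam z.1 ≠ 0 := right_ne_zero_of_mul (θ.ne_zero z hz)
  rw [potentialSystem_iff _ hs] at h
  obtain ⟨hx, -⟩ := h
  set l := θ.lam z.1 with hldef
  set St := fderiv ℝ s z (1, 0) with hSt
  set Sx := fderiv ℝ s z (0, 1) with hSx
  -- `v_tx` and `v_xx` are found from `u = v_x / λ`
  let v := quadJet z (s z).2 St.2 (l * (s z).1) 0 (l * St.1 + deriv θ.lam z.1 * (s z).1) (l * Sx.1)
  have hv : ContDiffAt ℝ ∞ v z := (contDiff_quadJet ..).contDiffAt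
  have hvd := hv.differentiableAt (by simp)
  have hu : ContDiffAt ℝ ∞ (fun y => dx v y / θ.lam y.1) z :=
    (contDiffAt_dx hv).div ((θ.smooth_lam z hz).comp z contDiffAt_fst) hl
  have hud := hu.differentiableAt (by simp)
  refine ⟨v, hv, ?_, ?_⟩
  · simp only [liftSec, v, quadJet_self, dx_quadJet, sub_self, mul_zero, add_zero]
    rw [mul_div_cancel_left₀ _ hl]
  · have hfd : fderiv ℝ (liftSec θ v) z = _ := (hud.hasFDerivAt.prodMk hvd.hasFDerivAt).fderiv
    have hdt : dt (fun y => dx v y / θ.lam y.1) z = St.1 := by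
      have h1 : HasDerivAt (fun τ : ℝ => τ - z.1) 1 z.1 := (hasDerivAt_id z.1).sub_const _
      have h2 := ((h1.const_mul (l * St.1 + deriv θ.lam z.1 * (s z).1)).const_add
        (l * (s z).1)).div ((θ.smooth_lam z hz).differentiableAt (by simp)).hasDerivAt hl
      have h3 : (fun τ : ℝ => dx v (τ, z.2) / θ.lam τ) = (fun τ => l * (s z).1 +
          (l * St.1 + deriv θ.lam z.1 * (s z).1) * (τ - z.1)) / θ.lam := by
        funext τ
        simp [v, dx_quadJet]
      unfold dt
      simp only
      rw [h3, h2.deriv, ← hldef]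
      field_simp
      ring
    have hdx : dx (fun y => dx v y / θ.lam y.1) z = Sx.1 := by
      have h1 : dx (fun y => dx v y / θ.lam y.1) z = dx (dx v) z / θ.lam z.1 := by
        simp only [dx, deriv_div_const]
      rw [h1, dx_dx_quadJet, mul_div_cancel_left₀ _ hl]
    rw [dt_eq_fderiv hud] at hdt
    rw [dx_eq_fderiv hud] at hdx
    have e1 : fderiv ℝ (liftSec θ v) z (1, 0) = St := by
      rw [hfd]
      refine Prod.ext hdt ?_
      change fderiv ℝ v z (1, 0) = St.2
      simp [v, fderiv_quadJet]
    have e2 : fderiv ℝ (liftSec θ v) z (0, 1) = Sx := by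
      rw [hfd]
      refine Prod.ext hdx ?_
      change fderiv ℝ v z (0, 1) = Sx.2
      rw [hx]
      simp [v, fderiv_quadJet]
    refine ContinuousLinearMap.ext fun w => ?_
    have hw : w = w.1 • ((1 : ℝ), (0 : ℝ)) + w.2 • ((0 : ℝ), (1 : ℝ)) := by ext <;> simp
    rw [hw]
    simp only [map_add, map_smul, e1, e2, ← hSt, ← hSx]

/-- Whether the image of a function satisfies the target system is decided by the first-order jet of
this function, which can be replaced by the jet of a lift. -/
theorem IsStrongProlongation.potentialSystem_of {φ : A ⟶ B}
    {ψ : cylinder A ⟶ cylinder B} (h : IsStrongProlongation φ ψ)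
    (hφ : IsAdmissible potentialEquation φ) {s s' : ℝ × ℝ → ℝ × ℝ} {z z' : ℝ × ℝ}
    (hs : ContDiffAt ℝ ∞ s z) (hs' : ContDiffAt ℝ ∞ s' z') (ht : Transforms ψ s z s' z')
    (hE : potentialSystem A.elem s z) : potentialSystem B.elem s' z' := by
  have hsd := hs.differentiableAt (by simp)
  have hsd' := hs'.differentiableAt (by simp)
  have hz : z ∈ A.elem.dom := A.over_dom _ ht.mem
  obtain ⟨v, hv, h0, h1⟩ := exists_liftSec_jet hz hsd hE
  have hvm : graphPt v z ∈ A.carrier := by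
    have h2 : (s z).2 = v z := by rw [h0]; rfl
    have h3 : (z.1, z.2, (s z).2) ∈ A.carrier := ht.mem
    rwa [h2] at h3
  obtain ⟨v', z'', hv', htv⟩ := hφ.isFibered.preservesGraphs v z hvm hv
  have hz'' : z'' ∈ B.elem.dom := B.over_dom _ htv.symm.mem
  have hld := (contDiffAt_liftSec _ hz hv).differentiableAt (by simp)
  have hld' := (contDiffAt_liftSec _ hz'' hv').differentiableAt (by simp)
  have hev : potentialEquation A.elem v z := by
    rw [← potentialSystem_liftSec _ hz, potentialSystem_iff _ hld, ← h0, ← h1,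
      ← potentialSystem_iff _ hsd]
    exact hE
  have hev' := (hφ v v' z z'' hv hv' htv).1 hev
  rw [← potentialSystem_liftSec _ hz''] at hev'
  obtain ⟨rfl, k0, k1⟩ := ht.jet_eq (h.transforms hv hv' htv) hsd hsd' hld hld' h0 h1
  rw [potentialSystem_iff _ hld'] at hev'
  rw [potentialSystem_iff _ hsd', k0, k1]
  exact hev'

theorem IsStrongProlongation.isAdmissible_potentialSystem {φ : A ⟶ B}
    {ψ : cylinder A ⟶ cylinder B} (h : IsStrongProlongation φ ψ)
    (hφ : IsAdmissible potentialEquation φ) : IsAdmissible potentialSystem ψ :=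
  fun _ _ _ _ hs hs' ht => ⟨h.potentialSystem_of hφ hs hs' ht,
    h.inv.potentialSystem_of (isAdmissible_inv hφ) hs' hs ht.symm⟩

/-! ### Existence and uniqueness of prolongations -/

theorem IsFibered.tangent_fst_ne_zero {φ : A ⟶ B} (hφ : IsFibered φ) {p : ℝ × ℝ × ℝ}
    (hp : p ∈ A.carrier) :
    (tangent φ p (1, 0, 0)).1 ≠ 0 ∧ (tangent φ p (0, 1, 0)).2.1 ≠ 0 := by
  obtain ⟨hTx, hTv, hXv⟩ := hφ p hp
  obtain ⟨a, b, hab⟩ := exists_jacobian_ne_zero φ hp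
  rw [jacobian_apply, hTx, hTv, hXv] at hab
  constructor
  · intro h; simp [h] at hab
  · intro h; simp [h] at hab

theorem IsFibered.inv {φ : A ⟶ B} (hφ : IsFibered φ) : IsFibered (Groupoid.inv φ) := by
  intro p' hp'
  obtain ⟨p, hp, rfl⟩ : ∃ p ∈ A.carrier, PointTransf.map φ p = p' :=
    ⟨_, map_mem (Groupoid.inv φ) hp', map_map_inv φ hp'⟩
  obtain ⟨hTx, hTv, hXv⟩ := hφ p hp
  obtain ⟨hT, hX⟩ := hφ.tangent_fst_ne_zero hp
  have hTe : ∀ w : ℝ × ℝ × ℝ, (tangent φ p w).1 = w.1 * (tangent φ p (1, 0, 0)).1 := fun w => by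
    rw [show w = (w.1, w.2.1, w.2.2) from rfl, tangent_apply]
    simp [hTx, hTv]
  have hXe : ∀ w : ℝ × ℝ × ℝ, (tangent φ p w).2.1 = w.1 * (tangent φ p (1, 0, 0)).2.1 +
      w.2.1 * (tangent φ p (0, 1, 0)).2.1 := fun w => by
    rw [show w = (w.1, w.2.1, w.2.2) from rfl, tangent_apply]
    simp [hXv]
  have key : ∀ w : ℝ × ℝ × ℝ, w.1 = 0 →
      (tangent (Groupoid.inv φ) (PointTransf.map φ p) w).1 = 0 := fun w hw => by
    have h1 := hTe (tangent (Groupoid.inv φ) (PointTransf.map φ p) w)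
    rw [tangent_tangent_inv φ hp, hw] at h1
    exact (mul_eq_zero.1 h1.symm).resolve_right hT
  refine ⟨key _ rfl, key _ rfl, ?_⟩
  have h1 := hXe (tangent (Groupoid.inv φ) (PointTransf.map φ p) (0, 0, 1))
  rw [tangent_tangent_inv φ hp, key _ rfl, zero_mul, zero_add] at h1
  exact (mul_eq_zero.1 h1.symm).resolve_right hX

/-- The projection to the space of `(t,x,v)`. -/
noncomputable def projV : (ℝ × ℝ × ℝ × ℝ) →L[ℝ] (ℝ × ℝ × ℝ) :=
  covT.prod (covX.prod covV)

@[simp] theorem projV_apply (q : ℝ × ℝ × ℝ × ℝ) : projV q = (q.1, q.2.1, q.2.2.2) := rfl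

/-- The `u`-component `(V_x + λ u V_v) / (λ' X_x)` of the prolongation. -/
noncomputable def prolongU (φ : A ⟶ B) (q : ℝ × ℝ × ℝ × ℝ) : ℝ :=
  (tangent φ (projV q) (0, 1, A.elem.lam q.1 * q.2.2.1)).2.2 /
    (B.elem.lam (PointTransf.map φ (projV q)).1 * (tangent φ (projV q) (0, 1, 0)).2.1)

/-- The prolongation of `φ` as a map. -/
noncomputable def prolongMap (φ : A ⟶ B) (q : ℝ × ℝ × ℝ × ℝ) : ℝ × ℝ × ℝ × ℝ :=
  ((PointTransf.map φ (projV q)).1, (PointTransf.map φ (projV q)).2.1, prolongU φ q,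
    (PointTransf.map φ (projV q)).2.2)

theorem prolongMap_mem (φ : A ⟶ B) {q : ℝ × ℝ × ℝ × ℝ} (hq : q ∈ (cylinder A).carrier) :
    prolongMap φ q ∈ (cylinder B).carrier := map_mem φ (p := projV q) hq

theorem IsFibered.prolongMap_graphPt {φ : A ⟶ B} (hφ : IsFibered φ) {v v' : ℝ × ℝ → ℝ}
    {z z' : ℝ × ℝ} (hv : DifferentiableAt ℝ v z) (hv' : DifferentiableAt ℝ v' z')
    (ht : Transforms φ v z v' z') :
    prolongMap φ (graphPt (liftSec A.elem v) z) = graphPt (liftSec B.elem v') z' := by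
  have hm := ht.map_eq
  have hp : projV (graphPt (liftSec A.elem v) z) = graphPt v z := rfl
  have hl : A.elem.lam z.1 ≠ 0 := lam_ne_zero ht.mem
  have hl' : B.elem.lam z'.1 ≠ 0 := lam_ne_zero ht.symm.mem
  obtain ⟨hTx, hTv, hXv⟩ := hφ _ ht.mem
  obtain ⟨hT, hX⟩ := hφ.tangent_fst_ne_zero ht.mem
  have hu : prolongU φ (graphPt (liftSec A.elem v) z) = dx v' z' / B.elem.lam z'.1 := by
    have h1 : A.elem.lam (graphPt (liftSec A.elem v) z).1 *
        (graphPt (liftSec A.elem v) z).2.2.1 = dx v z := mul_div_cancel₀ _ hl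
    have c := ht.chain_rule hv hv' (0, 1)
    simp only [← dx_eq_fderiv hv, ← dx_eq_fderiv hv'] at c
    rw [prolongU, h1, hp, hm, c, tangent_apply φ _ 0 1 (dx v z)]
    simp only [zero_smul, one_smul, zero_add, Prod.fst_add, Prod.snd_add, Prod.smul_fst,
      Prod.smul_snd, hTx, hTv, hXv, smul_eq_mul, mul_zero, add_zero, zero_mul]
    change _ / (B.elem.lam z'.1 * _) = _
    field_simp
  rw [prolongMap, hp, hm, hu]
  rfl

theorem IsFibered.prolongMap_inv {φ : A ⟶ B} (hφ : IsFibered φ) {q : ℝ × ℝ × ℝ × ℝ}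
    (hq : q ∈ (cylinder A).carrier) : prolongMap (Groupoid.inv φ) (prolongMap φ q) = q := by
  obtain ⟨v, z, hv, hm, rfl⟩ := exists_liftSec hq
  obtain ⟨v', z', hv', ht⟩ := hφ.preservesGraphs v z hm hv
  have hvd := hv.differentiableAt (by simp)
  have hvd' := hv'.differentiableAt (by simp)
  rw [hφ.prolongMap_graphPt hvd hvd' ht, hφ.inv.prolongMap_graphPt hvd' hvd ht.symm]

theorem IsFibered.contDiffAt_prolongMap {φ : A ⟶ B} (hφ : IsFibered φ) {q : ℝ × ℝ × ℝ × ℝ}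
    (hq : q ∈ (cylinder A).carrier) : ContDiffAt ℝ ∞ (prolongMap φ) q := by
  have hp : projV q ∈ A.carrier := hq
  have h1 : ContDiffAt ℝ ∞ (fun y => PointTransf.map φ (projV y)) q :=
    (contDiffAt_map φ hp).comp q projV.contDiff.contDiffAt
  have h2 : ContDiffAt ℝ ∞ (fun y => tangent φ (projV y)) q :=
    (contDiffAt_tangent φ hp).comp q projV.contDiff.contDiffAt
  have h3 : ContDiffAt ℝ ∞ (fun y : ℝ × ℝ × ℝ × ℝ => A.elem.lam y.1) q :=
    (A.elem.smooth_lam _ (A.over_dom _ hp)).comp q contDiffAt_fst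
  have h4 : ContDiffAt ℝ ∞ (fun y => B.elem.lam (PointTransf.map φ (projV y)).1) q :=
    ContDiffAt.comp (f := fun y => (PointTransf.map φ (projV y)).1) q
      (B.elem.smooth_lam _ (B.over_dom _ (map_mem φ hp))) h1.fst
  have h5 : ContDiffAt ℝ ∞ (prolongU φ) q := by
    refine ContDiffAt.div ?_ (h4.mul (h2.clm_apply contDiffAt_const).snd.fst) ?_
    · refine (h2.clm_apply ?_).snd.snd
      fun_prop
    · exact mul_ne_zero (lam_ne_zero (map_mem φ hp)) (hφ.tangent_fst_ne_zero hp).2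
  exact h1.fst.prodMk (h1.snd.fst.prodMk (h5.prodMk h1.snd.snd))

/-- The prolongation of a fibered transformation. -/
noncomputable def prolong (φ : A ⟶ B) (hφ : IsFibered φ) : cylinder A ⟶ cylinder B :=
  mkTransf (prolongMap φ) (prolongMap (Groupoid.inv φ)) (fun _ hq => prolongMap_mem φ hq)
    (fun _ hq => prolongMap_mem _ hq) (fun _ hq => hφ.prolongMap_inv hq)
    (fun _ hq => hφ.inv.prolongMap_inv hq) (fun _ hq => hφ.contDiffAt_prolongMap hq)
    (fun _ hq => hφ.inv.contDiffAt_prolongMap hq)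

theorem map_prolong {φ : A ⟶ B} (hφ : IsFibered φ) {q : ℝ × ℝ × ℝ × ℝ}
    (hq : q ∈ (cylinder A).carrier) : PointTransf.map (prolong φ hφ) q = prolongMap φ q :=
  map_mkTransf hq

theorem isStrongProlongation_prolong {φ : A ⟶ B} (hφ : IsFibered φ) :
    IsStrongProlongation φ (prolong φ hφ) := by
  constructor
  · intro t x u v hp
    rw [map_prolong hφ (q := (t, x, u, v)) hp]
    rfl
  · intro v v' z z' hv hv' ht
    have h1 := hφ.prolongMap_graphPt hv hv' ht
    rw [← map_prolong hφ (q := graphPt (liftSec A.elem v) z) ht.mem] at h1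
    exact congrArg (fun p => p.2.2.1) h1

theorem IsStrongProlongation.eq {φ : A ⟶ B} (hφ : IsFibered φ) {ψ ψ' : cylinder A ⟶ cylinder B}
    (h : IsStrongProlongation φ ψ) (h' : IsStrongProlongation φ ψ') : ψ = ψ' := by
  refine ext_map fun q hq => ?_
  obtain ⟨v, z, hv, hm, rfl⟩ := exists_liftSec hq
  obtain ⟨v', z', hv', ht⟩ := hφ.preservesGraphs v z hm hv
  have hvd := hv.differentiableAt (by simp)
  have hvd' := hv'.differentiableAt (by simp)
  rw [h.map_graphPt hvd hvd' ht, h'.map_graphPt hvd hvd' ht]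

theorem IsStrongProlongation.eq_comp {φ : A ⟶ B} {φ' : B ⟶ C} (hφ : IsFibered φ)
    (hφ' : IsFibered φ')
    {ψ : cylinder A ⟶ cylinder B} {ψ' : cylinder B ⟶ cylinder C} {χ : cylinder A ⟶ cylinder C}
    (h : IsStrongProlongation φ ψ) (h' : IsStrongProlongation φ' ψ')
    (hχ : IsStrongProlongation (φ ≫ φ') χ) :
    χ = ψ ≫ ψ' := by
  refine ext_map fun q hq => ?_
  rw [map_comp ψ ψ' hq]
  obtain ⟨v, z, hv, hm, rfl⟩ := exists_liftSec hq
  obtain ⟨v', z', hv', ht⟩ := hφ.preservesGraphs v z hm hv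
  obtain ⟨v'', z'', hv'', ht'⟩ := hφ'.preservesGraphs v' z' ht.symm.mem hv'
  have hvd := hv.differentiableAt (by simp)
  have hvd' := hv'.differentiableAt (by simp)
  have hvd'' := hv''.differentiableAt (by simp)
  rw [h.map_graphPt hvd hvd' ht, h'.map_graphPt hvd' hvd'' ht',
    hχ.map_graphPt hvd hvd'' (ht.trans ht')]

theorem IsStrongProlongation.eq_id {χ : cylinder A ⟶ cylinder A}
    (hχ : IsStrongProlongation (𝟙 A) χ) : χ = 𝟙 (cylinder A) := by
  refine ext_map fun q hq => ?_
  rw [map_id hq]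
  obtain ⟨v, z, hv, hm, rfl⟩ := exists_liftSec hq
  have hvd := hv.differentiableAt (by simp)
  refine hχ.map_graphPt hvd hvd ⟨hm, map_id hm, ?_⟩
  filter_upwards [A.isOpen_carrier.mem_nhds hm] with p hp
  rw [map_id hp]

end

section

/-! ### Projections of admissible transformations of potential systems -/

section Projection

variable {A B : LocalEq (ℝ × ℝ)} {C D : LocalEq ℝ}

theorem tangent_projV {φ : C ⟶ D} {χ : A ⟶ B} {q : ℝ × ℝ × ℝ × ℝ} (hq : q ∈ A.carrier)
    (hp : projV q ∈ C.carrier)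
    (h : ∀ᶠ y in 𝓝 q, PointTransf.map φ (projV y) = projV (PointTransf.map χ y))
    (w : ℝ × ℝ × ℝ × ℝ) : tangent φ (projV q) (projV w) = projV (tangent χ q w) := by
  have h1 := (hasFDerivAt_map φ hp).comp q projV.hasFDerivAt
  have h2 := projV.hasFDerivAt.comp q (hasFDerivAt_map χ hq)
  exact DFunLike.congr_fun (h1.unique (h2.congr_of_eventuallyEq h)) w

/-- The `(t,x,v)`-components of a projectable transformation do not change along segments on which
only `u` varies. -/
theorem IsProjectable.projV_map_eq {χ : A ⟶ B} (h : IsProjectable χ) {t x u u' v : ℝ}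
    {I : Set ℝ} (hI : IsOpen I) (hI' : _root_.IsPreconnected I)
    (hA : ∀ y ∈ I, (t, x, y, v) ∈ A.carrier) (hu : u ∈ I) (hu' : u' ∈ I) :
    projV (PointTransf.map χ (t, x, u, v)) = projV (PointTransf.map χ (t, x, u', v)) := by
  have hd : ∀ y ∈ I, HasDerivAt (fun y => projV (PointTransf.map χ (t, x, y, v))) 0 y := by
    intro y hy
    have h1 : HasDerivAt (fun y : ℝ => ((t, x, y, v) : ℝ × ℝ × ℝ × ℝ)) (0, 0, 1, 0) y :=
      (hasDerivAt_const _ _).prodMk ((hasDerivAt_const _ _).prodMk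
        ((hasDerivAt_id y).prodMk (hasDerivAt_const _ _)))
    have h2 := HasFDerivAt.comp_hasDerivAt (f := fun y : ℝ => ((t, x, y, v) : ℝ × ℝ × ℝ × ℝ)) y
      (projV.hasFDerivAt.comp _ (hasFDerivAt_map χ (hA y hy))) h1
    have h3 : projV (tangent χ (t, x, y, v) (0, 0, 1, 0)) = 0 := by
      rw [projV_apply, (h.fst _ (hA y hy)).2.1, h.snd_u _ (hA y hy), h.last_u _ (hA y hy)]
      rfl
    rw [ContinuousLinearMap.comp_apply, h3] at h2
    exact h2
  exact hI.is_const_of_deriv_eq_zero hI'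
    (fun y hy => (hd y hy).differentiableAt.differentiableWithinAt)
    (fun y hy => (hd y hy).deriv) hu hu'

end Projection

variable {A B : LocalEq ℝ}

/-- The projection to the space of `(t,x,v)`, as a map. -/
noncomputable def projMap (ψ : cylinder A ⟶ cylinder B) (p : ℝ × ℝ × ℝ) : ℝ × ℝ × ℝ :=
  projV (PointTransf.map ψ (p.1, p.2.1, 0, p.2.2))

/-- The value `u = 0` in the definition of `projMap` is immaterial. -/
theorem IsProjectable.projMap_projV {ψ : cylinder A ⟶ cylinder B} (h : IsProjectable ψ)
    {q : ℝ × ℝ × ℝ × ℝ} (hq : q ∈ (cylinder A).carrier) :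
    projMap ψ (projV q) = projV (PointTransf.map ψ q) :=
  h.projV_map_eq (t := q.1) (x := q.2.1) (u := 0) (u' := q.2.2.1) (v := q.2.2.2) (I := univ)
    isOpen_univ isPreconnected_univ (fun _ _ => hq) (mem_univ _) (mem_univ _)

theorem projMap_mem (ψ : cylinder A ⟶ cylinder B) {p : ℝ × ℝ × ℝ} (hp : p ∈ A.carrier) :
    projMap ψ p ∈ B.carrier :=
  map_mem ψ (p := (p.1, p.2.1, 0, p.2.2)) hp

theorem contDiffAt_projMap (ψ : cylinder A ⟶ cylinder B) {p : ℝ × ℝ × ℝ} (hp : p ∈ A.carrier) :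
    ContDiffAt ℝ ∞ (projMap ψ) p := by
  have h1 := contDiffAt_map ψ (p := (p.1, p.2.1, 0, p.2.2)) hp
  have h2 : ContDiffAt ℝ ∞ (fun p : ℝ × ℝ × ℝ => (p.1, p.2.1, (0 : ℝ), p.2.2)) p := by fun_prop
  exact projV.contDiff.contDiffAt.comp p
    (ContDiffAt.comp (f := fun p : ℝ × ℝ × ℝ => (p.1, p.2.1, (0 : ℝ), p.2.2)) p h1 h2)

theorem IsProjectable.projMap_inv {ψ : cylinder A ⟶ cylinder B}
    (h' : IsProjectable (Groupoid.inv ψ)) {p : ℝ × ℝ × ℝ} (hp : p ∈ A.carrier) :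
    projMap (Groupoid.inv ψ) (projMap ψ p) = p := by
  have hq : ((p.1, p.2.1, 0, p.2.2) : ℝ × ℝ × ℝ × ℝ) ∈ (cylinder A).carrier := hp
  have h1 := h'.projMap_projV (map_mem ψ hq)
  rw [map_inv_map ψ hq] at h1
  exact h1

/-- The projection of a transformation of systems to the space of `(t,x,v)`. -/
noncomputable def project (ψ : cylinder A ⟶ cylinder B) (h : IsProjectable ψ)
    (h' : IsProjectable (Groupoid.inv ψ)) : A ⟶ B :=
  mkTransf (projMap ψ) (projMap (Groupoid.inv ψ)) (fun _ hp => projMap_mem ψ hp)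
    (fun _ hp => projMap_mem _ hp) (fun _ hp => h'.projMap_inv hp)
    (fun _ hp => IsProjectable.projMap_inv (ψ := Groupoid.inv ψ) h hp)
    (fun _ hp => contDiffAt_projMap ψ hp) (fun _ hp => contDiffAt_projMap _ hp)

theorem isProjection_project {ψ : cylinder A ⟶ cylinder B} (h : IsProjectable ψ)
    (h' : IsProjectable (Groupoid.inv ψ)) : IsProjection ψ (project ψ h h') := by
  intro t x u v hp
  exact (map_mkTransf hp).trans (h.projMap_projV (q := (t, x, u, v)) hp)

theorem IsProjection.tangent_projV {φ : A ⟶ B} {ψ : cylinder A ⟶ cylinder B}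
    (h : IsProjection ψ φ) {q : ℝ × ℝ × ℝ × ℝ} (hq : q ∈ (cylinder A).carrier)
    (w : ℝ × ℝ × ℝ × ℝ) : tangent φ (projV q) (projV w) = projV (tangent ψ q w) := by
  refine PotentialBurgers.tangent_projV hq hq ?_ w
  filter_upwards [(cylinder A).isOpen_carrier.mem_nhds hq] with y hy
  exact h y.1 y.2.1 y.2.2.1 y.2.2.2 hy

theorem IsProjection.isFibered {φ : A ⟶ B} {ψ : cylinder A ⟶ cylinder B}
    (h : IsProjection ψ φ) (hψ : IsProjectable ψ) : IsFibered φ := by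
  intro p hp
  have hq : ((p.1, p.2.1, 0, p.2.2) : ℝ × ℝ × ℝ × ℝ) ∈ (cylinder A).carrier := hp
  have hT := h.tangent_projV hq
  have e : projV (p.1, p.2.1, 0, p.2.2) = p := rfl
  rw [e] at hT
  have h1 := hT (0, 1, 0, 0)
  have h2 := hT (0, 0, 0, 1)
  simp only [projV_apply] at h1 h2
  rw [h1, h2]
  exact ⟨(hψ.fst _ hq).1, (hψ.fst _ hq).2.2, hψ.snd_v _ hq⟩

/-- A projectable transformation is the prolongation of its projection. -/
theorem IsProjection.isStrongProlongation {φ : A ⟶ B} {ψ : cylinder A ⟶ cylinder B}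
    (h : IsProjection ψ φ) (hψ : IsProjectable ψ) : IsStrongProlongation φ ψ := by
  refine ⟨h, fun v v' z z' hv hv' ht => ?_⟩
  have hl : A.elem.lam z.1 ≠ 0 := lam_ne_zero ht.mem
  have hl' : B.elem.lam z'.1 ≠ 0 := lam_ne_zero ht.symm.mem
  set q : ℝ × ℝ × ℝ × ℝ := (z.1, z.2, dx v z / A.elem.lam z.1, v z) with hqdef
  have hq : q ∈ (cylinder A).carrier := ht.mem
  have hpq : projV q = graphPt v z := rfl
  have hX := tangent_snd_ne_zero ψ hq (hψ.fst q hq) (hψ.snd_u q hq) (hψ.snd_v q hq)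
  have hT := h.tangent_projV hq (vecXi A.elem q)
  have hxi : projV (vecXi A.elem q) = (0, 1, dx v z) := by
    simp only [vecXi, projV_apply, hqdef]
    rw [mul_div_cancel₀ _ hl]
  rw [hpq, hxi] at hT
  have c := ht.chain_rule hv hv' (0, 1)
  simp only [← dx_eq_fderiv hv, ← dx_eq_fderiv hv', smul_eq_mul] at c
  rw [hT] at c
  have hcon : contactForm ψ q (vecXi A.elem q) = 0 := hψ.contact q hq
  have hm1 : (PointTransf.map ψ q).1 = z'.1 := by
    have h1 := h z.1 z.2 (dx v z / A.elem.lam z.1) (v z) ht.mem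
    have h2 := ht.map_eq
    unfold graphPt at h2
    rw [h1] at h2
    exact congrArg (fun p => p.1) h2
  rw [contactForm_apply, hm1] at hcon
  change _ - B.elem.lam z'.1 * _ * _ = 0 at hcon
  simp only [projV_apply] at c
  have hT0 := tangent_fst_of ψ (hψ.fst q hq) (vecXi A.elem q)
  have hX0 : (tangent ψ q (vecXi A.elem q)).2.1 = (tangent ψ q (0, 1, 0, 0)).2.1 := by
    have h1 : (tangent ψ q (vecXi A.elem q)).2.1 = _ :=
      functional_apply (covX.comp (tangent ψ q)) 0 1 0 (A.elem.lam q.1 * q.2.2.1)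
    rw [h1]
    simp [hψ.snd_v q hq]
  rw [hT0, hX0] at c
  rw [hX0] at hcon
  simp only [vecXi, zero_mul, zero_add] at c hcon
  change _ = dx v' z' / B.elem.lam z'.1
  rw [eq_div_iff hl']
  refine mul_left_cancel₀ hX ?_
  linear_combination -hcon + c

/-- A prolongation of a fibered transformation is projectable. -/
theorem isProjectable_prolong {φ : A ⟶ B} (hφ : IsFibered φ) : IsProjectable (prolong φ hφ) := by
  have h := (isStrongProlongation_prolong hφ).1
  have key : ∀ q ∈ (cylinder A).carrier, ∀ w,
      (tangent (prolong φ hφ) q w).1 = (tangent φ (projV q) (projV w)).1 ∧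
      (tangent (prolong φ hφ) q w).2.1 = (tangent φ (projV q) (projV w)).2.1 ∧
      (tangent (prolong φ hφ) q w).2.2.2 = (tangent φ (projV q) (projV w)).2.2 := by
    intro q hq w
    rw [h.tangent_projV hq]
    exact ⟨rfl, rfl, rfl⟩
  have h0 : projV (0, 0, 1, 0) = 0 := rfl
  refine ⟨fun q hq => ?_, fun q hq => ?_, fun q hq => ?_, fun q hq => ?_, fun q hq => ?_⟩
  · obtain ⟨hTx, hTv, hXv⟩ := hφ (projV q) hq
    rw [(key q hq _).1, (key q hq _).1, (key q hq _).1, h0, map_zero]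
    exact ⟨hTx, rfl, hTv⟩
  · rw [(key q hq _).2.1, h0, map_zero]; rfl
  · rw [(key q hq _).2.1]; exact (hφ (projV q) hq).2.2
  · rw [(key q hq _).2.2, h0, map_zero]; rfl
  · have hX := (hφ.tangent_fst_ne_zero (p := projV q) hq).2
    have hl' : B.elem.lam (PointTransf.map φ (projV q)).1 ≠ 0 :=
      lam_ne_zero (map_mem φ (p := projV q) hq)
    rw [contactForm_apply, (key q hq _).2.1, (key q hq _).2.2, map_prolong hφ hq]
    have e1 : projV (vecXi A.elem q) = (0, 1, A.elem.lam q.1 * q.2.2.1) := rfl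
    have e2 : (tangent φ (projV q) (0, 1, A.elem.lam q.1 * q.2.2.1)).2.1 =
        (tangent φ (projV q) (0, 1, 0)).2.1 := by
      rw [tangent_apply]
      have hXv := (hφ (projV q) hq).2.2
      simp only [Prod.snd_add, Prod.fst_add, Prod.smul_snd, Prod.smul_fst, hXv, smul_eq_mul,
        mul_zero, zero_mul, one_mul, add_zero, zero_add]
    change (tangent φ (projV q) (projV (vecXi A.elem q))).2.2 -
      B.elem.lam (PointTransf.map φ (projV q)).1 * prolongU φ q *
      (tangent φ (projV q) (projV (vecXi A.elem q))).2.1 = 0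
    rw [e1, e2, prolongU]
    field_simp
    ring

end

section

/-! ### Admissible transformations of potential systems are locally prolongations -/

section Local

variable {A B : LocalEq (ℝ × ℝ)} {C D : LocalEq ℝ}

attribute [local fun_prop] analyticAt_fst analyticAt_snd

/-- The embedding of the space of `(t,x,v)` as the hyperplane on which `u` is constant. -/
def atU (u : ℝ) (p : ℝ × ℝ × ℝ) : ℝ × ℝ × ℝ × ℝ := (p.1, p.2.1, u, p.2.2)

theorem projV_atU (u : ℝ) (p : ℝ × ℝ × ℝ) : projV (atU u p) = p := rfl

theorem contDiff_atU (u : ℝ) : ContDiff ℝ ∞ (atU u) := by unfold atU; fun_prop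

theorem IsProjectable.tangent_last_v_ne_zero {χ : A ⟶ B} (h : IsProjectable χ)
    {q : ℝ × ℝ × ℝ × ℝ} (hq : q ∈ A.carrier) : (tangent χ q (0, 0, 0, 1)).2.2.2 ≠ 0 := by
  have hu : contactForm χ q (0, 0, 1, 0) = 0 := by
    rw [contactForm_apply, h.snd_u q hq, h.last_u q hq, mul_zero, sub_zero]
  have hv := contactForm_ne_zero χ hq (h.fst q hq) hu (h.contact q hq)
  rwa [contactForm_apply, h.snd_v q hq, mul_zero, sub_zero] at hv

/-- The `(t,x,v)`-components form a local diffeomorphism of each hyperplane `u = const`. -/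
theorem IsProjectable.exists_hasFDerivAt_projV {χ : A ⟶ B} (h : IsProjectable χ) {u : ℝ}
    {p : ℝ × ℝ × ℝ} (hq : atU u p ∈ A.carrier) :
    ∃ L : (ℝ × ℝ × ℝ) ≃L[ℝ] (ℝ × ℝ × ℝ),
      HasFDerivAt (fun p => projV (PointTransf.map χ (atU u p)))
        (L : (ℝ × ℝ × ℝ) →L[ℝ] (ℝ × ℝ × ℝ)) p := by
  set q := atU u p
  let ι : (ℝ × ℝ × ℝ) →L[ℝ] (ℝ × ℝ × ℝ × ℝ) :=
    (ContinuousLinearMap.fst ℝ ℝ _).prod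
      (((ContinuousLinearMap.fst ℝ ℝ _).comp (ContinuousLinearMap.snd ℝ ℝ _)).prod
        ((0 : (ℝ × ℝ × ℝ) →L[ℝ] ℝ).prod
          ((ContinuousLinearMap.snd ℝ ℝ _).comp (ContinuousLinearMap.snd ℝ ℝ _))))
  have hι : HasFDerivAt (atU u) ι p :=
    hasFDerivAt_fst.prodMk (hasFDerivAt_snd.fst.prodMk ((hasFDerivAt_const u p).prodMk
      hasFDerivAt_snd.snd))
  have hL := projV.hasFDerivAt.comp p ((hasFDerivAt_map χ hq).comp p hι)
  set L := projV.comp ((tangent χ q).comp ι)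
  have hLw : ∀ w, L w = projV (tangent χ q (w.1, w.2.1, 0, w.2.2)) := fun w => rfl
  have hLi : Function.Injective L.toLinearMap := by
    rw [← LinearMap.ker_eq_bot, LinearMap.ker_eq_bot']
    intro w hw
    have hw' : L w = 0 := hw
    rw [hLw, projV_apply, tangent_fst_of χ (h.fst q hq), Prod.mk_eq_zero, Prod.mk_eq_zero] at hw'
    obtain ⟨h1, h2, h3⟩ := hw'
    have w1 : w.1 = 0 := (mul_eq_zero.1 h1).resolve_right (tangent_fst_ne_zero χ hq (h.fst q hq))
    have e2 : (tangent χ q (w.1, w.2.1, 0, w.2.2)).2.1 = _ :=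
      functional_apply (covX.comp (tangent χ q)) w.1 w.2.1 0 w.2.2
    have e3 : (tangent χ q (w.1, w.2.1, 0, w.2.2)).2.2.2 = _ :=
      functional_apply (covV.comp (tangent χ q)) w.1 w.2.1 0 w.2.2
    simp only [ContinuousLinearMap.comp_apply, covX_apply, covV_apply, w1, h.snd_v q hq] at e2 e3
    rw [w1] at h2 h3
    rw [h2] at e2
    rw [h3] at e3
    have w2 : w.2.1 = 0 := by
      refine (mul_eq_zero.1 (?_ : w.2.1 * (tangent χ q (0, 1, 0, 0)).2.1 = 0)).resolve_right
        (tangent_snd_ne_zero χ hq (h.fst q hq) (h.snd_u q hq) (h.snd_v q hq))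
      linear_combination -e2
    rw [w2] at e3
    have w3 : w.2.2 = 0 := by
      refine (mul_eq_zero.1 (?_ : w.2.2 * (tangent χ q (0, 0, 0, 1)).2.2.2 = 0)).resolve_right
        (h.tangent_last_v_ne_zero hq)
      linear_combination -e3
    exact Prod.ext w1 (Prod.ext w2 w3)
  let e : (ℝ × ℝ × ℝ) ≃L[ℝ] (ℝ × ℝ × ℝ) :=
    (LinearEquiv.ofInjectiveEndo L.toLinearMap hLi).toContinuousLinearEquiv
  have he : (e : (ℝ × ℝ × ℝ) →L[ℝ] (ℝ × ℝ × ℝ)) = L := ContinuousLinearMap.ext fun _ => rfl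
  exact ⟨e, he ▸ hL⟩

/-- `φ` is the projection of the restriction of `χ` to the points over the open set of `C` with
`u ∈ I`. -/
def IsLocalProjection (χ : A ⟶ B) (φ : C ⟶ D) (I : Set ℝ) : Prop :=
  ∀ y : ℝ × ℝ × ℝ × ℝ, projV y ∈ C.carrier → y.2.2.1 ∈ I →
    y ∈ A.carrier ∧ PointTransf.map φ (projV y) = projV (PointTransf.map χ y)

/-- Near each point, a projectable transformation of systems on arbitrary open sets projects to a
transformation of the space of `(t,x,v)`. -/
theorem IsProjectable.exists_projection {χ : A ⟶ B} (h : IsProjectable χ)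
    {q : ℝ × ℝ × ℝ × ℝ} (hq : q ∈ A.carrier) :
    ∃ (C D : LocalEq ℝ) (φ : C ⟶ D) (I : Set ℝ), C.elem = A.elem ∧ D.elem = B.elem ∧
      projV q ∈ C.carrier ∧ IsOpen I ∧ q.2.2.1 ∈ I ∧ IsLocalProjection χ φ I := by
  -- balls of the maximum norm are products of balls in `(t,x,v)` and of intervals in `u`
  obtain ⟨ε, hε, hball⟩ := Metric.isOpen_iff.1 A.isOpen_carrier q hq
  have hUI : ∀ y : ℝ × ℝ × ℝ × ℝ, projV y ∈ Metric.ball (projV q) ε →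
      y.2.2.1 ∈ Metric.ball q.2.2.1 ε → y ∈ A.carrier := by
    intro y h1 h2
    refine hball ?_
    simp only [Metric.mem_ball, projV_apply, Prod.dist_eq, sup_lt_iff] at h1 h2 ⊢
    exact ⟨h1.1, h1.2.1, h2, h1.2.2⟩
  have hu : q.2.2.1 ∈ Metric.ball q.2.2.1 ε := Metric.mem_ball_self hε
  set f : ℝ × ℝ × ℝ → ℝ × ℝ × ℝ := fun p => projV (PointTransf.map χ (atU q.2.2.1 p)) with hf
  have hmem : ∀ p ∈ Metric.ball (projV q) ε, atU q.2.2.1 p ∈ A.carrier := fun p hp =>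
    hUI (atU q.2.2.1 p) hp hu
  have hsm : ∀ p ∈ Metric.ball (projV q) ε, ContDiffAt ℝ ∞ f p := fun p hp =>
    projV.contDiff.contDiffAt.comp p
      ((contDiffAt_map χ (hmem p hp)).comp p (contDiff_atU _).contDiffAt)
  have hp₀ : projV q ∈ Metric.ball (projV q) ε := Metric.mem_ball_self hε
  obtain ⟨L, hL⟩ := h.exists_hasFDerivAt_projV (hmem _ hp₀)
  let P := (hsm _ hp₀).toOpenPartialHomeomorph f hL (by simp)
  have hp₀P : projV q ∈ P.source := (hsm _ hp₀).mem_toOpenPartialHomeomorph_source hL (by simp)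
  let e := P.restrOpen (Metric.ball (projV q) ε) Metric.isOpen_ball
  have hes : ∀ p ∈ e.source, p ∈ Metric.ball (projV q) ε := fun p hp => hp.2
  have hef : ∀ p, e p = f p := fun p => rfl
  let C : LocalEq ℝ := ⟨A.elem, e.source, e.open_source, fun p hp =>
    A.over_dom _ (hmem p (hes p hp))⟩
  let D : LocalEq ℝ := ⟨B.elem, e.target, e.open_target, fun p hp => by
    have h1 := hmem _ (hes _ (e.map_target hp))
    have h2 := B.over_dom _ (map_mem χ h1)
    have h3 : f (e.symm p) = p := e.right_inv hp
    rw [← h3]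
    exact h2⟩
  let φ : C ⟶ D := mkTransf f e.symm (fun _ hp => e.map_source hp) (fun _ hp => e.map_target hp)
    (fun _ hp => e.left_inv hp) (fun _ hp => e.right_inv hp) (fun p hp => hsm p (hes p hp))
    (fun p hp => by
      have h1 := hes _ (e.map_target hp)
      obtain ⟨L', hL'⟩ := h.exists_hasFDerivAt_projV (hmem _ h1)
      exact e.contDiffAt_symm hp hL' (hsm _ h1))
  refine ⟨C, D, φ, Metric.ball q.2.2.1 ε, rfl, rfl, ⟨hp₀P, hp₀⟩, Metric.isOpen_ball, hu,
    fun y hy hyu => ⟨hUI y (hes _ hy) hyu, ?_⟩⟩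
  rw [show PointTransf.map φ (projV y) = f (projV y) from map_mkTransf hy]
  exact h.projV_map_eq (t := y.1) (x := y.2.1) (v := y.2.2.2) Metric.isOpen_ball
    (convex_ball _ _).isPreconnected (fun u' hu' => hUI (y.1, y.2.1, u', y.2.2.2) (hes _ hy) hu')
    hu hyu

theorem IsLocalProjection.tangent_projV {χ : A ⟶ B} {φ : C ⟶ D} {I : Set ℝ}
    (hφ : IsLocalProjection χ φ I) (hI : IsOpen I) {y : ℝ × ℝ × ℝ × ℝ} (hy : projV y ∈ C.carrier)
    (hyI : y.2.2.1 ∈ I) (w : ℝ × ℝ × ℝ × ℝ) :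
    tangent φ (projV y) (projV w) = projV (tangent χ y w) := by
  refine PotentialBurgers.tangent_projV (hφ y hy hyI).1 hy ?_ w
  have h1 : ContinuousAt (fun y : ℝ × ℝ × ℝ × ℝ => y.2.2.1) y := by fun_prop
  filter_upwards [projV.continuous.continuousAt.eventually (C.isOpen_carrier.mem_nhds hy),
    h1.eventually (hI.mem_nhds hyI)] with y' h2 h3
  exact (hφ y' h2 h3).2

theorem IsLocalProjection.isFibered {χ : A ⟶ B} (h : IsProjectable χ) {φ : C ⟶ D} {I : Set ℝ}
    (hφ : IsLocalProjection χ φ I) (hI : IsOpen I) {u : ℝ} (hu : u ∈ I) : IsFibered φ := by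
  intro p hp
  have hq := (hφ (atU u p) hp hu).1
  have hT := hφ.tangent_projV hI (y := atU u p) hp hu
  rw [projV_atU] at hT
  have h1 := hT (0, 1, 0, 0)
  have h2 := hT (0, 0, 0, 1)
  simp only [projV_apply] at h1 h2
  rw [h1, h2]
  exact ⟨(h.fst _ hq).1, (h.fst _ hq).2.2, h.snd_v _ hq⟩

/-- The prolongation of the projection of `χ` coincides with `χ`. -/
theorem IsLocalProjection.prolongMap_eq {χ : A ⟶ B} (h : IsProjectable χ) {φ : C ⟶ D} {I : Set ℝ}
    (hφ : IsLocalProjection χ φ I) (hI : IsOpen I) (hC : C.elem = A.elem) (hD : D.elem = B.elem)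
    {y : ℝ × ℝ × ℝ × ℝ} (hy : projV y ∈ C.carrier) (hyI : y.2.2.1 ∈ I) :
    prolongMap φ y = PointTransf.map χ y := by
  obtain ⟨hq, hm⟩ := hφ y hy hyI
  have h0 : B.elem.lam (PointTransf.map χ y).1 ≠ 0 :=
    right_ne_zero_of_mul (B.elem.ne_zero _ (B.over_dom _ (map_mem χ hq)))
  have hX := tangent_snd_ne_zero χ hq (h.fst y hq) (h.snd_u y hq) (h.snd_v y hq)
  have h1 := hφ.tangent_projV hI hy hyI (vecXi A.elem y)
  have h2 := hφ.tangent_projV hI hy hyI (0, 1, 0, 0)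
  have h3 : (tangent χ y (vecXi A.elem y)).2.1 = _ :=
    functional_apply (covX.comp (tangent χ y)) 0 1 0 (A.elem.lam y.1 * y.2.2.1)
  simp only [ContinuousLinearMap.comp_apply, covX_apply, h.snd_v y hq, zero_mul, one_mul, mul_zero,
    add_zero, zero_add] at h3
  have h4 := h.contact y hq
  rw [contactForm_apply, h3] at h4
  have hu : prolongU φ y = (PointTransf.map χ y).2.2.1 := by
    rw [prolongU, hC, hD, hm, show ((0, 1, 0) : ℝ × ℝ × ℝ) = projV (0, 1, 0, 0) from rfl, h2,
      show (0, 1, A.elem.lam y.1 * y.2.2.1) = projV (vecXi A.elem y) from rfl, h1]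
    simp only [projV_apply]
    rw [div_eq_iff (mul_ne_zero h0 hX)]
    linear_combination h4
  rw [prolongMap, hm, hu]
  rfl

theorem IsLocalProjection.eventually_map_prolong_eq {χ : A ⟶ B} (h : IsProjectable χ)
    {φ : C ⟶ D} {I : Set ℝ} (hφ : IsLocalProjection χ φ I) (hI : IsOpen I)
    (hC : C.elem = A.elem) (hD : D.elem = B.elem) (hf : IsFibered φ) {y : ℝ × ℝ × ℝ × ℝ}
    (hy : projV y ∈ C.carrier) (hyI : y.2.2.1 ∈ I) :
    PointTransf.map (prolong φ hf) =ᶠ[𝓝 y] PointTransf.map χ := by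
  have h1 : ContinuousAt (fun y : ℝ × ℝ × ℝ × ℝ => y.2.2.1) y := by fun_prop
  filter_upwards [projV.continuous.continuousAt.eventually (C.isOpen_carrier.mem_nhds hy),
    h1.eventually (hI.mem_nhds hyI)] with y' h2 h3
  rw [map_prolong hf h2, hφ.prolongMap_eq h hI hC hD h2 h3]

theorem sysDefect_congr {A' B' : LocalEq (ℝ × ℝ)} {χ : A ⟶ B} {χ' : A' ⟶ B'}
    (hA : A.elem = A'.elem) (hB : B.elem = B'.elem) {y : ℝ × ℝ × ℝ × ℝ}
    (h : PointTransf.map χ =ᶠ[𝓝 y] PointTransf.map χ') (b : ℝ) :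
    sysDefect χ y b = sysDefect χ' y b := by
  have h1 : tangent χ y = tangent χ' y := h.fderiv_eq
  simp only [sysDefect, contactForm_apply, h1, h.eq_of_nhds, hA, hB]

/-- The `u`-component of the prolongation is affine in `u`. -/
theorem prolongU_eq (φ : C ⟶ D) (y : ℝ × ℝ × ℝ × ℝ) :
    prolongU φ y = prolongU φ (atU 0 (projV y)) +
      y.2.2.1 * (prolongU φ (atU 1 (projV y)) - prolongU φ (atU 0 (projV y))) := by
  simp only [prolongU, projV_atU]
  have hy : ∀ c, C.elem.lam (atU c (projV y)).1 * (atU c (projV y)).2.2.1 = C.elem.lam y.1 * c :=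
    fun _ => rfl
  simp only [hy]
  generalize projV y = p
  have h1 : ∀ c, (tangent φ p (0, 1, c)).2.2 =
      (tangent φ p (0, 1, 0)).2.2 + c * (tangent φ p (0, 0, 1)).2.2 := by
    intro c
    rw [tangent_apply, tangent_apply φ p 0 1 0]
    simp
  rw [h1 (_ * y.2.2.1), h1 (_ * 0), h1 (_ * 1)]
  ring

theorem contDiffAt_prolongU {φ : C ⟶ D} (hφ : IsFibered φ) {q : ℝ × ℝ × ℝ × ℝ}
    (hq : q ∈ (cylinder C).carrier) : ContDiffAt ℝ ∞ (prolongU φ) q :=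
  (hφ.contDiffAt_prolongMap hq).snd.snd.fst

/-- For fixed `(t,x,v)`, the differential of the `u`-component of the prolongation is affine in
`u`. -/
theorem tangent_prolong_u {φ : C ⟶ D} (hφ : IsFibered φ) {p : ℝ × ℝ × ℝ} (hp : p ∈ C.carrier) :
    ∃ (ℓ₀ ℓ₁ : (ℝ × ℝ × ℝ) →L[ℝ] ℝ) (β : ℝ), ∀ u w,
      (tangent (prolong φ hφ) (atU u p) w).2.2.1 =
        ℓ₀ (projV w) + u * ℓ₁ (projV w) + w.2.2.1 * β := by
  have hG : ∀ c, DifferentiableAt ℝ (fun p => prolongU φ (atU c p)) p := fun c =>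
    ((contDiffAt_prolongU hφ (q := atU c p) hp).comp p
      (contDiff_atU c).contDiffAt).differentiableAt (by simp)
  set ℓ₀ := fderiv ℝ (fun p => prolongU φ (atU 0 p)) p
  set ℓ₁ := fderiv ℝ (fun p => prolongU φ (atU 1 p)) p
  have h0 : HasFDerivAt _ ℓ₀ p := (hG 0).hasFDerivAt
  have h1 : HasFDerivAt _ ℓ₁ p := (hG 1).hasFDerivAt
  refine ⟨ℓ₀, ℓ₁ - ℓ₀, prolongU φ (atU 1 p) - prolongU φ (atU 0 p), fun u w => ?_⟩
  have hq : atU u p ∈ (cylinder C).carrier := hp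
  have e0 : HasFDerivAt (fun y => prolongU φ (atU 0 (projV y))) _ (atU u p) :=
    HasFDerivAt.comp (f := projV) (atU u p) h0 projV.hasFDerivAt
  have e1 : HasFDerivAt (fun y => prolongU φ (atU 1 (projV y))) _ (atU u p) :=
    HasFDerivAt.comp (f := projV) (atU u p) h1 projV.hasFDerivAt
  have e2 : HasFDerivAt (fun y : ℝ × ℝ × ℝ × ℝ => y.2.2.1) _ (atU u p) :=
    ((ContinuousLinearMap.fst ℝ ℝ ℝ).comp ((ContinuousLinearMap.snd ℝ ℝ (ℝ × ℝ)).comp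
      (ContinuousLinearMap.snd ℝ ℝ (ℝ × ℝ × ℝ)))).hasFDerivAt
  have e3 := e0.add (e2.mul (e1.sub e0))
  have e4 := (hasFDerivAt_map (prolong φ hφ) hq).snd.snd.fst
  have e5 : (fun y => (PointTransf.map (prolong φ hφ) y).2.2.1) =ᶠ[𝓝 (atU u p)]
      fun y => prolongU φ (atU 0 (projV y)) +
        y.2.2.1 * (prolongU φ (atU 1 (projV y)) - prolongU φ (atU 0 (projV y))) := by
    filter_upwards [(cylinder C).isOpen_carrier.mem_nhds hq] with y hy
    rw [map_prolong hφ hy, ← prolongU_eq]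
    rfl
  have e6 := DFunLike.congr_fun (e4.unique (e3.congr_of_eventuallyEq e5)) w
  refine e6.trans ?_
  change ℓ₀ (projV w) + (u * (ℓ₁ (projV w) - ℓ₀ (projV w)) +
    (prolongU φ (atU 1 p) - prolongU φ (atU 0 p)) * w.2.2.1) =
    ℓ₀ (projV w) + u * (ℓ₁ (projV w) - ℓ₀ (projV w)) + w.2.2.1 * _
  ring

/-- For fixed `(t,x,v)`, `sysDefect` of a prolongation is even a polynomial in `u`. -/
theorem sysDefect_prolong_analyticAt {φ : C ⟶ D} (hφ : IsFibered φ) {p : ℝ × ℝ × ℝ}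
    (hp : p ∈ C.carrier) (b u : ℝ) :
    AnalyticAt ℝ (fun u => sysDefect (prolong φ hφ) (atU u p) b) u := by
  obtain ⟨ℓ₀, ℓ₁, β, hℓ⟩ := tangent_prolong_u hφ hp
  have key : ∀ u w, (tangent (prolong φ hφ) (atU u p) w).1 = (tangent φ p (projV w)).1 ∧
      (tangent (prolong φ hφ) (atU u p) w).2.1 = (tangent φ p (projV w)).2.1 ∧
      (tangent (prolong φ hφ) (atU u p) w).2.2.2 = (tangent φ p (projV w)).2.2 := by
    intro u w
    have h := (isStrongProlongation_prolong hφ).1.tangent_projV (q := atU u p) hp w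
    rw [projV_atU] at h
    rw [h]
    exact ⟨rfl, rfl, rfl⟩
  have hm : ∀ u, PointTransf.map (prolong φ hφ) (atU u p) = ((PointTransf.map φ p).1,
      (PointTransf.map φ p).2.1, prolongU φ (atU 0 p) +
      u * (prolongU φ (atU 1 p) - prolongU φ (atU 0 p)), (PointTransf.map φ p).2.2) := by
    intro u
    have h1 := prolongU_eq φ (atU u p)
    rw [map_prolong hφ (q := atU u p) hp, prolongMap, h1]
    rfl
  have hv : ∀ u, projV (vecX (cylinder C).elem (atU u p) b) =
      (0, 1, 0) + u • (0, 0, C.elem.lam p.1) := by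
    intro u
    simp [vecX, atU, mul_comm, cylinder]
  have hb : ∀ u, (vecX (cylinder C).elem (atU u p) b).2.2.1 = b := fun u => rfl
  simp only [sysDefect, contactForm_apply, (key _ _).1, (key _ _).2.1, (key _ _).2.2, hℓ, hm, hv,
    hb, vtVal, map_add, map_smul, smul_eq_mul]
  simp only [atU]
  fun_prop

/-- By the identity theorem in `u`, the prolongation of a local projection of an admissible
transformation inherits the vanishing of `sysDefect` on the whole cylinder. -/
theorem IsLocalProjection.sysDefect_prolong_eq_zero {χ : A ⟶ B}
    (h : IsAdmissible potentialSystem χ) {φ : C ⟶ D} {I : Set ℝ}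
    (hφ : IsLocalProjection χ φ I) (hI : IsOpen I) {u₀ : ℝ} (hu₀ : u₀ ∈ I)
    (hC : C.elem = A.elem) (hD : D.elem = B.elem) (hf : IsFibered φ) {y : ℝ × ℝ × ℝ × ℝ}
    (hy : y ∈ (cylinder C).carrier) (b : ℝ) : sysDefect (prolong φ hf) y b = 0 := by
  have hp : projV y ∈ C.carrier := hy
  have h1 : (fun u => sysDefect (prolong φ hf) (atU u (projV y)) b) =ᶠ[𝓝 u₀] fun _ => 0 := by
    filter_upwards [hI.mem_nhds hu₀] with u hu
    have h2 := hφ.eventually_map_prolong_eq h.isProjectable hI hC hD hf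
      (y := atU u (projV y)) hp hu
    rw [sysDefect_congr hC hD h2]
    exact h.sysDefect_eq_zero (hφ (atU u (projV y)) hp hu).1 b
  exact congrFun (AnalyticOnNhd.eq_of_eventuallyEq
    (fun u _ => sysDefect_prolong_analyticAt hf hp b u) analyticOnNhd_const h1) y.2.2.1

/-- Near each point, an admissible transformation of potential systems is the prolongation of an
admissible transformation of potential equations. -/
theorem IsAdmissible.exists_eventuallyEq_prolong {χ : A ⟶ B} (h : IsAdmissible potentialSystem χ)
    {q : ℝ × ℝ × ℝ × ℝ} (hq : q ∈ A.carrier) :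
    ∃ (C D : LocalEq ℝ) (φ : C ⟶ D) (hφ : IsAdmissible potentialEquation φ),
      C.elem = A.elem ∧ D.elem = B.elem ∧ q ∈ (cylinder C).carrier ∧
      ∀ᶠ p in 𝓝 q, PointTransf.map χ p = PointTransf.map (prolong φ hφ.isFibered) p := by
  have hχ := h.isProjectable
  obtain ⟨C, D, φ, I, hC, hD, hqC, hI, hu, hφ⟩ := hχ.exists_projection hq
  have hf := hφ.isFibered hχ hI hu
  have hψ : IsAdmissible potentialSystem (prolong φ hf) :=
    (isProjectable_prolong hf).isAdmissible fun y hy b =>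
      hφ.sysDefect_prolong_eq_zero h hI hu hC hD hf hy b
  exact ⟨C, D, φ, (isStrongProlongation_prolong hf).isAdmissible_potentialEquation hψ, hC, hD, hqC,
    (hφ.eventually_map_prolong_eq hχ hI hC hD hf hqC hu).symm⟩

end Local

/-! ### The equivalence groupoids -/

theorem cylinder_injective : Function.Injective cylinder := by
  intro A B h
  have h1 : A.elem = B.elem := congrArg (fun E : LocalEq (ℝ × ℝ) => E.elem) h
  have h2 : A.carrier = B.carrier := by
    ext p
    have h3 := congrArg (fun E : LocalEq (ℝ × ℝ) => atU 0 p ∈ E.carrier) h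
    exact Iff.of_eq h3
  cases A
  cases B
  cases h1
  cases h2
  rfl

theorem IsProjection.unique {A B : LocalEq ℝ} {ψ : cylinder A ⟶ cylinder B} {φ φ' : A ⟶ B}
    (h : IsProjection ψ φ) (h' : IsProjection ψ φ') : φ = φ' :=
  ext_map fun p hp => (h p.1 p.2.1 0 p.2.2 hp).trans (h' p.1 p.2.1 0 p.2.2 hp).symm

theorem IsAdmissible.isProjection_project {A B : LocalEq ℝ} {ψ : cylinder A ⟶ cylinder B}
    (h : IsAdmissible potentialSystem ψ) :
    IsProjection ψ (project ψ h.isProjectable (isAdmissible_inv h).isProjectable) :=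
  PotentialBurgers.isProjection_project _ _

/-- The prolongation of an admissible transformation, as an admissible transformation. -/
noncomputable def admissibleProlong {A B : LocalEq ℝ}
    (φ : {φ : A ⟶ B | IsAdmissible potentialEquation φ}) :
    {ψ : cylinder A ⟶ cylinder B | IsAdmissible potentialSystem ψ} :=
  ⟨prolong φ.1 (IsAdmissible.isFibered φ.2),
    (isStrongProlongation_prolong _).isAdmissible_potentialSystem φ.2⟩

/-- The projection of an admissible transformation, as an admissible transformation. -/
noncomputable def admissibleProject {A B : LocalEq ℝ}
    (ψ : {ψ : cylinder A ⟶ cylinder B | IsAdmissible potentialSystem ψ}) :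
    {φ : A ⟶ B | IsAdmissible potentialEquation φ} :=
  ⟨project ψ.1 (IsAdmissible.isProjectable ψ.2) (isAdmissible_inv ψ.2).isProjectable,
    ((IsAdmissible.isProjection_project ψ.2).isStrongProlongation
      (IsAdmissible.isProjectable ψ.2)).isAdmissible_potentialEquation ψ.2⟩

/-- Prolongation and projection as mutually inverse maps between the admissible transformations of
potential equations and those of the corresponding potential systems. -/
noncomputable def prolongEquiv (A B : LocalEq ℝ) :
    {φ : A ⟶ B | IsAdmissible potentialEquation φ} ≃
      {ψ : cylinder A ⟶ cylinder B | IsAdmissible potentialSystem ψ} where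
  toFun := admissibleProlong
  invFun := admissibleProject
  left_inv φ := Subtype.ext ((IsAdmissible.isProjection_project (admissibleProlong φ).2).unique
    (isStrongProlongation_prolong (IsAdmissible.isFibered φ.2)).1)
  right_inv ψ := by
    have h := IsAdmissible.isProjection_project ψ.2
    have h' := IsAdmissible.isProjectable ψ.2
    exact Subtype.ext (IsStrongProlongation.eq (h.isFibered h')
      (isStrongProlongation_prolong (h.isFibered h')) (h.isStrongProlongation h'))

theorem isStrongProlongation_prolongEquiv {A B : LocalEq ℝ}
    (φ : {φ : A ⟶ B | IsAdmissible potentialEquation φ}) :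
    IsStrongProlongation φ.1 (prolongEquiv A B φ).1 :=
  isStrongProlongation_prolong (IsAdmissible.isFibered φ.2)

end

end PotentialBurgers

open PotentialBurgers in
theorem mainTheorem8 :
    ∃ (GP : Subgroupoid (LocalEq ℝ)) (GR : Subgroupoid (LocalEq (ℝ × ℝ))),
      IsEquivalenceGroupoid potentialEquation GP ∧
      IsEquivalenceGroupoid potentialSystem GR ∧
      Function.Injective cylinder ∧
      ∃ Φ : ∀ A B : LocalEq ℝ, GP.arrows A B ≃ GR.arrows (cylinder A) (cylinder B),
        -- compatibility with the groupoid operations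
        (∀ (A : LocalEq ℝ) (h : 𝟙 A ∈ GP.arrows A A), (Φ A A ⟨𝟙 A, h⟩ : cylinder A ⟶ cylinder A) = 𝟙 _) ∧
        (∀ (A B C : LocalEq ℝ) (φ : GP.arrows A B) (ψ : GP.arrows B C),
          (Φ A C ⟨φ.1 ≫ ψ.1, GP.mul φ.2 ψ.2⟩ : cylinder A ⟶ cylinder C) =
            (Φ A B φ).1 ≫ (Φ B C ψ).1) ∧
        -- the isomorphism is the prolongation, its inverse is the projection
        (∀ (A B : LocalEq ℝ) (φ : GP.arrows A B), IsProlongation φ.1 (Φ A B φ).1) ∧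
        (∀ (A B : LocalEq ℝ) (ψ : GR.arrows (cylinder A) (cylinder B)),
          IsProjection ψ.1 ((Φ A B).symm ψ).1) ∧
        -- every admissible transformation of systems, on any open set, locally arises in this way
        (∀ (A B : LocalEq (ℝ × ℝ)) (χ : GR.arrows A B), ∀ q ∈ A.carrier,
          ∃ (C D : LocalEq ℝ) (φ : GP.arrows C D), C.elem = A.elem ∧ D.elem = B.elem ∧
            q ∈ (cylinder C).carrier ∧
            ∀ᶠ p in 𝓝 q, PointTransf.map χ.1 p = PointTransf.map (Φ C D φ).1 p) := by
  refine ⟨equivalenceGroupoid potentialEquation fun φ h => h.isFibered.preservesGraphs,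
    equivalenceGroupoid potentialSystem fun φ h => h.isProjectable.preservesGraphs,
    isEquivalenceGroupoid_equivalenceGroupoid _ potentialEquation_congr _,
    isEquivalenceGroupoid_equivalenceGroupoid _ potentialSystem_congr _, cylinder_injective,
    prolongEquiv, fun A h => ?_, fun A B C φ ψ => ?_, fun A B φ => ?_, fun A B ψ => ?_,
    fun A B χ q hq => ?_⟩
  · exact (isStrongProlongation_prolongEquiv ⟨𝟙 A, h⟩).eq_id
  · exact (isStrongProlongation_prolongEquiv φ).eq_comp (IsAdmissible.isFibered φ.2)
      (IsAdmissible.isFibered ψ.2) (isStrongProlongation_prolongEquiv ψ)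
      (isStrongProlongation_prolongEquiv ⟨φ.1 ≫ ψ.1, _⟩)
  · exact (isStrongProlongation_prolongEquiv φ).isProlongation
  · exact IsAdmissible.isProjection_project ψ.2
  · obtain ⟨C, D, φ, hφ, hC, hD, hqC, he⟩ := IsAdmissible.exists_eventuallyEq_prolong χ.2 hq
    exact ⟨C, D, ⟨φ, hφ⟩, hC, hD, hqC, he⟩
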